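/- **Theorem 5.** Let $\Upsilon\subset\mathbb R^p$ and $\Gamma\subset\mathbb R^d$ be compact, $f:\Upsilon\times\Gamma\to\mathbb R$, and let $\beta^0$ be an interior point of $\Gamma$. Let $(X_i,\varepsilon_i,\delta_i)_{i\ge1}$ be independent and identically distributed, with $X_i\in\Upsilon$, $\varepsilon_i\in\mathbb R$, $\delta_i\in\{0,1\}$ and $(\varepsilon_i,X_i)$ having a law absolutely continuous with respect to Lebesgue measure, and let $Y_i=f(X_i;\beta^0)+\varepsilon_i$; the response $Y_i$ is observed if $\delta_i=1$ and missing if $\delta_i=0$. Assume that * (identifiability) if $\beta,\beta^*\in\Gamma$ and $f(X;\beta)=f(X;\beta^*)$ almost surely, then $\beta=\beta^*$; * (missing at random) $P[\delta_i=1\mid X_i,Y_i]=P[\delta_i=1\mid X_i]=\pi(X_i)$, where $\pi$ is bounded below on $\Upsilon$ by a positive constant. Let $\hat\beta_n$ be a (measurable) least squares estimator on the observed data, $\hat\beta_n\in\arg\min_{\beta\in\Gamma}\sum_{i=1}^n\delta_i[Y_i-f(X_i;\beta)]^2$. For a kernel $K:\mathbb R^p\to\mathbb R$ and bandwidths $h_n>0$,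 $h_n\to0$, put $$\hat\pi(x)=\frac{\sum_{j=1}^n\delta_jK((X_j-x)/h_n)}{\max\{1,\sum_{j=1}^nK((X_j-x)/h_n)\}},\qquad Y_{n,i}=\frac{\delta_i}{\hat\pi(X_i)}Y_i+\Bigl(1-\frac{\delta_i}{\hat\pi(X_i)}\Bigr)f(X_i;\hat\beta_n)$$ (with $\delta_i/\hat\pi(X_i)=0$ if $\delta_i=0$), and with $\dot f,\ddot f$ the first and second derivatives of $f$ in $\beta$, put $g_{n,i}(\beta)=[Y_{n,i}-f(X_i;\beta)]\,\dot f(X_i;\beta)$ and $$\hat l_n(\beta)=-2\sup\Bigl\{\sum_{i=1}^n\log(np_i):\ (p_1,\dots,p_n)\in(0,1)^n,\ \sum_{i=1}^np_i=1,\ \sum_{i=1}^np_i\,g_{n,i}(\beta)=0\Bigr\}\in[0,\infty]$$ ($\hat l_n(\beta)=\infty$ if there is no such $(p_1,\dots,p_n)$). Let $q\ge0$ be an integer with $p\le2q$ (for instance $q=p$, or $q=d$ if $p\le 2d$) and $(M_n)$ a positive sequence with $M_n\to\infty$. Suppose that * (H1) $E[\varepsilon_i\mid X_i]=0$ and $E[\varepsilon_i^2]<\infty$;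 * (H2) for each $x\in\Upsilon$, $f(x;\cdot)$ is continuous on $\Gamma$ and twice differentiable in the interior of $\Gamma$; for each $\beta\in\Gamma$, $f(\cdot;\beta)$ is continuous on $\Upsilon$; * (H3) $P[\|X\|>M'_n]=o(n^{-1/2})$ for every positive sequence $M'_n\to\infty$; * (H4) $\|\dot f(x;\beta)\|$ and $\|\ddot f(x;\beta)\|$ are bounded over $x\in\Upsilon$ and $\beta$ in a neighbourhood of $\beta^0$; * (HA) the matrix $A=E[\pi(X)\dot f(X;\beta^0)\dot f(X;\beta^0)^t]$ is positive definite; * (H5) $nh_n^{2q}M_n^{-2q}\to\infty$ and $nh_n^{4\max\{2,q-1\}}\to0$; * (H6) there are constants $C_1,C_2,\rho>0$ with $C_1\mathbf 1_{\|u\|\le\rho}\le K(u)\le C_2\mathbf 1_{\|u\|\le\rho}$ for all $u$; * (H7) at Lebesgue-almost every interior point of $\Upsilon$, the partial derivatives of $\pi$ of orders up to $\max\{2,q-1\}$ exist, and they are bounded. Then $\hat l_n(\beta^0)$ converges in distribution, as $n\to\infty$, to the chi-squared law $\chi^2(d)$ with $d$ degrees of freedom. -/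

import Mathlib

open MeasureTheory ProbabilityTheory Filter Topology Asymptotics
open scoped BigOperators

noncomputable section

/-- The chi-squared law with `d` degrees of freedom: the law of the sum of the squares of `d`
independent standard normal variables. -/
def chiSquared (d : ℕ) : Measure ℝ :=
  (Measure.pi fun _ : Fin d => gaussianReal 0 1).map fun z => ∑ a, z a ^ 2

instance chiSquared.instIsProbabilityMeasure (d : ℕ) : IsProbabilityMeasure (chiSquared d) :=
  Measure.isProbabilityMeasure_map
    (Measurable.aemeasurable (by fun_prop))

/-- The sum of squared residuals over the observed responses,
`∑ δ_i [Y_i - f(X_i, β)]²`, for a sample `(x_i, y_i, δ_i)` of size `n`. -/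
def sumSq {p d n : ℕ} (f : EuclideanSpace ℝ (Fin p) → EuclideanSpace ℝ (Fin d) → ℝ)
    (x : Fin n → EuclideanSpace ℝ (Fin p)) (y δ : Fin n → ℝ) (β : EuclideanSpace ℝ (Fin d)) : ℝ :=
  ∑ i, δ i * (y i - f (x i) β) ^ 2

/-- The kernel estimate at the point `t` of the selection probability, with bandwidth `h`:
`∑ δ_j K((x_j - t)/h) / max{1, ∑ K((x_j - t)/h)}`. -/
def piHat {p n : ℕ} (K : EuclideanSpace ℝ (Fin p) → ℝ) (h : ℝ)
    (x : Fin n → EuclideanSpace ℝ (Fin p)) (δ : Fin n → ℝ) (t : EuclideanSpace ℝ (Fin p)) : ℝ :=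
  (∑ j, δ j * K (h⁻¹ • (x j - t))) / max 1 (∑ j, K (h⁻¹ • (x j - t)))

/-- The reconstituted response `(δ_i/π̂(x_i)) y_i + (1 - δ_i/π̂(x_i)) f(x_i; b)`, where `b` is the
estimate of the parameter. When `δ_i = 0` the quotient `δ_i/π̂(x_i)` is `0`, also if `π̂(x_i) = 0`;
when `δ_i = 1`, `π̂(x_i) > 0` as soon as `K ≥ 0` and `K(0) > 0`. -/
def imputed {p d n : ℕ} (f : EuclideanSpace ℝ (Fin p) → EuclideanSpace ℝ (Fin d) → ℝ)
    (K : EuclideanSpace ℝ (Fin p) → ℝ) (h : ℝ)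
    (x : Fin n → EuclideanSpace ℝ (Fin p)) (y δ : Fin n → ℝ) (b : EuclideanSpace ℝ (Fin d))
    (i : Fin n) : ℝ :=
  δ i / piHat K h x δ (x i) * y i + (1 - δ i / piHat K h x δ (x i)) * f (x i) b

/-- The estimating function `g_{n,i}(β) = [Y_{n,i} - f(x_i; β)] ḟ(x_i; β)`, with `ḟ` the gradient
in the parameter. -/
def gImputed {p d n : ℕ} (f : EuclideanSpace ℝ (Fin p) → EuclideanSpace ℝ (Fin d) → ℝ)
    (K : EuclideanSpace ℝ (Fin p) → ℝ) (h : ℝ)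
    (x : Fin n → EuclideanSpace ℝ (Fin p)) (y δ : Fin n → ℝ) (b β : EuclideanSpace ℝ (Fin d))
    (i : Fin n) : EuclideanSpace ℝ (Fin d) :=
  (imputed f K h x y δ b i - f (x i) β) • gradient (f (x i)) β

/-- The empirical log-likelihood ratio of `g_1, …, g_n`,
`-2 sup {∑ log(n p_i) : p ∈ (0,1)^n, ∑ p_i = 1, ∑ p_i g_i = 0}`, as an extended real number
(so it is `⊤` when no such `p` exists). -/
def empLogLik {d n : ℕ} (g : Fin n → EuclideanSpace ℝ (Fin d)) : EReal :=
  (-2 : ℝ) * sSup {s : EReal | ∃ w : Fin n → ℝ, (∀ i, w i ∈ Set.Ioo (0 : ℝ) 1) ∧ ∑ i, w i = 1 ∧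
    ∑ i, w i • g i = 0 ∧ s = ((∑ i, Real.log (n * w i) : ℝ) : EReal)}

/-- The iterated partial derivative of `u` along the coordinate directions in the list, the head
of the list being the last differentiation performed. -/
def iterPartial {p : ℕ} (u : EuclideanSpace ℝ (Fin p) → ℝ) :
    List (Fin p) → EuclideanSpace ℝ (Fin p) → ℝ
  | [] => u
  | a :: l => fun x => lineDeriv ℝ (iterPartial u l) x (EuclideanSpace.single a 1)

/-- On `S`, almost everywhere for Lebesgue measure, all partial derivatives of `u` of orders at
most `m` exist, and they are bounded. -/
def HasBoundedPartialsAE {p : ℕ} (u : EuclideanSpace ℝ (Fin p) → ℝ)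
    (S : Set (EuclideanSpace ℝ (Fin p))) (m : ℕ) : Prop :=
  ∃ C : ℝ, ∀ᵐ x ∂(volume.restrict S), ∀ l : List (Fin p),
    (l.length ≤ m → |iterPartial u l x| ≤ C) ∧
    (l.length < m → ∀ a, LineDifferentiableAt ℝ (iterPartial u l) x (EuclideanSpace.single a 1))

end

/-!
With `Δ i = f (X i) β̂ - f (X i) β₀` and the estimated weight `δ i / π̂ (X i)`, the estimating
function at `β₀` is `{(δ i / π̂ (X i)) ε i + (1 - δ i / π̂ (X i)) Δ i} ḟ (X i)`. The point of the
proof is that it may be replaced by `ξ i = (δ i / π (X i)) ε i ḟ (X i)`, a sequence of independent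
identically distributed centred vectors: if `n⁻¹ ∑ ‖g i - ξ i‖²` and `n^{-1/2} ∑ (g i - ξ i)` tend
to zero in probability, then the empirical log-likelihood ratio of the `g i` has the limit law of
`‖n^{-1/2} ∑ V^{-1/2} ξ i‖²`, with `V` the covariance of `ξ 0`, which is chi-squared
(`empLogLik_tendsto`). This rests on two explicit bounds for the ratio, whose errors are governed by
`n^{-1/2} max ‖g i‖` (`empLogLik_approx`). Convergence in probability is convergence along the
filter `inProb P`.

The weights. The error `δ i / π̂ (X i) - δ i / π (X i)` is studied conditionally on the `i`-th unit,
whose covariate is `x`, through the expected number `n μ(B(x, ρ h))` of neighbours, `μ` the law of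
`X`, and the mean oscillation of `π` on `B(x, ρ h)` (`exists_lintegral_ratio_sq_le`). For almost all
`x` the former tends to infinity, since `μ(B(x, r))` is at least of the order of `r ^ p` and
`n h ^ p → ∞`, and the latter tends to zero by Lebesgue's differentiation theorem; so the errors
tend to zero in mean square without any smoothness of `π` and without any rate
(`tendsto_lintegral_weightErr_sq`). That suffices for the sum of the `ε i` times the errors of the
weights, because its summands are uncorrelated: the errors `ε i` are centred given all covariates
and all indicators of observation (`tendsto_inProb_sum_mul_weightErr`).

The parameter. The least squares estimator is consistent by Wald's argument
(`tendsto_inProb_of_contrast`) and root-`n` consistent by comparing the sums of squares at `β̂` and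
`β₀` through a second-order expansion of `f` (`bddInProb_sqrt_mul_norm_sub`). The `Δ i` are thus of
order `n^{-1/2}`, and their contribution `n^{-1/2} ∑ (1 - δ i / π (X i)) Δ i ḟ (X i)` is negligible
because `1 - δ i / π (X i)` has mean zero given `X i` (`tendsto_inProb_sqrt_sum_scoreErr`).
-/

/-! ### Convergence and boundedness in probability -/

section InProb

variable {Ω : Type*} [MeasurableSpace Ω]

/-- The filter on `ℕ × Ω` of the sets whose `n`-th section has a complement of measure tending
to `0`. Convergence in probability of `X` is convergence along this filter, so that the whole
calculus of limits applies to it; no measurability is involved. -/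
def inProb (P : Measure Ω) : Filter (ℕ × Ω) where
  sets := {A | Tendsto (fun n => P {ω | (n, ω) ∉ A}) atTop (𝓝 0)}
  univ_sets := by simp
  sets_of_superset := by
    intro A B hA hAB
    refine tendsto_of_tendsto_of_tendsto_of_le_of_le tendsto_const_nhds hA (fun _ => zero_le) ?_
    exact fun n => measure_mono fun ω hω hA => hω (hAB hA)
  inter_sets := by
    intro A B hA hB
    have h := Tendsto.add hA hB
    rw [add_zero] at h
    refine tendsto_of_tendsto_of_tendsto_of_le_of_le tendsto_const_nhds h (fun _ => zero_le) ?_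
    intro n
    refine (measure_mono ?_).trans (measure_union_le _ _)
    intro ω hω
    by_cases h' : (n, ω) ∈ A
    · exact Or.inr fun h'' => hω ⟨h', h''⟩
    · exact Or.inl h'

lemma eventually_inProb {P : Measure Ω} {p : ℕ × Ω → Prop} :
    (∀ᶠ a in inProb P, p a) ↔ Tendsto (fun n => P {ω | ¬ p (n, ω)}) atTop (𝓝 0) := Iff.rfl

lemma tendsto_fst_inProb (P : Measure Ω) : Tendsto Prod.fst (inProb P) atTop := by
  intro A hA
  refine tendsto_const_nhds.congr' ?_
  filter_upwards [hA] with n hn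
  simp [hn]

lemma tendsto_inProb_iff {P : Measure Ω} {E : Type*} [PseudoMetricSpace E] {X : ℕ × Ω → E}
    {c : E} : Tendsto X (inProb P) (𝓝 c) ↔
      ∀ η > 0, Tendsto (fun n => P {ω | η ≤ dist (X (n, ω)) c}) atTop (𝓝 0) := by
  rw [Metric.tendsto_nhds]
  refine forall₂_congr fun η _ => ?_
  rw [eventually_inProb]
  simp only [not_lt]

lemma tendsto_inProb_iff_tendstoInMeasure {P : Measure Ω} {E : Type*} [PseudoMetricSpace E]
    {X : ℕ → Ω → E} {c : E} : Tendsto (fun a : ℕ × Ω => X a.1 a.2) (inProb P) (𝓝 c) ↔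
      TendstoInMeasure P X atTop (fun _ => c) := by
  rw [tendsto_inProb_iff, tendstoInMeasure_iff_dist]

lemma tendsto_inProb_of_ae {P : Measure Ω} [IsFiniteMeasure P] {E : Type*} [PseudoMetricSpace E]
    {X : ℕ → Ω → E} {c : E} (hX : ∀ n, AEStronglyMeasurable (X n) P)
    (h : ∀ᵐ ω ∂P, Tendsto (fun n => X n ω) atTop (𝓝 c)) :
    Tendsto (fun a : ℕ × Ω => X a.1 a.2) (inProb P) (𝓝 c) :=
  tendsto_inProb_iff_tendstoInMeasure.2 (tendstoInMeasure_of_tendsto_ae hX h)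

/-- Convergence to `0` in the mean implies convergence in probability. -/
lemma tendsto_inProb_of_lintegral {P : Measure Ω} {X : ℕ → Ω → ℝ} {b : ℕ → ENNReal}
    (hm : ∀ n, AEMeasurable (X n) P)
    (h : ∀ᶠ n in atTop, ∫⁻ ω, ENNReal.ofReal |X n ω| ∂P ≤ b n) (hb : Tendsto b atTop (𝓝 0)) :
    Tendsto (fun a : ℕ × Ω => X a.1 a.2) (inProb P) (𝓝 0) := by
  rw [tendsto_inProb_iff]
  intro η hη
  have hη' : ENNReal.ofReal η ≠ 0 := by simpa using hη
  have h2 : Tendsto (fun n => b n / ENNReal.ofReal η) atTop (𝓝 0) := by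
    have := ENNReal.Tendsto.div_const hb (b := ENNReal.ofReal η) (Or.inr hη')
    simpa using this
  refine tendsto_of_tendsto_of_tendsto_of_le_of_le' tendsto_const_nhds h2
    (Eventually.of_forall fun _ => zero_le) ?_
  filter_upwards [h] with n hn
  calc P {ω | η ≤ dist (X n ω) 0}
      ≤ P {ω | ENNReal.ofReal η ≤ ENNReal.ofReal |X n ω|} := by
        refine measure_mono fun ω hω => ?_
        simp only [Real.dist_eq, sub_zero, Set.mem_ofPred_eq] at hω ⊢
        exact ENNReal.ofReal_le_ofReal hω
    _ ≤ (∫⁻ ω, ENNReal.ofReal |X n ω| ∂P) / ENNReal.ofReal η :=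
        meas_ge_le_lintegral_div (by have := hm n; fun_prop) hη' ENNReal.ofReal_ne_top
    _ ≤ b n / ENNReal.ofReal η := by gcongr

/-- Boundedness in probability, `X = O_P(1)`, expressed by `X Y → 0` in probability whenever
`Y → 0` in probability. -/
def BddInProb (P : Measure Ω) (X : ℕ × Ω → ℝ) : Prop :=
  ∀ Y : ℕ × Ω → ℝ, Tendsto Y (inProb P) (𝓝 0) → Tendsto (fun a => X a * Y a) (inProb P) (𝓝 0)

lemma BddInProb.of_le {P : Measure Ω} {X X' : ℕ × Ω → ℝ} (hX : BddInProb P X)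
    (h : ∀ᶠ a in inProb P, |X' a| ≤ |X a|) : BddInProb P X' := by
  intro Y hY
  have h1 := (hX Y hY).abs
  rw [abs_zero] at h1
  refine squeeze_zero_norm' ?_ h1
  filter_upwards [h] with a ha
  rw [Real.norm_eq_abs, abs_mul, abs_mul]
  gcongr

lemma BddInProb.add {P : Measure Ω} {X X' : ℕ × Ω → ℝ} (hX : BddInProb P X)
    (hX' : BddInProb P X') : BddInProb P (fun a => X a + X' a) := by
  intro Y hY
  simpa [add_mul] using (hX Y hY).add (hX' Y hY)

lemma BddInProb.mul {P : Measure Ω} {X X' : ℕ × Ω → ℝ} (hX : BddInProb P X)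
    (hX' : BddInProb P X') : BddInProb P (fun a => X a * X' a) := by
  intro Y hY
  simpa [mul_assoc] using hX _ (hX' Y hY)

lemma BddInProb.abs {P : Measure Ω} {X : ℕ × Ω → ℝ} (hX : BddInProb P X) :
    BddInProb P (fun a => |X a|) :=
  hX.of_le (by simp)

lemma BddInProb.finset_sum {P : Measure Ω} {ι : Type*} (s : Finset ι) {X : ι → ℕ × Ω → ℝ}
    (h : ∀ i ∈ s, BddInProb P (X i)) : BddInProb P (fun a => ∑ i ∈ s, X i a) := by
  intro Y hY
  simp only [Finset.sum_mul]
  simpa using tendsto_finsetSum s fun i hi => h i hi Y hY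

lemma bddInProb_of_tendsto {P : Measure Ω} {X : ℕ × Ω → ℝ} {c : ℝ}
    (hX : Tendsto X (inProb P) (𝓝 c)) : BddInProb P X := by
  intro Y hY
  simpa using hX.mul hY

lemma bddInProb_const {P : Measure Ω} (c : ℝ) : BddInProb P (fun _ => c) :=
  bddInProb_of_tendsto tendsto_const_nhds

lemma BddInProb.const_mul {P : Measure Ω} {X : ℕ × Ω → ℝ} (hX : BddInProb P X) (c : ℝ) :
    BddInProb P (fun a => c * X a) :=
  (bddInProb_const c).mul hX

/-- Bounded second moments imply boundedness in probability. -/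
lemma bddInProb_of_lintegral_sq {P : Measure Ω} {X : ℕ → Ω → ℝ} {C : ENNReal} (hC : C ≠ ⊤)
    (hm : ∀ n, AEMeasurable (X n) P)
    (h : ∀ᶠ n in atTop, ∫⁻ ω, ENNReal.ofReal (X n ω ^ 2) ∂P ≤ C) :
    BddInProb P (fun a => X a.1 a.2) := by
  intro Y hY
  rw [tendsto_inProb_iff]
  intro η hη
  rw [ENNReal.tendsto_nhds_zero]
  intro κ hκ
  -- a level `L` beyond which `X` lies with probability at most `κ / 2`
  obtain ⟨L, hL, hLκ⟩ : ∃ L : ℝ, 0 < L ∧ C / ENNReal.ofReal (L ^ 2) ≤ κ / 2 := by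
    have h1 : Tendsto (fun L : ℝ => C / ENNReal.ofReal (L ^ 2)) atTop (𝓝 0) := by
      refine ENNReal.Tendsto.const_div (b := ⊤) ?_ (Or.inr hC) |>.trans_eq (by simp)
      exact ENNReal.tendsto_ofReal_atTop.comp (tendsto_pow_atTop two_ne_zero)
    have h2 := (ENNReal.tendsto_nhds_zero.1 h1 (κ / 2) (ENNReal.half_pos hκ.ne'))
    obtain ⟨L, h3, h4⟩ := (h2.and (eventually_gt_atTop 0)).exists
    exact ⟨L, h4, h3⟩
  have hY' := ENNReal.tendsto_nhds_zero.1 (tendsto_inProb_iff.1 hY (η / L) (by positivity)) (κ / 2)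
    (ENNReal.half_pos hκ.ne')
  filter_upwards [hY', h] with n hn hn2
  have h5 : P {ω | ENNReal.ofReal (L ^ 2) ≤ ENNReal.ofReal (X n ω ^ 2)} ≤ κ / 2 := by
    refine le_trans (meas_ge_le_lintegral_div (by have := hm n; fun_prop) (by simp; positivity)
      ENNReal.ofReal_ne_top) (le_trans ?_ hLκ)
    gcongr
  calc P {ω | η ≤ dist (X n ω * Y (n, ω)) 0}
      ≤ P ({ω | ENNReal.ofReal (L ^ 2) ≤ ENNReal.ofReal (X n ω ^ 2)} ∪
          {ω | η / L ≤ dist (Y (n, ω)) 0}) := by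
        refine measure_mono fun ω hω => ?_
        simp only [Real.dist_eq, sub_zero, Set.mem_ofPred_eq, Set.mem_union] at hω ⊢
        by_contra hcon
        push Not at hcon
        obtain ⟨h6, h7⟩ := hcon
        have h8 : |X n ω| < L := by
          rw [ENNReal.ofReal_lt_ofReal_iff (by positivity)] at h6
          exact abs_lt_of_sq_lt_sq h6 hL.le
        have : |X n ω * Y (n, ω)| < η := by
          rw [abs_mul]
          calc |X n ω| * |Y (n, ω)| ≤ L * |Y (n, ω)| := by gcongr
            _ < L * (η / L) := by gcongr
            _ = η := by field_simp
        linarith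
    _ ≤ κ / 2 + κ / 2 := (measure_union_le _ _).trans (add_le_add h5 hn)
    _ = κ := ENNReal.add_halves κ

/-- The law of large numbers, along `inProb`. -/
lemma tendsto_inProb_average {P : Measure Ω} [IsProbabilityMeasure P] {E : Type*}
    [NormedAddCommGroup E] [NormedSpace ℝ E] [CompleteSpace E] [MeasurableSpace E] [BorelSpace E]
    {X : ℕ → Ω → E} (hint : Integrable (X 0) P) (hindep : iIndepFun X P)
    (hident : ∀ i, IdentDistrib (X i) (X 0) P P) :
    Tendsto (fun a : ℕ × Ω => (a.1 : ℝ)⁻¹ • ∑ i : Fin a.1, X i a.2) (inProb P)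
      (𝓝 (∫ ω, X 0 ω ∂P)) := by
  have h := strong_law_ae X hint (fun i j hij => hindep.indepFun hij) hident
  have h2 : ∀ i, AEStronglyMeasurable (X i) P := fun i =>
    ((hident i).integrable_iff.2 hint).1
  have := tendsto_inProb_of_ae (P := P)
    (X := fun n ω => (n : ℝ)⁻¹ • ∑ i ∈ Finset.range n, X i ω) (fun n => by fun_prop) h
  refine this.congr fun a => ?_
  rw [Finset.sum_range]

end InProb

/-! ### Quadratic approximation of the empirical log-likelihood ratio -/

section Deterministic

lemma log_one_add_ge {x κ : ℝ} (hx : |x| ≤ κ) (hκ : κ ≤ 1 / 2) :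
    x - x ^ 2 / 2 * (1 + 4 * κ) ≤ Real.log (1 + x) := by
  have h1 : |x| < 1 := by linarith
  have h := Real.abs_log_sub_add_sum_range_le (x := -x) (by simpa using h1) 2
  simp only [Finset.sum_range_succ, Finset.sum_range_zero, abs_neg, sub_neg_eq_add] at h
  have h2 : |x| ^ (2 + 1) / (1 - |x|) ≤ 2 * κ * x ^ 2 := by
    rw [div_le_iff₀ (by linarith)]
    have h3 : |x| ^ (2 + 1) = |x| * x ^ 2 := by rw [← sq_abs x]; ring
    rw [h3]
    have h4 : |x| ≤ 2 * κ * (1 - |x|) := by nlinarith [abs_nonneg x]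
    nlinarith [sq_nonneg x]
  have h5 := (abs_le.1 (h.trans h2)).1
  norm_num at h5
  linarith

variable {d n : ℕ}

local notation "E" => EuclideanSpace ℝ (Fin d)

/-- Weak duality: every `l` with all `1 + ⟪l, g i⟫` positive bounds the log-likelihood of all
admissible weights. -/
lemma sum_log_weights_le (g : Fin n → E) (l : E) (hl : ∀ i, 0 < 1 + inner ℝ l (g i))
    (w : Fin n → ℝ) (hw : ∀ i, 0 < w i) (hw1 : ∑ i, w i = 1) (hwg : ∑ i, w i • g i = 0)
    (hn : 0 < n) :
    ∑ i, Real.log (n * w i) ≤ -∑ i, Real.log (1 + inner ℝ l (g i)) := by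
  have hn' : (0 : ℝ) < n := by exact_mod_cast hn
  have h1 : ∀ i, Real.log (n * w i) ≤ (n * w i * (1 + inner ℝ l (g i)) - 1)
      - Real.log (1 + inner ℝ l (g i)) := by
    intro i
    have h2 : 0 < n * w i := mul_pos hn' (hw i)
    have h3 := Real.log_le_sub_one_of_pos (mul_pos h2 (hl i))
    rw [Real.log_mul h2.ne' (hl i).ne'] at h3
    linarith
  have h4 : ∑ i, (n * w i * (1 + inner ℝ l (g i)) - 1) = 0 := by
    have h5 : ∑ i, w i * inner ℝ l (g i) = 0 := by
      have := congrArg (inner ℝ l) hwg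
      simpa [inner_sum, inner_smul_right] using this
    have h6 : ∀ i, n * w i * (1 + inner ℝ l (g i)) - 1 =
      n * w i + n * (w i * inner ℝ l (g i)) - 1 := fun i => by ring
    simp only [h6, Finset.sum_sub_distrib, Finset.sum_add_distrib, ← Finset.mul_sum, hw1, h5]
    simp
  calc ∑ i, Real.log (n * w i) ≤ ∑ i, ((n * w i * (1 + inner ℝ l (g i)) - 1)
      - Real.log (1 + inner ℝ l (g i))) := Finset.sum_le_sum fun i _ => h1 i
    _ = -∑ i, Real.log (1 + inner ℝ l (g i)) := by
      rw [Finset.sum_sub_distrib, h4, zero_sub]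

/-- A vector `t` solving the linear equation `S t = ḡ`, with `S` the empirical covariance matrix,
when `n⁻¹ ∑ gᵢ gᵢᵗ` is close to the identity. -/
lemma exists_covariance_solve (g : Fin n → E) (gb : E) (hgb : gb = (n : ℝ)⁻¹ • ∑ i, g i)
    (hn : 0 < n) {κ : ℝ} (hκ : κ ≤ 1 / 16)
    (hQ : ∀ u : E, |(n : ℝ)⁻¹ * ∑ i, inner ℝ u (g i) ^ 2 - ‖u‖ ^ 2| ≤ κ * ‖u‖ ^ 2)
    (hg : ‖gb‖ ^ 2 ≤ κ) :
    ∃ t : E, (n : ℝ)⁻¹ • ∑ i, inner ℝ t (g i - gb) • (g i - gb) = gb ∧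
      (n : ℝ)⁻¹ * ∑ i, inner ℝ t (g i - gb) ^ 2 = inner ℝ t gb ∧
      (1 - 2 * κ) * ‖t‖ ^ 2 ≤ inner ℝ t gb := by
  have hn' : (n : ℝ) ≠ 0 := by positivity
  have hQc : ∀ u : E, (n : ℝ)⁻¹ * ∑ i, inner ℝ u (g i - gb) ^ 2 =
      (n : ℝ)⁻¹ * ∑ i, inner ℝ u (g i) ^ 2 - inner ℝ u gb ^ 2 := by
    intro u
    have h1 : ∑ i, inner ℝ u (g i) = n * inner ℝ u gb := by
      rw [hgb, inner_smul_right, inner_sum]; field_simp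
    have h2 : ∀ i, inner ℝ u (g i - gb) ^ 2 = inner ℝ u (g i) ^ 2
        - 2 * inner ℝ u gb * inner ℝ u (g i) + inner ℝ u gb ^ 2 := by
      intro i; rw [inner_sub_right]; ring
    simp only [h2, Finset.sum_add_distrib, Finset.sum_sub_distrib, ← Finset.mul_sum, h1]
    simp
    field_simp
    ring
  have hlow : ∀ u : E, (1 - 2 * κ) * ‖u‖ ^ 2 ≤ (n : ℝ)⁻¹ * ∑ i, inner ℝ u (g i - gb) ^ 2 := by
    intro u
    rw [hQc]
    have h1 := (abs_le.1 (hQ u)).1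
    have h2 : inner ℝ u gb ^ 2 ≤ ‖u‖ ^ 2 * κ := by
      have h3 := abs_real_inner_le_norm u gb
      calc inner ℝ u gb ^ 2 = |inner ℝ u gb| ^ 2 := (sq_abs _).symm
        _ ≤ (‖u‖ * ‖gb‖) ^ 2 := by gcongr
        _ = ‖u‖ ^ 2 * ‖gb‖ ^ 2 := by ring
        _ ≤ ‖u‖ ^ 2 * κ := by gcongr
    linarith
  let T : E →ₗ[ℝ] E :=
    { toFun := fun u => (n : ℝ)⁻¹ • ∑ i, inner ℝ u (g i - gb) • (g i - gb)
      map_add' := by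
        intro u v
        simp only [inner_add_left, add_smul, Finset.sum_add_distrib, smul_add]
      map_smul' := by
        intro c u
        simp only [inner_smul_left, mul_smul, ← Finset.smul_sum, RingHom.id_apply]
        rw [smul_comm]; rfl }
  have hTin : ∀ u : E, inner ℝ u (T u) = (n : ℝ)⁻¹ * ∑ i, inner ℝ u (g i - gb) ^ 2 := by
    intro u
    change inner ℝ u ((n : ℝ)⁻¹ • ∑ i, inner ℝ u (g i - gb) • (g i - gb)) = _
    simp only [inner_smul_right, inner_sum, sq]
  have hinj : Function.Injective T := by
    rw [injective_iff_map_eq_zero]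
    intro u hu
    have h1 := hlow u
    rw [← hTin, hu, inner_zero_right] at h1
    have h2 : ‖u‖ ^ 2 ≤ 0 := by nlinarith [sq_nonneg ‖u‖]
    have h3 : ‖u‖ = 0 := by nlinarith [norm_nonneg u]
    exact norm_eq_zero.1 h3
  obtain ⟨t, ht⟩ := LinearMap.injective_iff_surjective.1 hinj gb
  refine ⟨t, ht, ?_, ?_⟩
  · rw [← hTin, ht]
  · have h1 := hlow t
    rwa [← hTin, ht] at h1

/-- For centred and normalised data the empirical log-likelihood ratio is `n ‖ḡ‖²`, up to a small
relative error. The lower bound is weak duality at the multiplier `ḡ`; the upper bound comes from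
the weights `n wᵢ = 1 - ⟪t, gᵢ - ḡ⟫` with `S t = ḡ`, which are admissible. -/
theorem empLogLik_approx (g : Fin n → E) (gb : E) (hgb : gb = (n : ℝ)⁻¹ • ∑ i, g i)
    (hn : 2 ≤ n) {κ : ℝ} (hκ : κ ≤ 1 / 16)
    (hQ : ∀ u : E, |(n : ℝ)⁻¹ * ∑ i, inner ℝ u (g i) ^ 2 - ‖u‖ ^ 2| ≤ κ * ‖u‖ ^ 2)
    (hg : ‖gb‖ ^ 2 ≤ κ) (hmax : ∀ i, ‖g i‖ * ‖gb‖ ≤ κ) :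
    ∃ r : ℝ, empLogLik g = (r : EReal) ∧ |r - n * ‖gb‖ ^ 2| ≤ 100 * κ * (n * ‖gb‖ ^ 2) := by
  have hn0 : 0 < n := by omega
  have hn' : (0 : ℝ) < n := by exact_mod_cast hn0
  have hn2 : (2 : ℝ) ≤ n := by exact_mod_cast hn
  have hκ0 : 0 ≤ κ := (sq_nonneg _).trans hg
  have hτ : 0 ≤ n * ‖gb‖ ^ 2 := by positivity
  -- lower bound
  have hx : ∀ i, |inner ℝ gb (g i)| ≤ κ := fun i =>
    (abs_real_inner_le_norm _ _).trans (by rw [mul_comm]; exact hmax i)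
  have hlower : ∀ w : Fin n → ℝ, (∀ i, w i ∈ Set.Ioo (0 : ℝ) 1) → ∑ i, w i = 1 →
      ∑ i, w i • g i = 0 → ∑ i, Real.log (n * w i) ≤ -((1 - 6 * κ) * (n * ‖gb‖ ^ 2)) / 2 := by
    intro w hw hw1 hwg
    refine (sum_log_weights_le g gb (fun i => ?_) w (fun i => (hw i).1) hw1 hwg hn0).trans ?_
    · have := (abs_le.1 (hx i)).1; linarith
    have h1 : ∑ i, (inner ℝ gb (g i) - inner ℝ gb (g i) ^ 2 / 2 * (1 + 4 * κ)) ≤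
        ∑ i, Real.log (1 + inner ℝ gb (g i)) :=
      Finset.sum_le_sum fun i _ => log_one_add_ge (hx i) (by linarith)
    have h2 : ∑ i, inner ℝ gb (g i) = n * ‖gb‖ ^ 2 := by
      rw [← inner_sum, ← real_inner_self_eq_norm_sq]
      nth_rw 3 [hgb]
      rw [inner_smul_right]; field_simp
    have h3 : ∑ i, inner ℝ gb (g i) ^ 2 ≤ (1 + κ) * (n * ‖gb‖ ^ 2) := by
      have h4 := (abs_le.1 (hQ gb)).2
      have h5 : (n : ℝ)⁻¹ * ∑ i, inner ℝ gb (g i) ^ 2 ≤ (1 + κ) * ‖gb‖ ^ 2 := by linarith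
      rw [inv_mul_le_iff₀ hn'] at h5
      linarith
    rw [Finset.sum_sub_distrib, h2, ← Finset.sum_mul, ← Finset.sum_div] at h1
    have h6 : (∑ i, inner ℝ gb (g i) ^ 2) / 2 * (1 + 4 * κ) ≤
        ((1 + κ) * (n * ‖gb‖ ^ 2)) / 2 * (1 + 4 * κ) := by gcongr
    have h7 : 0 ≤ κ * (1 - 4 * κ) * (n * ‖gb‖ ^ 2) :=
      mul_nonneg (mul_nonneg hκ0 (by linarith)) hτ
    nlinarith
  -- upper bound
  obtain ⟨t, ht, htQ, htn⟩ := exists_covariance_solve g gb hgb hn0 hκ hQ hg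
  have htgb : inner ℝ t gb ≤ ‖t‖ * ‖gb‖ := (le_abs_self _).trans (abs_real_inner_le_norm _ _)
  have ht1 : (1 - 2 * κ) * ‖t‖ ≤ ‖gb‖ := by
    rcases (norm_nonneg t).eq_or_lt with h0 | h0
    · rw [← h0]; simp
    · have : (1 - 2 * κ) * ‖t‖ * ‖t‖ ≤ ‖gb‖ * ‖t‖ := by nlinarith
      exact le_of_mul_le_mul_right this h0
  have ht2 : ‖t‖ ≤ 2 * ‖gb‖ := by nlinarith [norm_nonneg t]
  have hy : ∀ i, |inner ℝ t (g i - gb)| ≤ 4 * κ := by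
    intro i
    calc |inner ℝ t (g i - gb)| ≤ ‖t‖ * ‖g i - gb‖ := abs_real_inner_le_norm _ _
      _ ≤ (2 * ‖gb‖) * (‖g i‖ + ‖gb‖) := by gcongr; exact norm_sub_le _ _
      _ = 2 * (‖g i‖ * ‖gb‖) + 2 * ‖gb‖ ^ 2 := by ring
      _ ≤ 4 * κ := by linarith [hmax i]
  have hsum0 : ∑ i, (g i - gb) = 0 := by
    rw [Finset.sum_sub_distrib, hgb]
    simp only [Finset.sum_const, Finset.card_univ, Fintype.card_fin]
    rw [← Nat.cast_smul_eq_nsmul ℝ, smul_smul, mul_inv_cancel₀ hn'.ne', one_smul, sub_self]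
  have hsumy : ∑ i, inner ℝ t (g i - gb) = 0 := by
    rw [← inner_sum, hsum0, inner_zero_right]
  set w : Fin n → ℝ := fun i => (n : ℝ)⁻¹ * (1 - inner ℝ t (g i - gb)) with hw
  have hnw : ∀ i, n * w i = 1 + -inner ℝ t (g i - gb) := by
    intro i; simp only [hw]; field_simp; ring
  have hwmem : ∀ i, w i ∈ Set.Ioo (0 : ℝ) 1 := by
    intro i
    have h1 := abs_le.1 (hy i)
    constructor
    · exact mul_pos (by positivity) (by linarith)
    · simp only [hw]
      rw [inv_mul_lt_iff₀ hn']
      linarith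
  have hw1 : ∑ i, w i = 1 := by
    simp only [hw, ← Finset.mul_sum, Finset.sum_sub_distrib, hsumy]
    simp [hn'.ne']
  have hwg : ∑ i, w i • g i = 0 := by
    have h1 : ∀ i, w i • g i = (n : ℝ)⁻¹ • g i - ((n : ℝ)⁻¹ • (inner ℝ t (g i - gb) • (g i - gb))
        + ((n : ℝ)⁻¹ * inner ℝ t (g i - gb)) • gb) := by
      intro i
      simp only [hw]
      module
    simp only [h1, Finset.sum_sub_distrib, Finset.sum_add_distrib, ← Finset.smul_sum, ht,
      ← Finset.sum_smul, ← Finset.mul_sum, hsumy, ← hgb]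
    simp
  have hupper : -((1 + 100 * κ) * (n * ‖gb‖ ^ 2)) / 2 ≤ ∑ i, Real.log (n * w i) := by
    have h1 : ∑ i, (-inner ℝ t (g i - gb) -
        (-inner ℝ t (g i - gb)) ^ 2 / 2 * (1 + 4 * (4 * κ))) ≤ ∑ i, Real.log (n * w i) := by
      refine Finset.sum_le_sum fun i _ => ?_
      rw [hnw]
      exact log_one_add_ge (by rw [abs_neg]; exact hy i) (by linarith)
    refine le_trans ?_ h1
    simp only [neg_sq]
    rw [Finset.sum_sub_distrib, Finset.sum_neg_distrib, hsumy, ← Finset.sum_mul, ← Finset.sum_div]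
    have h2 : ∑ i, inner ℝ t (g i - gb) ^ 2 = n * inner ℝ t gb := by
      rw [← htQ]; field_simp
    rw [h2]
    have h3 : (1 - 2 * κ) * inner ℝ t gb ≤ ‖gb‖ ^ 2 := by
      nlinarith [norm_nonneg gb]
    have h5 : (1 + 16 * κ) * inner ℝ t gb ≤ (1 + 100 * κ) * ‖gb‖ ^ 2 := by
      have h6 : 0 ≤ inner ℝ t gb := le_trans (mul_nonneg (by linarith) (sq_nonneg _)) htn
      have h7 : 1 + 16 * κ ≤ (1 + 100 * κ) * (1 - 2 * κ) := by nlinarith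
      calc (1 + 16 * κ) * inner ℝ t gb ≤ ((1 + 100 * κ) * (1 - 2 * κ)) * inner ℝ t gb := by gcongr
        _ = (1 + 100 * κ) * ((1 - 2 * κ) * inner ℝ t gb) := by ring
        _ ≤ _ := by gcongr
    nlinarith
  -- conclusion in the extended reals
  set S : Set EReal := {s : EReal | ∃ w : Fin n → ℝ, (∀ i, w i ∈ Set.Ioo (0 : ℝ) 1) ∧ ∑ i, w i = 1 ∧
    ∑ i, w i • g i = 0 ∧ s = ((∑ i, Real.log (n * w i) : ℝ) : EReal)} with hS
  have hS1 : ((-((1 + 100 * κ) * (n * ‖gb‖ ^ 2)) / 2 : ℝ) : EReal) ≤ sSup S :=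
    le_trans (EReal.coe_le_coe_iff.2 hupper) (le_sSup ⟨w, hwmem, hw1, hwg, rfl⟩)
  have hS2 : sSup S ≤ ((-((1 - 6 * κ) * (n * ‖gb‖ ^ 2)) / 2 : ℝ) : EReal) := by
    refine sSup_le ?_
    rintro s ⟨w, h1, h2, h3, rfl⟩
    exact EReal.coe_le_coe_iff.2 (hlower w h1 h2 h3)
  obtain ⟨σ, hσ⟩ : ∃ σ : ℝ, sSup S = (σ : EReal) := by
    refine ⟨(sSup S).toReal, (EReal.coe_toReal ?_ ?_).symm⟩
    · exact ne_top_of_le_ne_top (EReal.coe_ne_top _) hS2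
    · exact ne_bot_of_le_ne_bot (EReal.coe_ne_bot _) hS1
  rw [hσ, EReal.coe_le_coe_iff] at hS1 hS2
  refine ⟨-2 * σ, ?_, ?_⟩
  · rw [empLogLik, ← hS, hσ, EReal.coe_mul]
  · rw [abs_le]
    constructor <;> nlinarith

lemma empLogLik_linearEquiv (g : Fin n → E) (B : E ≃ₗ[ℝ] E) :
    empLogLik (fun i => B (g i)) = empLogLik g := by
  have h : ∀ w : Fin n → ℝ, ∑ i, w i • B (g i) = 0 ↔ ∑ i, w i • g i = 0 := by
    intro w
    rw [← map_eq_zero_iff B B.injective (x := ∑ i, w i • g i), map_sum]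
    simp only [map_smul]
  simp only [empLogLik, h]

end Deterministic

/-! ### Measurability of the empirical log-likelihood ratio -/

section Measurability

variable {d n : ℕ}

local notation "E" => EuclideanSpace ℝ (Fin d)

/-- For `n ≥ 2` the data admitting weights of log-likelihood at least `c` form a closed set: these
weights range over the compact set `{w ≥ 0, ∑ w = 1, ∏ (n w) ≥ exp c}`. -/
lemma isClosed_setOf_exists_weights (hn : 2 ≤ n) (c : ℝ) :
    IsClosed {g : Fin n → E | ∃ w : Fin n → ℝ, (∀ i, w i ∈ Set.Ioo (0 : ℝ) 1) ∧ ∑ i, w i = 1 ∧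
      ∑ i, w i • g i = 0 ∧ c ≤ ∑ i, Real.log (n * w i)} := by
  have hn' : (0 : ℝ) < n := by have : 0 < n := by omega
                               exact_mod_cast this
  set F : Set (Fin n → ℝ) := {w | (∀ i, 0 ≤ w i) ∧ ∑ i, w i = 1 ∧ Real.exp c ≤ ∏ i, (n * w i)}
    with hF
  have hFc : IsCompact F := by
    refine (isCompact_Icc (a := (0 : Fin n → ℝ)) (b := 1)).of_isClosed_subset ?_ ?_
    · have h1 : IsClosed {w : Fin n → ℝ | ∀ i, 0 ≤ w i} := by
        simp only [Set.ofPred_forall]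
        exact isClosed_iInter fun i => isClosed_le continuous_const (continuous_apply i)
      have h2 : IsClosed {w : Fin n → ℝ | ∑ i, w i = 1} :=
        isClosed_eq (by fun_prop) continuous_const
      have h3 : IsClosed {w : Fin n → ℝ | Real.exp c ≤ ∏ i, (n * w i)} :=
        isClosed_le continuous_const (by fun_prop)
      exact h1.inter (h2.inter h3)
    · rintro w ⟨h1, h2, -⟩
      refine ⟨h1, fun i => ?_⟩
      rw [Pi.one_apply, ← h2]
      exact Finset.single_le_sum (fun j _ => h1 j) (Finset.mem_univ i)
  have hmem : ∀ w : Fin n → ℝ, w ∈ F ↔ (∀ i, w i ∈ Set.Ioo (0 : ℝ) 1) ∧ ∑ i, w i = 1 ∧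
      c ≤ ∑ i, Real.log (n * w i) := by
    intro w
    have key : (∀ i, 0 < w i) → (Real.exp c ≤ ∏ i, (n * w i) ↔ c ≤ ∑ i, Real.log (n * w i)) := by
      intro hpos
      rw [← Real.log_prod (fun i _ => (mul_pos hn' (hpos i)).ne'),
        Real.le_log_iff_exp_le (Finset.prod_pos fun i _ => mul_pos hn' (hpos i))]
    constructor
    · rintro ⟨h1, h2, h3⟩
      have hpos : ∀ i, 0 < w i := by
        intro i
        refine (h1 i).lt_of_ne fun h0 => ?_
        have : ∏ i, (n * w i) = 0 := Finset.prod_eq_zero (Finset.mem_univ i) (by rw [← h0]; simp)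
        rw [this] at h3
        exact absurd h3 (not_le.2 (Real.exp_pos c))
      refine ⟨fun i => ⟨hpos i, ?_⟩, h2, (key hpos).1 h3⟩
      obtain ⟨j, hj⟩ : ∃ j : Fin n, j ≠ i := by
        have : Nontrivial (Fin n) := Fin.nontrivial_iff_two_le.2 hn
        exact exists_ne i
      calc w i < w i + w j := by linarith [hpos j]
        _ = ∑ k ∈ {i, j}, w k := by rw [Finset.sum_pair hj.symm]
        _ ≤ ∑ k, w k := Finset.sum_le_sum_of_subset_of_nonneg (Finset.subset_univ _)
            fun k _ _ => (hpos k).le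
        _ = 1 := h2
    · rintro ⟨h1, h2, h3⟩
      exact ⟨fun i => (h1 i).1.le, h2, (key fun i => (h1 i).1).2 h3⟩
  have : CompactSpace F := isCompact_iff_compactSpace.1 hFc
  have hcl : IsClosed {q : (Fin n → E) × F | ∑ i, (q.2 : Fin n → ℝ) i • q.1 i = 0} :=
    isClosed_eq (continuous_finsetSum _ fun i _ =>
      ((continuous_apply i).comp (continuous_subtype_val.comp continuous_snd)).smul
        ((continuous_apply i).comp continuous_fst)) continuous_const
  convert isClosedMap_fst_of_compactSpace _ hcl using 1
  ext g
  constructor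
  · rintro ⟨w, h1, h2, h3, h4⟩
    exact ⟨(g, ⟨w, (hmem w).2 ⟨h1, h2, h4⟩⟩), h3, rfl⟩
  · rintro ⟨⟨g', ⟨w, hw⟩⟩, h3, rfl⟩
    obtain ⟨h1, h2, h4⟩ := (hmem w).1 hw
    exact ⟨w, h1, h2, h3, h4⟩

lemma measurable_empLogLik : Measurable (empLogLik : (Fin n → E) → EReal) := by
  have hmul : Measurable fun x : EReal => ((-2 : ℝ) : EReal) * x := by
    refine Antitone.measurable fun x y hxy => ?_
    have h : ((-2 : ℝ) : EReal) = -((2 : ℝ) : EReal) := by norm_num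
    rw [h, EReal.neg_mul, EReal.neg_mul, EReal.neg_le_neg_iff]
    exact mul_le_mul_of_nonneg_left hxy (by norm_num)
  refine hmul.comp ?_
  rcases lt_or_ge n 2 with hn | hn
  · -- there are no weights in `(0, 1)` if `n = 1`, and a single datum if `n = 0`
    interval_cases n
    · exact Subsingleton.measurable
    · convert measurable_const (a := (⊥ : EReal)) using 2 with g
      rw [sSup_eq_bot]
      rintro s ⟨w, h1, h2, -⟩
      have := (h1 0).2
      simp at h2
      linarith
  · refine measurable_of_Ioi fun a => ?_
    have : (fun g : Fin n → E => sSup {s : EReal | ∃ w : Fin n → ℝ, (∀ i, w i ∈ Set.Ioo (0 : ℝ) 1) ∧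
        ∑ i, w i = 1 ∧ ∑ i, w i • g i = 0 ∧ s = ((∑ i, Real.log (n * w i) : ℝ) : EReal)}) ⁻¹'
          Set.Ioi a = ⋃ r ∈ {r : ℚ | a < ((r : ℝ) : EReal)},
        {g : Fin n → E | ∃ w : Fin n → ℝ, (∀ i, w i ∈ Set.Ioo (0 : ℝ) 1) ∧ ∑ i, w i = 1 ∧
          ∑ i, w i • g i = 0 ∧ (r : ℝ) ≤ ∑ i, Real.log (n * w i)} := by
      ext g
      simp only [Set.mem_preimage, Set.mem_Ioi, lt_sSup_iff, Set.mem_iUnion, Set.mem_ofPred_eq,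
        exists_prop]
      constructor
      · rintro ⟨s, ⟨w, h1, h2, h3, rfl⟩, h4⟩
        obtain ⟨r, h5, h6⟩ := EReal.lt_iff_exists_rat_btwn.1 h4
        exact ⟨r, h5, w, h1, h2, h3, (EReal.coe_lt_coe_iff.1 h6).le⟩
      · rintro ⟨r, h5, w, h1, h2, h3, h6⟩
        exact ⟨_, ⟨w, h1, h2, h3, rfl⟩, h5.trans_le (EReal.coe_le_coe_iff.2 h6)⟩
    rw [this]
    exact MeasurableSet.biUnion (Set.to_countable _) fun r _ =>
      (isClosed_setOf_exists_weights hn r).measurableSet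

end Measurability

/-! ### Limits in distribution -/

section Distribution

variable {Ω : Type*} [MeasurableSpace Ω] {P : Measure Ω} [IsProbabilityMeasure P]

/-- Two sequences of random variables which coincide with probability tending to `1` have the same
limits in distribution. -/
lemma tendstoInDistribution_of_eventually_eq {E : Type*} [TopologicalSpace E] [MeasurableSpace E]
    [OpensMeasurableSpace E] {Ω' : Type*} [MeasurableSpace Ω'] {P' : Measure Ω'}
    [IsProbabilityMeasure P'] {X X' : ℕ → Ω → E} {Z : Ω' → E}
    (hX : TendstoInDistribution X atTop Z (fun _ => P) P') (hX' : ∀ n, AEMeasurable (X' n) P)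
    (h : ∀ᶠ a in inProb P, X a.1 a.2 = X' a.1 a.2) :
    TendstoInDistribution X' atTop Z (fun _ => P) P' := by
  refine ⟨hX', hX.aemeasurable_limit, ?_⟩
  have hT := ProbabilityMeasure.tendsto_iff_forall_integral_tendsto.1 hX.tendsto
  refine ProbabilityMeasure.tendsto_iff_forall_integral_tendsto.2 fun F => ?_
  have h1 := hT F
  have hFm : Measurable F := F.continuous.measurable
  simp only [ProbabilityMeasure.coe_mk] at h1 ⊢
  have h2 : ∀ n, ∫ ω, F ω ∂(P.map (X n)) = ∫ ω, F (X n ω) ∂P := fun n =>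
    integral_map (hX.forall_aemeasurable n) hFm.aestronglyMeasurable
  have h3 : ∀ n, ∫ ω, F ω ∂(P.map (X' n)) = ∫ ω, F (X' n ω) ∂P := fun n =>
    integral_map (hX' n) hFm.aestronglyMeasurable
  simp only [h2] at h1
  simp only [h3]
  have hint : ∀ (Y : Ω → E), AEMeasurable Y P → Integrable (fun ω => F (Y ω)) P := fun Y hY =>
    (integrable_const ‖F‖).mono' (hFm.comp_aemeasurable hY).aestronglyMeasurable
      (Eventually.of_forall fun ω => F.norm_coe_le_norm _)
  have h4 : Tendsto (fun n => ∫ ω, F (X' n ω) ∂P - ∫ ω, F (X n ω) ∂P) atTop (𝓝 0) := by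
    have h5 : Tendsto (fun n => 2 * ‖F‖ * (P {ω | ¬ X n ω = X' n ω}).toReal) atTop (𝓝 0) := by
      have := (ENNReal.tendsto_toReal ENNReal.zero_ne_top).comp (eventually_inProb.1 h)
      simpa using this.const_mul (2 * ‖F‖)
    refine squeeze_zero_norm (fun n => ?_) h5
    rw [← integral_sub (hint _ (hX' n)) (hint _ (hX.forall_aemeasurable n))]
    set B := toMeasurable P {ω | ¬ X n ω = X' n ω} with hB
    have hBm : MeasurableSet B := measurableSet_toMeasurable _ _
    calc ‖∫ ω, F (X' n ω) - F (X n ω) ∂P‖ ≤ ∫ ω, B.indicator (fun _ => 2 * ‖F‖) ω ∂P := by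
          refine norm_integral_le_of_norm_le ((integrable_const _).indicator hBm)
            (Eventually.of_forall fun ω => ?_)
          by_cases hω : ω ∈ B
          · rw [Set.indicator_of_mem hω]
            calc ‖F (X' n ω) - F (X n ω)‖ ≤ ‖F (X' n ω)‖ + ‖F (X n ω)‖ := norm_sub_le _ _
              _ ≤ ‖F‖ + ‖F‖ := add_le_add (F.norm_coe_le_norm _) (F.norm_coe_le_norm _)
              _ = 2 * ‖F‖ := by ring
          · rw [Set.indicator_of_notMem hω]
            have : X n ω = X' n ω := by
              by_contra hne
              exact hω (subset_toMeasurable P _ hne)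
            simp [this]
      _ = 2 * ‖F‖ * (P {ω | ¬ X n ω = X' n ω}).toReal := by
          rw [integral_indicator_const _ hBm, measureReal_def, hB, measure_toMeasurable]
          simp [mul_comm]
  simpa using h4.add h1

variable {d : ℕ}

local notation "E" => EuclideanSpace ℝ (Fin d)

/-- The central limit theorem in `ℝ^d`, for variables with identity covariance. -/
lemma tendstoInDistribution_sqrt_sum {ξ : ℕ → Ω → E}
    (hindep : iIndepFun ξ P) (hident : ∀ i, IdentDistrib (ξ i) (ξ 0) P P)
    (hL2 : MemLp (ξ 0) 2 P) (hmean : ∀ u : E, ∫ ω, inner ℝ u (ξ 0 ω) ∂P = 0)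
    (hcov : ∀ u : E, ∫ ω, inner ℝ u (ξ 0 ω) ^ 2 ∂P = ‖u‖ ^ 2) :
    TendstoInDistribution (fun (n : ℕ) ω => (√n)⁻¹ • ∑ k : Fin n, ξ k ω) atTop
      (id : E → E) (fun _ => P) (stdGaussian E) := by
  have hξm : ∀ i, AEMeasurable (ξ i) P := fun i => (hident i).aemeasurable_fst
  have hm : ∀ n : ℕ, AEMeasurable (fun ω => (√(n : ℝ))⁻¹ • ∑ k : Fin n, ξ k ω) P := fun n =>
    AEMeasurable.fun_const_smul
      (Finset.aemeasurable_fun_sum Finset.univ fun (k : Fin n) _ => hξm k) _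
  refine ⟨hm, aemeasurable_id, ?_⟩
  refine ProbabilityMeasure.tendsto_iff_tendsto_charFun.2 fun t => ?_
  have hmeas : Measurable fun x : E => inner ℝ t x := by fun_prop
  have h1 := tendstoInDistribution_inv_sqrt_mul_sum_sub (P := P)
    (X := fun i ω => inner ℝ t (ξ i ω)) (Y := id)
    (P' := gaussianReal 0 Var[fun ω => inner ℝ t (ξ 0 ω); P].toNNReal) HasLaw.id
    (hL2.const_inner t) (hindep.comp (fun _ x => inner ℝ t x) fun _ => hmeas)
    (fun i => (hident i).comp hmeas)
  have h2 := (ProbabilityMeasure.tendsto_iff_tendsto_charFun.1 h1.tendsto) 1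
  have hvar : Var[fun ω => inner ℝ t (ξ 0 ω); P] = ‖t‖ ^ 2 :=
    (variance_of_integral_eq_zero (hmeas.comp_aemeasurable (hξm 0)) (hmean t)).trans (hcov t)
  simp only [ProbabilityMeasure.coe_mk, hmean, hvar, Measure.map_id, mul_zero, sub_zero,
    charFun_gaussianReal] at h2 ⊢
  rw [charFun_stdGaussian]
  convert h2 using 2 with n
  · rw [charFun_apply, charFun_apply_real, integral_map (hm n) (by fun_prop),
      integral_map ?_ (by fun_prop)]
    · congr 1
      ext ω
      rw [real_inner_comm, inner_smul_right, inner_sum, Finset.sum_range]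
      simp
    · exact (Finset.aemeasurable_fun_sum _ fun k _ =>
        hmeas.comp_aemeasurable (hξm k)).const_mul _
  · have h3 : (((‖t‖ ^ 2).toNNReal : ℝ) : ℂ) = (‖t‖ : ℂ) ^ 2 := by
      rw [Real.coe_toNNReal _ (sq_nonneg _)]; push_cast; ring
    rw [h3]
    simp [neg_div]

lemma stdGaussian_map_norm_sq :
    (stdGaussian E).map (fun x => ‖x‖ ^ 2) = chiSquared d := by
  rw [← map_pi_eq_stdGaussian, Measure.map_map (by fun_prop) (by fun_prop), chiSquared]
  congr 1
  ext z
  simp [EuclideanSpace.real_norm_sq_eq]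

/-- If real variables `r` with `r - ‖n^{-1/2} ∑ ξ‖² → 0` in probability coincide, with probability
tending to `1`, with the extended real variables `l`, then `l` converges to the chi-squared law. -/
lemma tendstoInDistribution_chiSquared {ξ : ℕ → Ω → E}
    (hindep : iIndepFun ξ P) (hident : ∀ i, IdentDistrib (ξ i) (ξ 0) P P)
    (hL2 : MemLp (ξ 0) 2 P) (hmean : ∀ u : E, ∫ ω, inner ℝ u (ξ 0 ω) ∂P = 0)
    (hcov : ∀ u : E, ∫ ω, inner ℝ u (ξ 0 ω) ^ 2 ∂P = ‖u‖ ^ 2)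
    {l : ℕ → Ω → EReal} {r : ℕ → Ω → ℝ} (hl : ∀ n, AEMeasurable (l n) P)
    (hr : ∀ n, AEMeasurable (r n) P) (hlr : ∀ᶠ a in inProb P, (r a.1 a.2 : EReal) = l a.1 a.2)
    (hrξ : Tendsto (fun a : ℕ × Ω => r a.1 a.2 - ‖(√(a.1 : ℝ))⁻¹ • ∑ k : Fin a.1, ξ k a.2‖ ^ 2)
      (inProb P) (𝓝 0)) :
    TendstoInDistribution l atTop Real.toEReal (fun _ => P) (chiSquared d) := by
  have h1 := (tendstoInDistribution_sqrt_sum hindep hident hL2 hmean hcov).continuous_comp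
    (g := fun x : E => ‖x‖ ^ 2) (by fun_prop)
  have h2 := tendstoInDistribution_of_tendstoInMeasure_sub r _ h1
    (tendsto_inProb_iff_tendstoInMeasure.1 hrξ) hr
  have h3 := h2.continuous_comp (g := Real.toEReal) continuous_coe_real_ereal
  have h4 := tendstoInDistribution_of_eventually_eq h3 hl hlr
  have h5 : (chiSquared d).map Real.toEReal =
      (stdGaussian E).map (Real.toEReal ∘ (fun x => ‖x‖ ^ 2) ∘ id) := by
    rw [← stdGaussian_map_norm_sq, Measure.map_map measurable_coe_real_ereal (by fun_prop)]
    rfl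
  refine ⟨h4.forall_aemeasurable, measurable_coe_real_ereal.aemeasurable, ?_⟩
  have h6 : (⟨(chiSquared d).map Real.toEReal, Measure.isProbabilityMeasure_map
      measurable_coe_real_ereal.aemeasurable⟩ : ProbabilityMeasure EReal) =
      ⟨(stdGaussian E).map (Real.toEReal ∘ (fun x => ‖x‖ ^ 2) ∘ id),
        Measure.isProbabilityMeasure_map h4.aemeasurable_limit⟩ := Subtype.ext h5
  rw [h6]
  exact h4.tendsto

end Distribution

/-! ### Sums and maxima of independent identically distributed variables -/

section IID

variable {Ω : Type*} [MeasurableSpace Ω] {P : Measure Ω} [IsProbabilityMeasure P]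

lemma bddInProb_sqrt_sum {X : ℕ → Ω → ℝ} (hindep : iIndepFun X P)
    (hident : ∀ i, IdentDistrib (X i) (X 0) P P) (hL2 : MemLp (X 0) 2 P)
    (hmean : ∫ ω, X 0 ω ∂P = 0) :
    BddInProb P (fun a => (√(a.1 : ℝ))⁻¹ * ∑ i : Fin a.1, X i a.2) := by
  have hXL : ∀ i, MemLp (X i) 2 P := fun i => (hident i).memLp_iff.2 hL2
  have hXm : ∀ i, AEMeasurable (X i) P := fun i => (hident i).aemeasurable_fst
  have hSm : ∀ n : ℕ, AEMeasurable (fun ω => (√(n : ℝ))⁻¹ * ∑ i : Fin n, X i ω) P := fun n =>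
    (Finset.aemeasurable_fun_sum Finset.univ fun (k : Fin n) _ => hXm k).const_mul _
  refine bddInProb_of_lintegral_sq (X := fun n ω => (√(n : ℝ))⁻¹ * ∑ i : Fin n, X i ω)
    (C := ENNReal.ofReal (∫ ω, X 0 ω ^ 2 ∂P)) ENNReal.ofReal_ne_top hSm ?_
  filter_upwards [eventually_gt_atTop 0] with n hn
  have hn' : (0 : ℝ) < n := by exact_mod_cast hn
  have hSL : MemLp (fun ω => ∑ i : Fin n, X i ω) 2 P :=
    memLp_finsetSum Finset.univ fun (i : Fin n) _ => hXL i
  have h1 : ∫ ω, (∑ i : Fin n, X i ω) ^ 2 ∂P = n * ∫ ω, X 0 ω ^ 2 ∂P := by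
    have hmean' : ∫ ω, ∑ i : Fin n, X i ω ∂P = 0 := by
      rw [integral_finsetSum _ fun (i : Fin n) _ => (hXL i).integrable (by norm_num)]
      refine Finset.sum_eq_zero fun i _ => ?_
      rw [(hident i).integral_eq, hmean]
    rw [← variance_of_integral_eq_zero hSL.1.aemeasurable hmean']
    have h2 := IndepFun.variance_sum (X := fun i : Fin n => X i) (s := Finset.univ) (μ := P)
      (fun i _ => hXL i) (fun i _ j _ hij => hindep.indepFun (fun h => hij (Fin.ext h)))
    have h3 : (∑ i : Fin n, X i) = fun ω => ∑ i : Fin n, X i ω := by ext ω; simp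
    rw [h3] at h2
    rw [h2]
    simp only [(hident _).variance_eq, variance_of_integral_eq_zero (hXm 0) hmean]
    simp
  rw [← ofReal_integral_eq_lintegral_ofReal]
  · refine ENNReal.ofReal_le_ofReal (le_of_eq ?_)
    simp only [mul_pow, integral_const_mul, h1, inv_pow, Real.sq_sqrt hn'.le]
    field_simp
  · simp only [mul_pow]
    exact hSL.integrable_sq.const_mul _
  · exact Eventually.of_forall fun ω => sq_nonneg _

variable {d : ℕ}

local notation "E" => EuclideanSpace ℝ (Fin d)

lemma EuclideanSpace.norm_le_sum_abs (v : E) : ‖v‖ ≤ ∑ a, |v a| := by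
  have h : ‖v‖ ^ 2 ≤ (∑ a, |v a|) ^ 2 := by
    rw [EuclideanSpace.real_norm_sq_eq]
    simpa using Finset.sum_sq_le_sq_sum_of_nonneg (s := Finset.univ) (f := fun a => |v a|)
      (fun i _ => abs_nonneg _)
  exact le_of_sq_le_sq h (Finset.sum_nonneg fun i _ => abs_nonneg _)

lemma bddInProb_norm_sqrt_sum {ξ : ℕ → Ω → E} (hindep : iIndepFun ξ P)
    (hident : ∀ i, IdentDistrib (ξ i) (ξ 0) P P) (hL2 : MemLp (ξ 0) 2 P)
    (hmean : ∀ u : E, ∫ ω, inner ℝ u (ξ 0 ω) ∂P = 0) :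
    BddInProb P (fun a => ‖(√(a.1 : ℝ))⁻¹ • ∑ i : Fin a.1, ξ i a.2‖) := by
  have h1 : ∀ b : Fin d, BddInProb P
      (fun a => |(√(a.1 : ℝ))⁻¹ * ∑ i : Fin a.1, ξ i a.2 b|) := by
    intro b
    have hmeas : Measurable fun x : E => x b := by fun_prop
    refine (bddInProb_sqrt_sum (X := fun i ω => ξ i ω b) (hindep.comp (fun _ x => x b)
      fun _ => hmeas) (fun i => (hident i).comp hmeas) ?_ ?_).abs
    · have := hL2.const_inner (𝕜 := ℝ) (EuclideanSpace.single b 1)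
      simpa [EuclideanSpace.inner_single_left] using this
    · simpa [EuclideanSpace.inner_single_left] using hmean (EuclideanSpace.single b 1)
  refine (BddInProb.finset_sum Finset.univ fun b _ => h1 b).of_le (Eventually.of_forall fun a => ?_)
  rw [abs_norm]
  refine (EuclideanSpace.norm_le_sum_abs _).trans (le_of_eq ?_)
  rw [abs_of_nonneg (Finset.sum_nonneg fun i _ => abs_nonneg _)]
  simp

/-- The largest of `n` identically distributed square-integrable variables is `o_P(n^{1/2})`. -/
lemma tendsto_inProb_iSup_norm {ξ : ℕ → Ω → E}
    (hident : ∀ i, IdentDistrib (ξ i) (ξ 0) P P) (hL2 : MemLp (ξ 0) 2 P) :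
    Tendsto (fun a : ℕ × Ω => (√(a.1 : ℝ))⁻¹ * ⨆ i : Fin a.1, ‖ξ i a.2‖) (inProb P) (𝓝 0) := by
  rw [tendsto_inProb_iff]
  intro η hη
  have hsqrt : Tendsto (fun n : ℕ => η * √(n : ℝ)) atTop atTop :=
    (Real.tendsto_sqrt_atTop.comp tendsto_natCast_atTop_atTop).const_mul_atTop hη
  set s : ℕ → Set Ω := fun n => {ω | η * √(n : ℝ) ≤ ‖ξ 0 ω‖} with hs
  have hfin : ∫⁻ ω, ‖ξ 0 ω‖ₑ ^ 2 ∂P ≠ ⊤ := by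
    have := (memLp_two_iff_integrable_sq_norm hL2.1).1 hL2
    have h2 := this.2
    simp only [HasFiniteIntegral, enorm_pow, enorm_norm] at h2
    exact h2.ne
  have hm0 : AEMeasurable (fun ω => ‖ξ 0 ω‖ₑ) P := hL2.1.enorm
  have hPs : Tendsto (P ∘ s) atTop (𝓝 0) := by
    have h1 : Tendsto (fun n : ℕ => (∫⁻ ω, ‖ξ 0 ω‖ₑ ∂P) / ENNReal.ofReal (η * √(n : ℝ)))
        atTop (𝓝 0) := by
      have hfin1 : ∫⁻ ω, ‖ξ 0 ω‖ₑ ∂P ≠ ⊤ := (hL2.integrable (by norm_num)).2.ne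
      have := ENNReal.Tendsto.const_div (a := ∫⁻ ω, ‖ξ 0 ω‖ₑ ∂P)
        (ENNReal.tendsto_ofReal_atTop.comp hsqrt) (Or.inr hfin1)
      simpa using this
    refine tendsto_of_tendsto_of_tendsto_of_le_of_le' tendsto_const_nhds h1
      (Eventually.of_forall fun _ => zero_le) ?_
    filter_upwards [eventually_gt_atTop 0] with n hn
    have hn' : (0 : ℝ) < n := by exact_mod_cast hn
    have hpos : 0 < η * √(n : ℝ) := by positivity
    refine le_trans (measure_mono ?_) (meas_ge_le_lintegral_div hm0 (by simpa using hpos)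
      ENNReal.ofReal_ne_top)
    intro ω hω
    simp only [hs, Set.mem_ofPred_eq] at hω ⊢
    rw [← ofReal_norm]
    exact ENNReal.ofReal_le_ofReal hω
  have h2 := tendsto_setLIntegral_zero hfin hPs
  have h3 : Tendsto (fun n => (∫⁻ ω in s n, ‖ξ 0 ω‖ₑ ^ 2 ∂P) / ENNReal.ofReal (η ^ 2))
      atTop (𝓝 0) := by
    have := ENNReal.Tendsto.div_const h2 (b := ENNReal.ofReal (η ^ 2))
      (Or.inr (by simpa using hη.ne'))
    simpa using this
  refine tendsto_of_tendsto_of_tendsto_of_le_of_le' tendsto_const_nhds h3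
    (Eventually.of_forall fun _ => zero_le) ?_
  filter_upwards [eventually_gt_atTop 0] with n hn
  have hn' : (0 : ℝ) < n := by exact_mod_cast hn
  have hsub : {ω | η ≤ dist ((√(n : ℝ))⁻¹ * ⨆ i : Fin n, ‖ξ i ω‖) 0} ⊆
      ⋃ i : Fin n, {ω | η * √(n : ℝ) ≤ ‖ξ i ω‖} := by
    intro ω hω
    have : Nonempty (Fin n) := ⟨⟨0, hn⟩⟩
    simp only [Real.dist_eq, sub_zero, Set.mem_ofPred_eq, Set.mem_iUnion] at hω ⊢
    obtain ⟨i, hi⟩ := exists_eq_ciSup_of_finite (f := fun i : Fin n => ‖ξ i ω‖)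
    refine ⟨i, ?_⟩
    rw [← hi, abs_of_nonneg (by positivity), le_inv_mul_iff₀ (by positivity)] at hω
    linarith
  have heq : ∀ i : Fin n, P {ω | η * √(n : ℝ) ≤ ‖ξ i ω‖} = P (s n) := fun i =>
    (hident i).measure_mem_eq (s := {x : E | η * √(n : ℝ) ≤ ‖x‖})
      (measurableSet_le measurable_const measurable_norm)
  have hmark : n * ENNReal.ofReal (η ^ 2) * P (s n) ≤ ∫⁻ ω in s n, ‖ξ 0 ω‖ₑ ^ 2 ∂P := by
    have hsn : NullMeasurableSet (s n) P :=
      nullMeasurableSet_le aemeasurable_const hL2.1.norm.aemeasurable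
    have h5 : ∫⁻ ω in s n, ENNReal.ofReal ((η * √(n : ℝ)) ^ 2) ∂P ≤
        ∫⁻ ω in s n, ‖ξ 0 ω‖ₑ ^ 2 ∂P := by
      refine lintegral_mono_ae ?_
      refine (ae_restrict_iff'₀ hsn).2 (Eventually.of_forall fun ω hω => ?_)
      simp only [hs, Set.mem_ofPred_eq] at hω
      rw [← ofReal_norm, ← ENNReal.ofReal_pow (norm_nonneg _)]
      exact ENNReal.ofReal_le_ofReal (by gcongr)
    rw [setLIntegral_const, mul_pow, Real.sq_sqrt hn'.le, ENNReal.ofReal_mul (sq_nonneg _),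
      ENNReal.ofReal_natCast] at h5
    rwa [mul_comm (n : ENNReal)]
  calc P {ω | η ≤ dist ((√(n : ℝ))⁻¹ * ⨆ i : Fin n, ‖ξ i ω‖) 0}
      ≤ ∑ i : Fin n, P {ω | η * √(n : ℝ) ≤ ‖ξ i ω‖} :=
        (measure_mono hsub).trans ((measure_iUnion_le _).trans_eq (tsum_fintype _))
    _ = n * P (s n) := by simp [heq]
    _ ≤ (∫⁻ ω in s n, ‖ξ 0 ω‖ₑ ^ 2 ∂P) / ENNReal.ofReal (η ^ 2) := by
        rw [ENNReal.le_div_iff_mul_le (Or.inl (by simpa using hη.ne'))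
          (Or.inl ENNReal.ofReal_ne_top)]
        calc _ = n * ENNReal.ofReal (η ^ 2) * P (s n) := by ring
          _ ≤ _ := hmark

/-- The law of large numbers for the weighted quadratic forms `c ⟪u, v⟫²`, uniformly in the
argument `u`. -/
lemma exists_tendsto_inProb_quadratic {c : ℕ → Ω → ℝ} {v : ℕ → Ω → E}
    (hindep : iIndepFun (fun i ω => (c i ω, v i ω)) P)
    (hident : ∀ i, IdentDistrib (fun ω => (c i ω, v i ω)) (fun ω => (c 0 ω, v 0 ω)) P P)
    (hint : Integrable (fun ω => c 0 ω * ‖v 0 ω‖ ^ 2) P) :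
    ∃ D : ℕ × Ω → ℝ, Tendsto D (inProb P) (𝓝 0) ∧ ∀ (a : ℕ × Ω) (u w : E),
      |(a.1 : ℝ)⁻¹ * ∑ i : Fin a.1, c i a.2 * (inner ℝ u (v i a.2) * inner ℝ w (v i a.2)) -
        ∫ ω, c 0 ω * (inner ℝ u (v 0 ω) * inner ℝ w (v 0 ω)) ∂P| ≤ D a * (‖u‖ * ‖w‖) := by
  set φ : ℝ × E → (E →L[ℝ] E) := fun q => q.1 • InnerProductSpace.rankOne ℝ q.2 q.2 with hφ
  have hφc : Continuous φ := by
    exact continuous_fst.smul (((InnerProductSpace.rankOne ℝ).continuous.comp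
      continuous_snd).clm_apply continuous_snd)
  have hcv : AEMeasurable (fun ω => (c 0 ω, v 0 ω)) P := (hident 0).aemeasurable_fst
  have hint' : Integrable (fun ω => φ (c 0 ω, v 0 ω)) P := by
    refine hint.norm.mono' (hφc.measurable.comp_aemeasurable hcv).aestronglyMeasurable
      (Eventually.of_forall fun ω => ?_)
    simp only [hφ, norm_smul, InnerProductSpace.norm_rankOne, norm_mul, norm_pow, norm_norm]
    rw [sq]
  have h1 := tendsto_inProb_average (X := fun i ω => φ (c i ω, v i ω)) hint'
    (hindep.comp (fun _ => φ) fun _ => hφc.measurable) (fun i => (hident i).comp hφc.measurable)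
  have hinner : ∀ q : ℝ × E, ∀ u w : E, inner ℝ w (φ q u) = q.1 * (inner ℝ u q.2 * inner ℝ w q.2) :=
      by
    intro q u w
    simp only [hφ, smul_apply, InnerProductSpace.rankOne_apply,
      inner_smul_right, real_inner_comm u q.2]
  refine ⟨fun a => ‖(a.1 : ℝ)⁻¹ • ∑ i : Fin a.1, φ (c i a.2, v i a.2) -
    ∫ ω, φ (c 0 ω, v 0 ω) ∂P‖, ?_, ?_⟩
  · exact tendsto_iff_norm_sub_tendsto_zero.1 h1
  · intro a u w
    set T := (a.1 : ℝ)⁻¹ • ∑ i : Fin a.1, φ (c i a.2, v i a.2) - ∫ ω, φ (c 0 ω, v 0 ω) ∂P with hT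
    have h2 : inner ℝ w (T u) =
        (a.1 : ℝ)⁻¹ * ∑ i : Fin a.1, c i a.2 * (inner ℝ u (v i a.2) * inner ℝ w (v i a.2)) -
        ∫ ω, c 0 ω * (inner ℝ u (v 0 ω) * inner ℝ w (v 0 ω)) ∂P := by
      rw [hT, sub_apply, inner_sub_right, smul_apply,
        inner_smul_right, sum_apply, inner_sum,
        ContinuousLinearMap.integral_apply hint', ← integral_inner
          (hint'.apply_continuousLinearMap u)]
      simp only [hinner]
    rw [← h2]
    calc |inner ℝ w (T u)| ≤ ‖w‖ * ‖T u‖ := abs_real_inner_le_norm _ _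
      _ ≤ ‖w‖ * (‖T‖ * ‖u‖) := by gcongr; exact T.le_opNorm u
      _ = ‖T‖ * (‖u‖ * ‖w‖) := by ring

end IID

/-! ### The chi-squared limit of the empirical log-likelihood ratio -/

section Wilks

variable {d : ℕ}

local notation "E" => EuclideanSpace ℝ (Fin d)

lemma abs_average_inner_sq_sub_le {n : ℕ} (g x : Fin n → E) (u : E) :
    |(n : ℝ)⁻¹ * ∑ i, inner ℝ u (g i) ^ 2 - (n : ℝ)⁻¹ * ∑ i, inner ℝ u (x i) ^ 2| ≤
      ((n : ℝ)⁻¹ * ∑ i, ‖g i - x i‖ ^ 2 + 2 * (√((n : ℝ)⁻¹ * ∑ i, ‖g i - x i‖ ^ 2) *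
        √((n : ℝ)⁻¹ * ∑ i, ‖x i‖ ^ 2))) * ‖u‖ ^ 2 := by
  have h1 : ∀ i, |inner ℝ u (g i) ^ 2 - inner ℝ u (x i) ^ 2| ≤
      (‖g i - x i‖ ^ 2 + 2 * (‖g i - x i‖ * ‖x i‖)) * ‖u‖ ^ 2 := by
    intro i
    have h2 : inner ℝ u (g i) ^ 2 - inner ℝ u (x i) ^ 2 =
        inner ℝ u (g i - x i) ^ 2 + 2 * (inner ℝ u (g i - x i) * inner ℝ u (x i)) := by
      rw [inner_sub_right]; ring
    have h3 := abs_real_inner_le_norm u (g i - x i)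
    have h4 := abs_real_inner_le_norm u (x i)
    rw [h2]
    calc |inner ℝ u (g i - x i) ^ 2 + 2 * (inner ℝ u (g i - x i) * inner ℝ u (x i))|
        ≤ |inner ℝ u (g i - x i)| ^ 2
          + 2 * (|inner ℝ u (g i - x i)| * |inner ℝ u (x i)|) := by
          refine (abs_add_le _ _).trans (le_of_eq ?_)
          rw [abs_mul, abs_mul, abs_pow]; norm_num
      _ ≤ (‖u‖ * ‖g i - x i‖) ^ 2 + 2 * ((‖u‖ * ‖g i - x i‖) * (‖u‖ * ‖x i‖)) := by gcongr
      _ = _ := by ring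
  have hn : (0 : ℝ) ≤ (n : ℝ)⁻¹ := by positivity
  rw [← mul_sub, ← Finset.sum_sub_distrib, abs_mul, abs_of_nonneg hn]
  calc (n : ℝ)⁻¹ * |∑ i, (inner ℝ u (g i) ^ 2 - inner ℝ u (x i) ^ 2)|
      ≤ (n : ℝ)⁻¹ * ∑ i, (‖g i - x i‖ ^ 2 + 2 * (‖g i - x i‖ * ‖x i‖)) * ‖u‖ ^ 2 := by
        gcongr
        exact (Finset.abs_sum_le_sum_abs _ _).trans (Finset.sum_le_sum fun i _ => h1 i)
    _ = ((n : ℝ)⁻¹ * ∑ i, ‖g i - x i‖ ^ 2 +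
          2 * ((n : ℝ)⁻¹ * ∑ i, ‖g i - x i‖ * ‖x i‖)) * ‖u‖ ^ 2 := by
        rw [← Finset.sum_mul, Finset.sum_add_distrib, ← Finset.mul_sum]; ring
    _ ≤ _ := by
        have h5 := Real.sum_mul_le_sqrt_mul_sqrt Finset.univ (fun i => ‖g i - x i‖) fun i => ‖x i‖
        have h6 := Real.mul_self_sqrt hn
        have h7 : (n : ℝ)⁻¹ * ∑ i, ‖g i - x i‖ * ‖x i‖ ≤
            √((n : ℝ)⁻¹ * ∑ i, ‖g i - x i‖ ^ 2) * √((n : ℝ)⁻¹ * ∑ i, ‖x i‖ ^ 2) := by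
          rw [Real.sqrt_mul hn, Real.sqrt_mul hn]
          calc (n : ℝ)⁻¹ * ∑ i, ‖g i - x i‖ * ‖x i‖
              ≤ (n : ℝ)⁻¹ * (√(∑ i, ‖g i - x i‖ ^ 2) * √(∑ i, ‖x i‖ ^ 2)) := by gcongr
            _ = _ := by
                linear_combination (-(√(∑ i, ‖g i - x i‖ ^ 2) * √(∑ i, ‖x i‖ ^ 2))) * h6
        gcongr

/-- The quadratic approximation for data `g` close, in mean square, to data `x` whose second moments
are nearly normalised. -/
lemma empLogLik_approx_of_near {n : ℕ} (hn2 : 2 ≤ n) (g x : Fin n → E) {A L G D κ : ℝ} {v : E}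
    (hA : A = (n : ℝ)⁻¹ * ∑ i, ‖g i - x i‖ ^ 2) (hL : L = (n : ℝ)⁻¹ * ∑ i, ‖x i‖ ^ 2)
    (hG : G = (√(n : ℝ))⁻¹ * ⨆ i, ‖x i‖) (hv : v = (√(n : ℝ))⁻¹ • ∑ i, g i)
    (hD : ∀ u : E, |(n : ℝ)⁻¹ * ∑ i, inner ℝ u (x i) ^ 2 - ‖u‖ ^ 2| ≤ D * ‖u‖ ^ 2)
    (hκ : κ = |D| + (A + 2 * (√A * √L)) + ‖v‖ * (‖v‖ * (n : ℝ)⁻¹) + ‖v‖ * (G + √A))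
    (hκ16 : κ ≤ 1 / 16) :
    ∃ r : ℝ, empLogLik g = (r : EReal) ∧ |r - ‖v‖ ^ 2| ≤ 100 * κ * ‖v‖ ^ 2 := by
  have hn : (0 : ℝ) < n := by
    have : 0 < n := by omega
    exact_mod_cast this
  have hsq : 0 < √(n : ℝ) := Real.sqrt_pos.2 hn
  obtain ⟨gb, hgb⟩ : ∃ gb : E, gb = (n : ℝ)⁻¹ • ∑ i, g i := ⟨_, rfl⟩
  have hvg : v = √(n : ℝ) • gb := by
    rw [hv, hgb, smul_smul]
    congr 1
    field_simp
    rw [Real.sq_sqrt hn.le]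
  have hnorm : ‖v‖ = √(n : ℝ) * ‖gb‖ := by rw [hvg, norm_smul, Real.norm_of_nonneg hsq.le]
  have hτ : ‖v‖ ^ 2 = n * ‖gb‖ ^ 2 := by rw [hnorm, mul_pow, Real.sq_sqrt hn.le]
  have hA0 : 0 ≤ A := by
    rw [hA]
    exact mul_nonneg (inv_nonneg.2 hn.le) (Finset.sum_nonneg fun i _ => sq_nonneg _)
  have hG0 : 0 ≤ G := by
    rw [hG]; exact mul_nonneg (by positivity) (Real.iSup_nonneg fun i => norm_nonneg _)
  have hp0 := abs_nonneg D
  have hp1 : 0 ≤ A + 2 * (√A * √L) := by positivity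
  have hp2 : 0 ≤ ‖v‖ * (‖v‖ * (n : ℝ)⁻¹) := by positivity
  have hp3 : 0 ≤ ‖v‖ * (G + √A) := by positivity
  rw [hτ]
  refine empLogLik_approx g gb hgb hn2 hκ16 (fun u => ?_) ?_ fun i => ?_
  · have q1 := abs_average_inner_sq_sub_le g x u
    rw [← hA, ← hL] at q1
    calc _ ≤ |(n : ℝ)⁻¹ * ∑ i, inner ℝ u (g i) ^ 2 - (n : ℝ)⁻¹ * ∑ i, inner ℝ u (x i) ^ 2| +
          |(n : ℝ)⁻¹ * ∑ i, inner ℝ u (x i) ^ 2 - ‖u‖ ^ 2| := abs_sub_le _ _ _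
      _ ≤ (A + 2 * (√A * √L)) * ‖u‖ ^ 2 + D * ‖u‖ ^ 2 := add_le_add q1 (hD u)
      _ ≤ (A + 2 * (√A * √L)) * ‖u‖ ^ 2 + |D| * ‖u‖ ^ 2 := by gcongr; exact le_abs_self D
      _ = (|D| + (A + 2 * (√A * √L))) * ‖u‖ ^ 2 := by ring
      _ ≤ κ * ‖u‖ ^ 2 := by gcongr; linarith
  · have : ‖gb‖ ^ 2 = ‖v‖ * (‖v‖ * (n : ℝ)⁻¹) := by rw [← mul_assoc, ← sq, hτ]; field_simp
    linarith
  · have q1 : ‖x i‖ ≤ √(n : ℝ) * G := by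
      rw [hG, mul_inv_cancel_left₀ hsq.ne']
      exact le_ciSup (f := fun i => ‖x i‖) (Set.finite_range _).bddAbove i
    have q2 : ‖g i - x i‖ ≤ √(n : ℝ) * √A := by
      rw [← Real.sqrt_mul hn.le]
      refine Real.le_sqrt_of_sq_le ?_
      rw [hA, mul_inv_cancel_left₀ hn.ne']
      exact Finset.single_le_sum (f := fun i => ‖g i - x i‖ ^ 2)
        (fun j _ => by positivity) (Finset.mem_univ i)
    have q3 : ‖g i‖ ≤ ‖x i‖ + ‖g i - x i‖ := by
      simpa using norm_add_le (x i) (g i - x i)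
    calc ‖g i‖ * ‖gb‖ ≤ (√(n : ℝ) * G + √(n : ℝ) * √A) * ‖gb‖ := by gcongr; linarith
      _ = ‖v‖ * (G + √A) := by rw [hnorm]; ring
      _ ≤ κ := by linarith

variable {Ω : Type*} [MeasurableSpace Ω] {P : Measure Ω}

open scoped MatrixOrder Matrix in
/-- A linear change of coordinates which normalises the covariance of a square-integrable vector
with nondegenerate second moments. -/
lemma exists_whitening {ζ : Ω → E} (hL2 : MemLp ζ 2 P)
    (hpos : ∀ u : E, u ≠ 0 → 0 < ∫ ω, inner ℝ u (ζ ω) ^ 2 ∂P) :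
    ∃ B : E ≃ₗ[ℝ] E, ∀ u : E, ∫ ω, inner ℝ u (B (ζ ω)) ^ 2 ∂P = ‖u‖ ^ 2 := by
  have hint : ∀ a b : Fin d, Integrable (fun ω => ζ ω a * ζ ω b) P := by
    intro a b
    have hc : ∀ c : Fin d, MemLp (fun ω => ζ ω c) 2 P := by
      intro c
      have := hL2.const_inner (𝕜 := ℝ) (EuclideanSpace.single c 1)
      simpa [EuclideanSpace.inner_single_left] using this
    exact (hc a).integrable_mul (hc b)
  set V : Matrix (Fin d) (Fin d) ℝ := Matrix.of fun a b => ∫ ω, ζ ω a * ζ ω b ∂P with hV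
  have hquad : ∀ u : Fin d → ℝ, u ⬝ᵥ V *ᵥ u = ∫ ω, inner ℝ (WithLp.toLp 2 u) (ζ ω) ^ 2 ∂P := by
    intro u
    have q1 : ∀ ω, inner ℝ (WithLp.toLp 2 u) (ζ ω) ^ 2 =
        ∑ a, ∑ b, u a * (u b * (ζ ω a * ζ ω b)) := by
      intro ω
      rw [PiLp.inner_apply, sq, Finset.sum_mul_sum]
      refine Finset.sum_congr rfl fun a _ => Finset.sum_congr rfl fun b _ => ?_
      simp only [RCLike.inner_apply, conj_trivial]
      ring
    simp only [q1]
    rw [integral_finsetSum _ fun a _ => integrable_finsetSum _ fun b _ =>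
      ((hint a b).const_mul _).const_mul _]
    simp only [dotProduct, Matrix.mulVec, Finset.mul_sum]
    refine Finset.sum_congr rfl fun a _ => ?_
    rw [integral_finsetSum _ fun b _ => ((hint a b).const_mul _).const_mul _]
    refine Finset.sum_congr rfl fun b _ => ?_
    rw [integral_const_mul, integral_const_mul]
    simp only [hV, Matrix.of_apply]
    ring
  have hVpd : V.PosDef := by
    refine Matrix.posDef_iff_dotProduct_mulVec.2 ⟨?_, fun u hu => ?_⟩
    · ext a b
      simp only [hV, Matrix.conjTranspose_apply, Matrix.of_apply, star_trivial]
      congr 1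
      ext ω
      ring
    · rw [star_trivial, hquad]
      refine hpos _ fun h0 => hu ?_
      simpa using congrArg WithLp.ofLp h0
  obtain ⟨C, hC, hVC⟩ := CStarAlgebra.isStrictlyPositive_iff_eq_star_mul_self.1
    hVpd.isStrictlyPositive
  have hdet : IsUnit C.det := (Matrix.isUnit_iff_isUnit_det C).1 hC
  have hCC : C * C⁻¹ = 1 := Matrix.mul_nonsing_inv _ hdet
  have hCC' : C⁻¹ * C = 1 := Matrix.nonsing_inv_mul _ hdet
  have hmul : ∀ M N : Matrix (Fin d) (Fin d) ℝ, M * N = 1 →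
      (Matrix.toEuclideanLin M).comp (Matrix.toEuclideanLin N) = LinearMap.id := by
    intro M N h
    ext1 v
    simp [Matrix.toEuclideanLin, Matrix.toLpLin_apply, h]
  have ht1 : (C⁻¹)ᵀ * Cᵀ = 1 := by rw [← Matrix.transpose_mul, hCC, Matrix.transpose_one]
  have ht2 : Cᵀ * (C⁻¹)ᵀ = 1 := by rw [← Matrix.transpose_mul, hCC', Matrix.transpose_one]
  refine ⟨LinearEquiv.ofLinearMap (Matrix.toEuclideanLin (C⁻¹)ᵀ) (Matrix.toEuclideanLin Cᵀ)
    (hmul _ _ ht1) (hmul _ _ ht2), fun u => ?_⟩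
  have q1 : ∀ x : E, inner ℝ u ((Matrix.toEuclideanLin (C⁻¹)ᵀ) x) =
      inner ℝ (WithLp.toLp 2 (C⁻¹ *ᵥ u.ofLp)) x := by
    intro x
    simp only [Matrix.toEuclideanLin, Matrix.toLpLin_apply, EuclideanSpace.inner_eq_star_dotProduct,
      star_trivial]
    rw [Matrix.mulVec_transpose, ← Matrix.dotProduct_mulVec]
  simp only [LinearEquiv.coe_ofLinearMap, q1]
  have q2 : C *ᵥ (C⁻¹ *ᵥ u.ofLp) = u.ofLp := by rw [Matrix.mulVec_mulVec, hCC, Matrix.one_mulVec]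
  rw [← hquad, hVC, EuclideanSpace.real_norm_sq_eq, ← Matrix.mulVec_mulVec, q2,
    Matrix.star_eq_conjTranspose, Matrix.conjTranspose_eq_transpose_of_trivial,
    Matrix.dotProduct_mulVec, Matrix.vecMul_transpose, q2]
  simp [dotProduct, sq]

variable [IsProbabilityMeasure P]

/-- Wilks' theorem for a triangular array `g` which is close to centred independent identically
distributed variables with identity covariance. -/
theorem empLogLik_tendsto_of_cov_one {ξ : ℕ → Ω → E} (hindep : iIndepFun ξ P)
    (hident : ∀ i, IdentDistrib (ξ i) (ξ 0) P P) (hL2 : MemLp (ξ 0) 2 P)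
    (hmean : ∀ u : E, ∫ ω, inner ℝ u (ξ 0 ω) ∂P = 0)
    (hcov : ∀ u : E, ∫ ω, inner ℝ u (ξ 0 ω) ^ 2 ∂P = ‖u‖ ^ 2)
    (g : (n : ℕ) → Fin n → Ω → E) (hg : ∀ n i, Measurable (g n i))
    (h1 : Tendsto (fun a : ℕ × Ω => (a.1 : ℝ)⁻¹ * ∑ i : Fin a.1, ‖g a.1 i a.2 - ξ i a.2‖ ^ 2)
      (inProb P) (𝓝 0))
    (h2 : Tendsto (fun a : ℕ × Ω => (√(a.1 : ℝ))⁻¹ • ∑ i : Fin a.1, (g a.1 i a.2 - ξ i a.2))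
      (inProb P) (𝓝 0)) :
    TendstoInDistribution (fun (n : ℕ) ω => empLogLik fun i : Fin n => g n i ω)
      atTop Real.toEReal (fun _ => P) (chiSquared d) := by
  have hlm : ∀ n : ℕ, Measurable fun ω => empLogLik fun i : Fin n => g n i ω := fun n =>
    measurable_empLogLik.comp (measurable_pi_lambda _ fun i => hg n i)
  set A : ℕ × Ω → ℝ := fun a => (a.1 : ℝ)⁻¹ * ∑ i : Fin a.1, ‖g a.1 i a.2 - ξ i a.2‖ ^ 2 with hA
  set e : ℕ × Ω → E := fun a => (√(a.1 : ℝ))⁻¹ • ∑ i : Fin a.1, (g a.1 i a.2 - ξ i a.2) with he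
  set s : ℕ × Ω → E := fun a => (√(a.1 : ℝ))⁻¹ • ∑ i : Fin a.1, ξ i a.2 with hs
  set v : ℕ × Ω → E := fun a => (√(a.1 : ℝ))⁻¹ • ∑ i : Fin a.1, g a.1 i a.2 with hv
  have hvse : ∀ a, v a = s a + e a := fun a => by
    simp only [hv, hs, he, Finset.sum_sub_distrib, smul_sub, add_sub_cancel]
  set L : ℕ × Ω → ℝ := fun a => (a.1 : ℝ)⁻¹ * ∑ i : Fin a.1, ‖ξ i a.2‖ ^ 2 with hL
  set G : ℕ × Ω → ℝ := fun a => (√(a.1 : ℝ))⁻¹ * ⨆ i : Fin a.1, ‖ξ i a.2‖ with hG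
  have hLlim : Tendsto L (inProb P) (𝓝 (∫ ω, ‖ξ 0 ω‖ ^ 2 ∂P)) := by
    have hmeas : Measurable fun x : E => ‖x‖ ^ 2 := by fun_prop
    simpa using tendsto_inProb_average (X := fun i ω => ‖ξ i ω‖ ^ 2)
      ((memLp_two_iff_integrable_sq_norm hL2.1).1 hL2)
      (hindep.comp (fun _ x => ‖x‖ ^ 2) fun _ => hmeas) (fun i => (hident i).comp hmeas)
  have hGlim : Tendsto G (inProb P) (𝓝 0) := tendsto_inProb_iSup_norm hident hL2
  have hsb : BddInProb P fun a => ‖s a‖ := bddInProb_norm_sqrt_sum hindep hident hL2 hmean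
  have helim : Tendsto (fun a => ‖e a‖) (inProb P) (𝓝 0) := by simpa using h2.norm
  have hvb : BddInProb P fun a => ‖v a‖ := by
    refine (hsb.add (bddInProb_of_tendsto helim)).of_le (Eventually.of_forall fun a => ?_)
    rw [abs_norm, abs_of_nonneg (by positivity), hvse]
    exact norm_add_le _ _
  obtain ⟨D, hDlim, hD⟩ := exists_tendsto_inProb_quadratic (P := P) (c := fun _ _ => (1 : ℝ))
    (v := ξ) (hindep.comp (fun _ x => ((1 : ℝ), x)) fun _ => by fun_prop)
    (fun i => (hident i).comp (u := fun x => ((1 : ℝ), x)) (by fun_prop))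
    (by simpa using (memLp_two_iff_integrable_sq_norm hL2.1).1 hL2)
  have hNlim : Tendsto (fun a : ℕ × Ω => (a.1 : ℝ)⁻¹) (inProb P) (𝓝 0) :=
    (tendsto_inv_atTop_nhds_zero_nat (𝕜 := ℝ)).comp (tendsto_fst_inProb P)
  have hsA : Tendsto (fun a => √(A a)) (inProb P) (𝓝 0) := by simpa using h1.sqrt
  -- the relative error of the quadratic approximation
  set κ : ℕ × Ω → ℝ := fun a => |D a| + (A a + 2 * (√(A a) * √(L a))) +
    ‖v a‖ * (‖v a‖ * (a.1 : ℝ)⁻¹) + ‖v a‖ * (G a + √(A a)) with hκ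
  have hκlim : Tendsto κ (inProb P) (𝓝 0) := by
    have t1 := hDlim.abs.add (h1.add ((hsA.mul hLlim.sqrt).const_mul 2))
    have t2 := hvb _ (hvb _ hNlim)
    have t3 := hvb _ (hGlim.add hsA |>.trans_eq (by rw [add_zero]))
    simpa using (t1.add t2).add t3
  have hmain : ∀ᶠ a in inProb P, ∃ r : ℝ, (empLogLik fun i : Fin a.1 => g a.1 i a.2) = (r : EReal) ∧
      |r - ‖v a‖ ^ 2| ≤ 100 * κ a * ‖v a‖ ^ 2 := by
    filter_upwards [hκlim.eventually (ge_mem_nhds (show (0 : ℝ) < 1 / 16 by norm_num)),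
      (tendsto_fst_inProb P).eventually (eventually_ge_atTop 2)] with a ha ha2
    refine empLogLik_approx_of_near ha2 _ (fun i : Fin a.1 => ξ i a.2) (A := A a) (L := L a)
      (G := G a) (D := D a) rfl rfl rfl rfl (fun u => ?_) rfl ha
    have q2 := hD a u u
    simpa only [one_mul, ← sq, hcov] using q2
  refine tendstoInDistribution_chiSquared hindep hident hL2 hmean hcov
    (r := fun n ω => (empLogLik fun i : Fin n => g n i ω).toReal)
    (fun n => (hlm n).aemeasurable) (fun n => (hlm n).ereal_toReal.aemeasurable) ?_ ?_
  · filter_upwards [hmain] with a ha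
    obtain ⟨r, hr, -⟩ := ha
    rw [hr, EReal.toReal_coe]
  · have t1 : Tendsto (fun a => 100 * (‖v a‖ * (‖v a‖ * κ a)) +
        (2 * (‖s a‖ * ‖e a‖) + ‖e a‖ * ‖e a‖)) (inProb P) (𝓝 0) := by
      simpa using ((hvb _ (hvb _ hκlim)).const_mul 100).add
        (((hsb _ helim).const_mul 2).add (helim.mul helim))
    refine squeeze_zero_norm' ?_ t1
    filter_upwards [hmain] with a ha
    obtain ⟨r, hr, hr2⟩ := ha
    rw [hr, EReal.toReal_coe, Real.norm_eq_abs]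
    have q1 : |‖v a‖ ^ 2 - ‖s a‖ ^ 2| ≤ 2 * (‖s a‖ * ‖e a‖) + ‖e a‖ * ‖e a‖ := by
      rw [hvse, norm_add_sq_real]
      have q3 := abs_le.1 (abs_real_inner_le_norm (s a) (e a))
      rw [abs_le]
      constructor <;> nlinarith [sq_nonneg ‖e a‖]
    calc |r - ‖s a‖ ^ 2| ≤ |r - ‖v a‖ ^ 2| + |‖v a‖ ^ 2 - ‖s a‖ ^ 2| := abs_sub_le _ _ _
      _ ≤ _ := add_le_add (hr2.trans (le_of_eq (by ring))) q1

/-- Wilks' theorem for a triangular array `g` which is close to centred independent identically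
distributed variables with nondegenerate second moments. -/
theorem empLogLik_tendsto {ξ : ℕ → Ω → E} (hindep : iIndepFun ξ P)
    (hident : ∀ i, IdentDistrib (ξ i) (ξ 0) P P) (hL2 : MemLp (ξ 0) 2 P)
    (hmean : ∀ u : E, ∫ ω, inner ℝ u (ξ 0 ω) ∂P = 0)
    (hpos : ∀ u : E, u ≠ 0 → 0 < ∫ ω, inner ℝ u (ξ 0 ω) ^ 2 ∂P)
    (g : (n : ℕ) → Fin n → Ω → E) (hg : ∀ n i, Measurable (g n i))
    (h1 : Tendsto (fun a : ℕ × Ω => (a.1 : ℝ)⁻¹ * ∑ i : Fin a.1, ‖g a.1 i a.2 - ξ i a.2‖ ^ 2)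
      (inProb P) (𝓝 0))
    (h2 : Tendsto (fun a : ℕ × Ω => (√(a.1 : ℝ))⁻¹ • ∑ i : Fin a.1, (g a.1 i a.2 - ξ i a.2))
      (inProb P) (𝓝 0)) :
    TendstoInDistribution (fun (n : ℕ) ω => empLogLik fun i : Fin n => g n i ω)
      atTop Real.toEReal (fun _ => P) (chiSquared d) := by
  obtain ⟨B, hB⟩ := exists_whitening hL2 hpos
  set Bc : E →L[ℝ] E := LinearMap.toContinuousLinearMap (B : E →ₗ[ℝ] E) with hBc
  have hBB : ∀ x, B x = Bc x := fun x => rfl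
  have hBm : Measurable fun x => B x := by simp only [hBB]; fun_prop
  have h := empLogLik_tendsto_of_cov_one (ξ := fun i ω => B (ξ i ω))
    (hindep.comp (fun _ x => B x) fun _ => hBm) (fun i => (hident i).comp hBm)
    (Bc.comp_memLp' hL2)
    (fun u => ?_) hB (fun n i ω => B (g n i ω)) (fun n i => hBm.comp (hg n i)) ?_ ?_
  · simpa only [empLogLik_linearEquiv] using h
  · have q1 := hmean (Bc.adjoint u)
    simpa only [ContinuousLinearMap.adjoint_inner_left, hBB] using q1
  · have q1 := h1.const_mul (‖Bc‖ ^ 2)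
    rw [mul_zero] at q1
    refine squeeze_zero_norm (fun a => ?_) q1
    rw [Real.norm_of_nonneg (by positivity), mul_left_comm (‖Bc‖ ^ 2),
      Finset.mul_sum _ _ (‖Bc‖ ^ 2)]
    refine mul_le_mul_of_nonneg_left (Finset.sum_le_sum fun i _ => ?_) (by positivity)
    rw [← mul_pow, ← map_sub, hBB]
    gcongr
    exact Bc.le_opNorm _
  · have q1 := (Bc.continuous.tendsto 0).comp h2
    rw [map_zero] at q1
    refine q1.congr fun a => ?_
    simp only [Function.comp_apply, map_smul, map_sum, map_sub, hBB]

end Wilks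

/-! ### Mean square error of inverse selection probabilities at a fixed point -/

section Ratio

/-- The error of the ratio `max{1, S} / N`, with `S = K₀ + ∑ a` and `N = K₀ + ∑ o a`, as an estimate
of `1 / π`, in terms of `W = ∑ (1 - o / π) a` and of the number `B = ∑ o I` of observed
neighbours. -/
lemma sq_ratio_sub_le {ι : Type*} (s : Finset ι) {a o I : ι → ℝ} {K₀ C₁ C₂ c π : ℝ}
    (hC₁ : 0 < C₁) (hK1 : C₁ ≤ K₀) (hK2 : K₀ ≤ C₂) (hc : 0 < c) (hcπ : c ≤ π) (hπ : π ≤ 1)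
    (ho : ∀ j, o j = 0 ∨ o j = 1) (hI : ∀ j, I j = 0 ∨ I j = 1)
    (ha1 : ∀ j, C₁ * I j ≤ a j) :
    (max 1 (K₀ + ∑ j ∈ s, a j) / (K₀ + ∑ j ∈ s, o j * a j) - 1 / π) ^ 2 ≤
      2 * ((1 + C₂ / c) ^ 2 + (∑ j ∈ s, (1 - o j / π) * a j) ^ 2) /
        (C₁ ^ 2 * (1 + ∑ j ∈ s, o j * I j) ^ 2) := by
  have hπ0 : 0 < π := hc.trans_le hcπ
  have hI0 : ∀ j, 0 ≤ I j := fun j => by rcases hI j with h | h <;> simp [h]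
  have ho0 : ∀ j, 0 ≤ o j := fun j => by rcases ho j with h | h <;> simp [h]
  have ha0 : ∀ j, 0 ≤ a j := fun j => (mul_nonneg hC₁.le (hI0 j)).trans (ha1 j)
  set S := K₀ + ∑ j ∈ s, a j with hS
  set N := K₀ + ∑ j ∈ s, o j * a j with hN
  set B := ∑ j ∈ s, o j * I j with hB
  set W := ∑ j ∈ s, (1 - o j / π) * a j with hW
  have hB0 : 0 ≤ B := Finset.sum_nonneg fun j _ => mul_nonneg (ho0 j) (hI0 j)
  have hNB : C₁ * (1 + B) ≤ N := by
    have : C₁ * B ≤ ∑ j ∈ s, o j * a j := by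
      rw [hB, Finset.mul_sum]
      refine Finset.sum_le_sum fun j _ => ?_
      calc C₁ * (o j * I j) = o j * (C₁ * I j) := by ring
        _ ≤ o j * a j := mul_le_mul_of_nonneg_left (ha1 j) (ho0 j)
    rw [hN]; linarith
  have hN0 : 0 < N := lt_of_lt_of_le (by positivity) hNB
  have hS0 : 0 ≤ S := add_nonneg (hC₁.le.trans hK1) (Finset.sum_nonneg fun j _ => ha0 j)
  have hT1 : 0 ≤ max 1 S - S := sub_nonneg.2 (le_max_right _ _)
  have hT2 : max 1 S - S ≤ 1 := by
    rcases le_total S 1 with h | h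
    · rw [max_eq_left h]; linarith
    · rw [max_eq_right h]; linarith
  have hSN : S - N / π = K₀ * (1 - 1 / π) + W := by
    have h1 : ∑ j ∈ s, a j - (∑ j ∈ s, o j * a j) / π = W := by
      rw [hW, Finset.sum_div, ← Finset.sum_sub_distrib]
      exact Finset.sum_congr rfl fun j _ => by ring
    rw [← h1, hS, hN]; ring
  have hK : |K₀ * (1 - 1 / π)| ≤ C₂ / c := by
    have h1 : 1 ≤ 1 / π := by rw [le_div_iff₀ hπ0]; linarith
    have h2 : 1 / π ≤ 1 / c := one_div_le_one_div_of_le hc hcπ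
    rw [abs_mul, abs_of_nonneg (hC₁.le.trans hK1), abs_of_nonpos (by linarith)]
    calc K₀ * -(1 - 1 / π) ≤ C₂ * (1 / c) := by
          apply mul_le_mul hK2 (by linarith) (by linarith) (by linarith)
      _ = C₂ / c := by ring
  have hR : max 1 S / N - 1 / π = ((max 1 S - S) + (K₀ * (1 - 1 / π) + W)) / N := by
    rw [← hSN]; field_simp; ring
  have hnum : |(max 1 S - S) + (K₀ * (1 - 1 / π) + W)| ≤ (1 + C₂ / c) + |W| := by
    refine (abs_add_le _ _).trans ?_
    have := abs_add_le (K₀ * (1 - 1 / π)) W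
    rw [abs_of_nonneg hT1]
    linarith
  rw [hR, div_pow]
  have hden : C₁ ^ 2 * (1 + B) ^ 2 ≤ N ^ 2 := by
    rw [← mul_pow]; gcongr
  have hnum2 : ((max 1 S - S) + (K₀ * (1 - 1 / π) + W)) ^ 2 ≤ 2 * ((1 + C₂ / c) ^ 2 + W ^ 2) := by
    rw [← sq_abs ((max 1 S - S) + (K₀ * (1 - 1 / π) + W)), ← sq_abs W]
    calc _ ≤ ((1 + C₂ / c) + |W|) ^ 2 := by gcongr
      _ ≤ _ := by nlinarith [sq_nonneg ((1 + C₂ / c) - |W|)]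
  gcongr

variable {Ω : Type*} [MeasurableSpace Ω] {P : Measure Ω} [IsProbabilityMeasure P] {ι : Type*}

/-- The second moment of a sum of independent bounded variables, in terms of bounds for the first
two moments of the summands. -/
lemma integral_sq_sum_le (s : Finset ι) {w : ι → Ω → ℝ} {L b v : ℝ}
    (hw : ∀ j, Measurable (w j)) (hL : ∀ j ω, |w j ω| ≤ L) (hindep : iIndepFun w P)
    (hb : ∀ j, |∫ ω, w j ω ∂P| ≤ b) (hv : ∀ j, ∫ ω, w j ω ^ 2 ∂P ≤ v) :
    Integrable (fun ω => (∑ j ∈ s, w j ω) ^ 2) P ∧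
      ∫ ω, (∑ j ∈ s, w j ω) ^ 2 ∂P ≤ s.card * v + (s.card * b) ^ 2 := by
  have hwL : ∀ j, MemLp (w j) 2 P := fun j =>
    MemLp.of_bound (hw j).aestronglyMeasurable L (Eventually.of_forall fun ω => hL j ω)
  have hS : MemLp (fun ω => ∑ j ∈ s, w j ω) 2 P := memLp_finsetSum s fun j _ => hwL j
  refine ⟨hS.integrable_sq, ?_⟩
  have h1 := variance_eq_sub hS
  have h2 := IndepFun.variance_sum (X := w) (s := s) (μ := P) (fun i _ => hwL i)
    (fun i _ j _ hij => hindep.indepFun hij)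
  have h3 : (∑ j ∈ s, w j) = fun ω => ∑ j ∈ s, w j ω := by ext ω; simp
  rw [h3] at h2
  have h4 : ∑ j ∈ s, Var[w j; P] ≤ s.card * v := by
    rw [← nsmul_eq_mul]
    refine Finset.sum_le_card_nsmul _ _ _ fun j _ => ?_
    exact (variance_le_expectation_sq (hw j).aestronglyMeasurable).trans (hv j)
  have h5 : (∫ ω, ∑ j ∈ s, w j ω ∂P) ^ 2 ≤ (s.card * b) ^ 2 := by
    rw [← sq_abs (∫ ω, ∑ j ∈ s, w j ω ∂P)]
    gcongr
    rw [integral_finsetSum _ fun i _ => (hwL i).integrable (by norm_num), ← nsmul_eq_mul]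
    exact (Finset.abs_sum_le_sum_abs _ _).trans (Finset.sum_le_card_nsmul _ _ _ fun j _ => hb j)
  have h6 : ∫ ω, (∑ j ∈ s, w j ω) ^ 2 ∂P =
      Var[fun ω => ∑ j ∈ s, w j ω; P] + (∫ ω, ∑ j ∈ s, w j ω ∂P) ^ 2 := by
    rw [h1]; simp
  rw [h6, h2]
  linarith

/-- A Chernoff bound: the exponential moment of `s A - B`, with `A` the number of neighbours and `B`
the number of observed ones, for a small enough `s > 0`. -/
lemma integral_exp_neighbours_le (s : Finset ι) {o I : ι → Ω → ℝ} {c m : ℝ} (hc : 0 < c)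
    (hom : ∀ j, Measurable (o j)) (hIm : ∀ j, Measurable (I j))
    (ho : ∀ j ω, o j ω = 0 ∨ o j ω = 1) (hI : ∀ j ω, I j ω = 0 ∨ I j ω = 1)
    (hindep : iIndepFun (fun j ω => (I j ω, o j ω)) P)
    (hm : ∀ j, ∫ ω, I j ω ∂P = m) (hcm : ∀ j, c * m ≤ ∫ ω, o j ω * I j ω ∂P) :
    Integrable (fun ω => Real.exp (Real.log (1 + c * (1 - Real.exp (-1)) / 2) * ∑ j ∈ s, I j ω -
        ∑ j ∈ s, o j ω * I j ω)) P ∧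
    ∫ ω, Real.exp (Real.log (1 + c * (1 - Real.exp (-1)) / 2) * ∑ j ∈ s, I j ω -
        ∑ j ∈ s, o j ω * I j ω) ∂P ≤ Real.exp (-(c * (1 - Real.exp (-1)) / 2 * (s.card * m))) := by
  set q := 1 - Real.exp (-1) with hq
  have hq0 : 0 < q := by
    rw [hq, sub_pos, Real.exp_lt_one_iff]; norm_num
  set θ := c * q / 2 with hθ
  have hθ0 : 0 < θ := by positivity
  set t := Real.log (1 + θ) with ht
  have het : Real.exp t = 1 + θ := Real.exp_log (by linarith)
  set y : ι → Ω → ℝ := fun j ω => t * I j ω - o j ω * I j ω with hy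
  have hsum : ∀ ω, t * ∑ j ∈ s, I j ω - ∑ j ∈ s, o j ω * I j ω = ∑ j ∈ s, y j ω := by
    intro ω
    simp only [hy]
    rw [Finset.sum_sub_distrib, Finset.mul_sum]
  simp only [hsum]
  have hym : ∀ j, Measurable (y j) := fun j => by
    have := hom j; have := hIm j; simp only [hy]; fun_prop
  have hyindep : iIndepFun y P :=
    hindep.comp (fun _ x => t * x.1 - x.2 * x.1) fun _ => by fun_prop
  have hexp : ∀ j ω, Real.exp (y j ω) = 1 + θ * I j ω - (1 + θ) * q * (o j ω * I j ω) := by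
    intro j ω
    simp only [hy]
    rcases hI j ω with h | h <;> rcases ho j ω with h' | h' <;> simp [h, h', het]
    rw [sub_eq_add_neg, Real.exp_add, het, hq]; ring
  have hm0 : ∀ j : ι, 0 ≤ m := fun j => by
    rw [← hm j]
    exact integral_nonneg fun ω => by rcases hI j ω with h | h <;> simp [h]
  have hIint : ∀ j, Integrable (I j) P := fun j =>
    (integrable_const (1 : ℝ)).mono' (hIm j).aestronglyMeasurable
      (Eventually.of_forall fun ω => by rcases hI j ω with h | h <;> simp [h])
  have hoIint : ∀ j, Integrable (fun ω => o j ω * I j ω) P := fun j =>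
    (integrable_const (1 : ℝ)).mono' ((hom j).mul (hIm j)).aestronglyMeasurable
      (Eventually.of_forall fun ω => by
        rcases hI j ω with h | h <;> rcases ho j ω with h' | h' <;> simp [h, h'])
  have hmgf : ∀ j, mgf (y j) P 1 ≤ Real.exp (-(θ * m)) := by
    intro j
    simp only [mgf, one_mul, hexp]
    have e1 : Integrable (fun ω => 1 + θ * I j ω) P :=
      (integrable_const _).add ((hIint j).const_mul _)
    rw [integral_sub e1 ((hoIint j).const_mul _), integral_add (integrable_const _)
        ((hIint j).const_mul _),
      integral_const_mul, integral_const_mul, hm]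
    have h1 := hcm j
    have h2 := Real.add_one_le_exp (-(θ * m))
    have h3 : q * (c * m) ≤ (1 + θ) * q * ∫ ω, o j ω * I j ω ∂P := by
      have h4 : 0 ≤ ∫ ω, o j ω * I j ω ∂P :=
        le_trans (mul_nonneg hc.le (hm0 j)) h1
      calc q * (c * m) ≤ q * ∫ ω, o j ω * I j ω ∂P := by gcongr
        _ ≤ (1 + θ) * (q * ∫ ω, o j ω * I j ω ∂P) :=
            le_mul_of_one_le_left (by positivity) (by linarith)
        _ = _ := by ring
    have h5 : q * (c * m) = 2 * (θ * m) := by rw [hθ]; ring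
    simp
    linarith
  have hbd : ∀ ω, ‖Real.exp (∑ j ∈ s, y j ω)‖ ≤ Real.exp (∑ _j ∈ s, t) := by
    intro ω
    rw [Real.norm_of_nonneg (Real.exp_pos _).le]
    refine Real.exp_le_exp.2 (Finset.sum_le_sum fun j _ => ?_)
    have ht0 : 0 ≤ t := Real.log_nonneg (by linarith)
    simp only [hy]
    rcases hI j ω with h | h <;> rcases ho j ω with h' | h' <;> simp [h, h', ht0]
  refine ⟨(integrable_const _).mono' ?_ (Eventually.of_forall hbd), ?_⟩
  · have : Measurable fun ω => ∑ j ∈ s, y j ω := Finset.measurable_fun_sum s fun j _ => hym j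
    exact (Real.measurable_exp.comp this).aestronglyMeasurable
  · have h1 := hyindep.mgf_sum hym s (t := 1)
    have h2 : mgf (∑ j ∈ s, y j) P 1 = ∫ ω, Real.exp (∑ j ∈ s, y j ω) ∂P := by
      simp [mgf]
    rw [← h2, h1]
    calc ∏ j ∈ s, mgf (y j) P 1 ≤ ∏ _j ∈ s, Real.exp (-(θ * m)) :=
          Finset.prod_le_prod (fun j _ => mgf_nonneg) fun j _ => hmgf j
      _ = Real.exp (-(θ * (s.card * m))) := by
          rw [Finset.prod_const, ← Real.exp_nat_mul]; congr 1; ring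

universe u

set_option maxHeartbeats 1000000 in
/-- Nonasymptotic bounds for the mean square error of `max{1, S} / N` as an estimate of `1 / π`:
a uniform one, and one which is small if the expected number `M = s.card * m` of neighbours is large
and the bias `b` is small. -/
lemma exists_lintegral_ratio_sq_le {C₁ C₂ c : ℝ} (hC₁ : 0 < C₁) (hC12 : C₁ ≤ C₂) (hc : 0 < c) :
    ∃ C : ℝ, 0 ≤ C ∧ ∀ {Ω : Type u} [MeasurableSpace Ω] (P : Measure Ω) [IsProbabilityMeasure P]
      {n : ℕ} (s : Finset (Fin n)) {a o I : Fin n → Ω → ℝ} {K₀ π m b : ℝ},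
      C₁ ≤ K₀ → K₀ ≤ C₂ → c ≤ π → π ≤ 1 →
      (∀ j, Measurable (a j)) → (∀ j, Measurable (o j)) → (∀ j, Measurable (I j)) →
      (∀ j ω, o j ω = 0 ∨ o j ω = 1) → (∀ j ω, I j ω = 0 ∨ I j ω = 1) →
      (∀ j ω, C₁ * I j ω ≤ a j ω) → (∀ j ω, a j ω ≤ C₂ * I j ω) →
      iIndepFun (fun j ω => (I j ω, o j ω, a j ω)) P →
      (∀ j, ∫ ω, I j ω ∂P = m) → (∀ j, c * m ≤ ∫ ω, o j ω * I j ω ∂P) →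
      (∀ j, |∫ ω, (1 - o j ω / π) * a j ω ∂P| ≤ b * m) →
      ∫⁻ ω, ENNReal.ofReal ((max 1 (K₀ + ∑ j ∈ s, a j ω) / (K₀ + ∑ j ∈ s, o j ω * a j ω)
          - 1 / π) ^ 2) ∂P ≤ ENNReal.ofReal C ∧
      (0 < s.card * m → ∫⁻ ω, ENNReal.ofReal ((max 1 (K₀ + ∑ j ∈ s, a j ω) /
          (K₀ + ∑ j ∈ s, o j ω * a j ω) - 1 / π) ^ 2) ∂P ≤
        ENNReal.ofReal (C * (1 / (s.card * m) ^ 2 + 1 / (s.card * m) + b ^ 2))) := by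
  have hC2 : 0 < C₂ := hC₁.trans_le hC12
  set C₃ := 1 + C₂ / c with hC₃
  have hC2c : 0 < C₂ / c := by positivity
  have hC₃0 : 0 < C₃ := by positivity
  set θ := c * (1 - Real.exp (-1)) / 2 with hθ
  have hθ0 : 0 < θ := by
    have : 0 < 1 - Real.exp (-1) := by rw [sub_pos, Real.exp_lt_one_iff]; norm_num
    positivity
  set t := Real.log (1 + θ) with ht
  have ht0 : 0 < t := Real.log_pos (by linarith)
  set C₅ := 2 * C₃ ^ 2 / C₁ ^ 2 * (2 / t ^ 2) * Real.exp t with hC₅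
  have hC₅0 : 0 < C₅ := by positivity
  set C₆ := 8 * C₃ ^ 2 / (C₁ ^ 2 * θ ^ 2) + 8 / (C₁ ^ 2 * θ ^ 2) + 2 * C₅ / θ with hC₆
  have hC₆0 : 0 < C₆ := by positivity
  refine ⟨C₆ * (2 + C₃ ^ 2) + 12 * C₃ ^ 2 / C₁ ^ 2, by positivity, ?_⟩
  intro Ω _ P _ n s a o I K₀ π m b hK1 hK2 hcπ hπ ham hom hIm ho hI ha1 ha2 hindep hm hcm hb
  have hπ0 : 0 < π := hc.trans_le hcπ
  have hI0 : ∀ j ω, 0 ≤ I j ω := fun j ω => by rcases hI j ω with h | h <;> simp [h]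
  have ho0 : ∀ j ω, 0 ≤ o j ω := fun j ω => by rcases ho j ω with h | h <;> simp [h]
  have hI1 : ∀ j ω, |I j ω| ≤ 1 := fun j ω => by rcases hI j ω with h | h <;> simp [h]
  have hIsq : ∀ j ω, I j ω ^ 2 = I j ω := fun j ω => by rcases hI j ω with h | h <;> simp [h]
  have hIint : ∀ j, Integrable (I j) P := fun j =>
    (integrable_const (1 : ℝ)).mono' (hIm j).aestronglyMeasurable
      (Eventually.of_forall fun ω => hI1 j ω)
  set M := s.card * m with hM
  set w : Fin n → Ω → ℝ := fun j ω => (1 - o j ω / π) * a j ω with hw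
  have hwm : ∀ j, Measurable (w j) := fun j => by
    have := ham j; have := hom j; simp only [hw]; fun_prop
  have hwI : ∀ j ω, |w j ω| ≤ C₂ / c * I j ω := by
    intro j ω
    have ha0 : 0 ≤ a j ω := (mul_nonneg hC₁.le (hI0 j ω)).trans (ha1 j ω)
    have h1 : |1 - o j ω / π| ≤ 1 / c := by
      have h2 : 1 / π ≤ 1 / c := one_div_le_one_div_of_le hc hcπ
      have h3 : 1 ≤ 1 / π := by rw [le_div_iff₀ hπ0]; linarith
      rcases ho j ω with h | h
      · rw [h]; simp only [zero_div, sub_zero, abs_one]; linarith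
      · rw [h, abs_of_nonpos (by linarith)]; linarith
    simp only [hw]
    rw [abs_mul, abs_of_nonneg ha0]
    calc |1 - o j ω / π| * a j ω ≤ 1 / c * (C₂ * I j ω) := by
          gcongr
          exact ha2 j ω
      _ = C₂ / c * I j ω := by ring
  set A : Ω → ℝ := fun ω => ∑ j ∈ s, I j ω with hA
  set B : Ω → ℝ := fun ω => ∑ j ∈ s, o j ω * I j ω with hB
  set W : Ω → ℝ := fun ω => ∑ j ∈ s, w j ω with hW
  have hA0 : ∀ ω, 0 ≤ A ω := fun ω => Finset.sum_nonneg fun j _ => hI0 j ω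
  have hB0 : ∀ ω, 0 ≤ B ω := fun ω =>
    Finset.sum_nonneg fun j _ => mul_nonneg (ho0 j ω) (hI0 j ω)
  have hWA : ∀ ω, |W ω| ≤ C₂ / c * A ω := fun ω => by
    simp only [hW, hA, Finset.mul_sum]
    exact (Finset.abs_sum_le_sum_abs _ _).trans (Finset.sum_le_sum fun j _ => hwI j ω)
  set R : Ω → ℝ := fun ω => (max 1 (K₀ + ∑ j ∈ s, a j ω) / (K₀ + ∑ j ∈ s, o j ω * a j ω)
    - 1 / π) ^ 2 with hR
  have hRle : ∀ ω, R ω ≤ 2 * (C₃ ^ 2 + W ω ^ 2) / (C₁ ^ 2 * (1 + B ω) ^ 2) := fun ω =>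
    sq_ratio_sub_le s (a := fun j => a j ω) (o := fun j => o j ω) (I := fun j => I j ω) hC₁ hK1 hK2
      hc hcπ hπ (fun j => ho j ω) (fun j => hI j ω) fun j => ha1 j ω
  have hRA : ∀ ω, R ω ≤ 2 * C₃ ^ 2 / C₁ ^ 2 * (1 + A ω) ^ 2 := by
    intro ω
    refine (hRle ω).trans ?_
    have h1 : W ω ^ 2 ≤ (C₃ * A ω) ^ 2 := by
      rw [← sq_abs (W ω)]
      have : C₂ / c * A ω ≤ C₃ * A ω := by have := hA0 ω; gcongr; linarith
      have := hWA ω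
      gcongr
      linarith
    have h2 : C₁ ^ 2 * 1 ≤ C₁ ^ 2 * (1 + B ω) ^ 2 := by
      have := hB0 ω
      gcongr
      nlinarith
    calc 2 * (C₃ ^ 2 + W ω ^ 2) / (C₁ ^ 2 * (1 + B ω) ^ 2)
        ≤ 2 * (C₃ ^ 2 + (C₃ * A ω) ^ 2) / (C₁ ^ 2 * 1) := by gcongr
      _ = 2 * C₃ ^ 2 / C₁ ^ 2 * (1 + A ω ^ 2) := by field_simp
      _ ≤ 2 * C₃ ^ 2 / C₁ ^ 2 * (1 + A ω) ^ 2 := by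
          gcongr
          nlinarith [hA0 ω]
  have hRτ : ∀ τ : ℝ, 0 < τ → ∀ ω, R ω ≤ 2 / (C₁ ^ 2 * τ ^ 2) * (C₃ ^ 2 + W ω ^ 2) +
      C₅ * Real.exp τ * Real.exp (t * A ω - B ω) := by
    intro τ hτ ω
    rcases le_or_gt τ (1 + B ω) with h | h
    · have h1 : 2 * (C₃ ^ 2 + W ω ^ 2) / (C₁ ^ 2 * (1 + B ω) ^ 2) ≤
          2 * (C₃ ^ 2 + W ω ^ 2) / (C₁ ^ 2 * τ ^ 2) := by gcongr
      have h2 : 0 ≤ C₅ * Real.exp τ * Real.exp (t * A ω - B ω) := by positivity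
      have h3 : 2 / (C₁ ^ 2 * τ ^ 2) * (C₃ ^ 2 + W ω ^ 2) =
          2 * (C₃ ^ 2 + W ω ^ 2) / (C₁ ^ 2 * τ ^ 2) := by ring
      rw [h3]
      linarith [hRle ω]
    · have h1 : (1 + A ω) ^ 2 ≤ 2 / t ^ 2 * Real.exp (t * (1 + A ω)) := by
        have h2 := Real.quadratic_le_exp_of_nonneg (x := t * (1 + A ω))
          (by have := hA0 ω; positivity)
        have h3 : (t * (1 + A ω)) ^ 2 / 2 ≤ Real.exp (t * (1 + A ω)) := by
          have : 0 ≤ t * (1 + A ω) := by have := hA0 ω; positivity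
          linarith
        rw [div_mul_eq_mul_div, le_div_iff₀ (by positivity)]
        linarith [mul_pow t (1 + A ω) 2]
      have h4 : Real.exp (t * (1 + A ω)) ≤
          Real.exp t * Real.exp τ * Real.exp (t * A ω - B ω) := by
        rw [← Real.exp_add, ← Real.exp_add]
        exact Real.exp_le_exp.2 (by linarith)
      have h5 : 0 ≤ 2 / (C₁ ^ 2 * τ ^ 2) * (C₃ ^ 2 + W ω ^ 2) := by positivity
      calc R ω ≤ 2 * C₃ ^ 2 / C₁ ^ 2 * (1 + A ω) ^ 2 := hRA ω
        _ ≤ 2 * C₃ ^ 2 / C₁ ^ 2 * (2 / t ^ 2 *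
            (Real.exp t * Real.exp τ * Real.exp (t * A ω - B ω))) := by
            gcongr; exact h1.trans (by gcongr)
        _ = C₅ * Real.exp τ * Real.exp (t * A ω - B ω) := by rw [hC₅]; ring
        _ ≤ _ := by linarith
  have hlint : ∀ {F : Ω → ℝ} {y : ℝ}, (∀ ω, R ω ≤ F ω) → Integrable F P → ∫ ω, F ω ∂P ≤ y →
      ∫⁻ ω, ENNReal.ofReal (R ω) ∂P ≤ ENNReal.ofReal y := by
    intro F y hF hFint hFy
    calc ∫⁻ ω, ENNReal.ofReal (R ω) ∂P ≤ ∫⁻ ω, ENNReal.ofReal (F ω) ∂P :=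
          lintegral_mono fun ω => ENNReal.ofReal_le_ofReal (hF ω)
      _ = ENNReal.ofReal (∫ ω, F ω ∂P) := (ofReal_integral_eq_lintegral_ofReal hFint
          (Eventually.of_forall fun ω => (sq_nonneg _).trans (hF ω))).symm
      _ ≤ ENNReal.ofReal y := ENNReal.ofReal_le_ofReal hFy
  have hwsq : ∀ j, ∫ ω, w j ω ^ 2 ∂P ≤ C₃ ^ 2 * m := by
    intro j
    rw [← hm j, ← integral_const_mul]
    refine integral_mono_of_nonneg (Eventually.of_forall fun ω => sq_nonneg _)
      ((hIint j).const_mul _) (Eventually.of_forall fun ω => ?_)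
    simp only
    rw [← sq_abs, ← hIsq j ω, ← mul_pow]
    have h1 := hwI j ω
    have h2 : C₂ / c * I j ω ≤ C₃ * I j ω := by have := hI0 j ω; gcongr; linarith
    gcongr
    linarith
  have hIo : iIndepFun (fun j ω => (I j ω, o j ω)) P :=
    hindep.comp (fun _ x => (x.1, x.2.1)) fun _ => by fun_prop
  have hwindep : iIndepFun w P :=
    hindep.comp (fun _ x => (1 - x.2.1 / π) * x.2.2) fun _ => by fun_prop
  have hIindep : iIndepFun I P := hindep.comp (fun _ x => x.1) fun _ => by fun_prop
  have hwL : ∀ j ω, |w j ω| ≤ C₂ / c := fun j ω =>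
    (hwI j ω).trans (mul_le_of_le_one_right hC2c.le ((le_abs_self _).trans (hI1 j ω)))
  -- the bound by the number of neighbours and the bias
  have key : ∀ b' : ℝ, (∀ j, |∫ ω, w j ω ∂P| ≤ b' * m) → 0 < M →
      ∫⁻ ω, ENNReal.ofReal (R ω) ∂P ≤ ENNReal.ofReal (C₆ * (1 / M ^ 2 + 1 / M + b' ^ 2)) := by
    intro b' hb' hM0
    obtain ⟨hWi, hWle⟩ := integral_sq_sum_le s hwm hwL hwindep hb' hwsq
    obtain ⟨hEi, hEle⟩ := integral_exp_neighbours_le s hc hom hIm ho hI hIo hm hcm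
    rw [← hθ, ← hM] at hEle
    have hτ : 0 < θ * M / 2 := by positivity
    have hF1 : Integrable (fun ω => 2 / (C₁ ^ 2 * (θ * M / 2) ^ 2) * (C₃ ^ 2 + W ω ^ 2)) P :=
      ((integrable_const _).add hWi).const_mul _
    have hF2 : Integrable (fun ω => C₅ * Real.exp (θ * M / 2) * Real.exp (t * A ω - B ω)) P :=
      hEi.const_mul _
    refine hlint (hRτ (θ * M / 2) hτ) (hF1.add hF2) ?_
    rw [integral_add hF1 hF2, integral_const_mul, integral_const_mul,
      integral_add (integrable_const _) hWi]
    have h1 : ∫ ω, W ω ^ 2 ∂P ≤ C₃ ^ 2 * M + (b' * M) ^ 2 := by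
      refine hWle.trans (le_of_eq ?_)
      rw [hM]; ring
    have h2 : C₅ * Real.exp (θ * M / 2) * ∫ ω, Real.exp (t * A ω - B ω) ∂P ≤
        C₅ * (2 / θ * (1 / M)) := by
      have h3 : Real.exp (θ * M / 2) * Real.exp (-(θ * M)) = Real.exp (-(θ * M / 2)) := by
        rw [← Real.exp_add]; congr 1; ring
      have h4 : Real.exp (-(θ * M / 2)) ≤ 2 / θ * (1 / M) := by
        rw [Real.exp_neg]
        have h5 := Real.add_one_le_exp (θ * M / 2)
        calc (Real.exp (θ * M / 2))⁻¹ ≤ (θ * M / 2)⁻¹ := inv_anti₀ hτ (by linarith)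
          _ = 2 / θ * (1 / M) := by field_simp
      calc C₅ * Real.exp (θ * M / 2) * ∫ ω, Real.exp (t * A ω - B ω) ∂P
          ≤ C₅ * Real.exp (θ * M / 2) * Real.exp (-(θ * M)) := by gcongr
        _ = C₅ * Real.exp (-(θ * M / 2)) := by rw [mul_assoc, h3]
        _ ≤ _ := by gcongr
    have h6 : 2 / (C₁ ^ 2 * (θ * M / 2) ^ 2) * (C₃ ^ 2 + (C₃ ^ 2 * M + (b' * M) ^ 2)) =
        8 * C₃ ^ 2 / (C₁ ^ 2 * θ ^ 2) * (1 / M ^ 2 + 1 / M) + 8 / (C₁ ^ 2 * θ ^ 2) * b' ^ 2 := by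
      field_simp
      ring
    have h7 : 2 / (C₁ ^ 2 * (θ * M / 2) ^ 2) * (∫ _ω, C₃ ^ 2 ∂P + ∫ ω, W ω ^ 2 ∂P) ≤
        2 / (C₁ ^ 2 * (θ * M / 2) ^ 2) * (C₃ ^ 2 + (C₃ ^ 2 * M + (b' * M) ^ 2)) := by
      have : ∫ _ω, C₃ ^ 2 ∂P = C₃ ^ 2 := by simp
      rw [this]
      gcongr
    rw [h6] at h7
    have p1 : 0 ≤ 8 * C₃ ^ 2 / (C₁ ^ 2 * θ ^ 2) := by positivity
    have p2 : 0 ≤ 8 / (C₁ ^ 2 * θ ^ 2) := by positivity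
    have p3 : 0 ≤ 2 * C₅ / θ := by positivity
    have p4 : 0 ≤ 1 / M ^ 2 := by positivity
    have p5 : 0 ≤ 1 / M := by positivity
    have p6 : 0 ≤ b' ^ 2 := sq_nonneg _
    have h8 : C₅ * (2 / θ * (1 / M)) = 2 * C₅ / θ * (1 / M) := by ring
    have h9 : C₆ * (1 / M ^ 2 + 1 / M + b' ^ 2) =
        8 * C₃ ^ 2 / (C₁ ^ 2 * θ ^ 2) * (1 / M ^ 2 + 1 / M) + 8 / (C₁ ^ 2 * θ ^ 2) * b' ^ 2 +
        2 * C₅ / θ * (1 / M) + (8 * C₃ ^ 2 / (C₁ ^ 2 * θ ^ 2) * b' ^ 2 +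
        8 / (C₁ ^ 2 * θ ^ 2) * (1 / M ^ 2 + 1 / M) + 2 * C₅ / θ * (1 / M ^ 2 + b' ^ 2)) := by
      rw [hC₆]; ring
    have h10 : 0 ≤ 8 * C₃ ^ 2 / (C₁ ^ 2 * θ ^ 2) * b' ^ 2 +
        8 / (C₁ ^ 2 * θ ^ 2) * (1 / M ^ 2 + 1 / M) + 2 * C₅ / θ * (1 / M ^ 2 + b' ^ 2) := by
      positivity
    rw [h9]
    linarith
  refine ⟨?_, fun hM0 => (key b hb hM0).trans (ENNReal.ofReal_le_ofReal ?_)⟩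
  · rcases le_or_gt M 1 with hM1 | hM1
    · have hAI := integral_sq_sum_le s hIm hI1 hIindep (fun j => (abs_of_nonneg
        (integral_nonneg (hI0 j))).le.trans (hm j).le)
          (fun j => by simp only [hIsq]; exact (hm j).le)
      have hM0 : 0 ≤ M := by
        rcases s.eq_empty_or_nonempty with h | ⟨j, -⟩
        · simp [hM, h]
        · have : 0 ≤ m := by rw [← hm j]; exact integral_nonneg (hI0 j)
          positivity
      have hAint : Integrable (fun ω => 4 * C₃ ^ 2 / C₁ ^ 2 * (1 + A ω ^ 2)) P :=
        ((integrable_const _).add hAI.1).const_mul _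
      refine hlint (F := fun ω => 4 * C₃ ^ 2 / C₁ ^ 2 * (1 + A ω ^ 2)) (fun ω => ?_) hAint ?_
      · refine (hRA ω).trans ?_
        have h1 : (1 + A ω) ^ 2 ≤ 2 * (1 + A ω ^ 2) := by nlinarith [sq_nonneg (1 - A ω)]
        calc 2 * C₃ ^ 2 / C₁ ^ 2 * (1 + A ω) ^ 2
            ≤ 2 * C₃ ^ 2 / C₁ ^ 2 * (2 * (1 + A ω ^ 2)) := by gcongr
          _ = _ := by ring
      · rw [integral_const_mul, integral_add (integrable_const _) hAI.1]
        have h2 : ∫ ω, A ω ^ 2 ∂P ≤ 2 := by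
          refine hAI.2.trans ?_
          nlinarith
        calc 4 * C₃ ^ 2 / C₁ ^ 2 * (∫ _ω, (1 : ℝ) ∂P + ∫ ω, A ω ^ 2 ∂P)
            ≤ 4 * C₃ ^ 2 / C₁ ^ 2 * (1 + 2) := by gcongr; simp
          _ = 12 * C₃ ^ 2 / C₁ ^ 2 := by ring
          _ ≤ _ := le_add_of_nonneg_left (by positivity)
    · refine (key (C₂ / c) (fun j => ?_) (by linarith)).trans (ENNReal.ofReal_le_ofReal ?_)
      · rw [← hm j, ← integral_const_mul]
        exact norm_integral_le_of_norm_le (f := w j) ((hIint j).const_mul (C₂ / c))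
          (Eventually.of_forall fun ω => hwI j ω)
      · have h1 : 1 / M ^ 2 ≤ 1 := by
          rw [div_le_one (by positivity)]; nlinarith
        have h2 : 1 / M ≤ 1 := by rw [div_le_one (by linarith)]; linarith
        have h3 : (C₂ / c) ^ 2 ≤ C₃ ^ 2 := by gcongr; linarith
        calc C₆ * (1 / M ^ 2 + 1 / M + (C₂ / c) ^ 2) ≤ C₆ * (1 + 1 + C₃ ^ 2) := by gcongr
          _ = C₆ * (2 + C₃ ^ 2) := by ring
          _ ≤ _ := le_add_of_nonneg_right (by positivity)
  · have h1 : 0 ≤ 12 * C₃ ^ 2 / C₁ ^ 2 := by positivity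
    have h2 : C₆ * 1 ≤ C₆ * (2 + C₃ ^ 2) :=
      mul_le_mul_of_nonneg_left (by linarith [sq_nonneg C₃]) hC₆0.le
    exact mul_le_mul_of_nonneg_right (by linarith) (by positivity)

end Ratio

/-! ### Resampling one coordinate, and small balls -/

section Resampling

/-- Replacing one coordinate of a sample by an independent copy preserves the law of the sample. -/
lemma measurePreserving_update_prod {n : ℕ} {S : Type*} [MeasurableSpace S] (ν : Measure S)
    [IsProbabilityMeasure ν] (i : Fin n) :
    MeasurePreserving (fun q : (Fin n → S) × S => Function.update q.1 i q.2)
      ((Measure.pi fun _ => ν).prod ν) (Measure.pi fun _ : Fin n => ν) := by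
  refine ⟨measurable_update', ?_⟩
  symm
  refine Measure.pi_eq fun s hs => ?_
  rw [Measure.map_apply measurable_update' (MeasurableSet.univ_pi hs)]
  have h1 : (fun q : (Fin n → S) × S => Function.update q.1 i q.2) ⁻¹' (Set.univ.pi s) =
      (Set.univ.pi (Function.update s i Set.univ)) ×ˢ (s i) := by
    ext ⟨z, a⟩
    simp only [Set.mem_preimage, Set.mem_pi, Set.mem_univ, true_implies, Set.mem_prod]
    constructor
    · intro h
      refine ⟨fun j => ?_, by simpa using h i⟩
      by_cases hj : j = i
      · subst hj; simp
      · simpa [hj] using h j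
    · rintro ⟨h, h'⟩ j
      by_cases hj : j = i
      · subst hj; simpa using h'
      · simpa [hj] using h j
  rw [h1, Measure.prod_prod, Measure.pi_pi, ← Finset.mul_prod_erase _ _ (Finset.mem_univ i),
    ← Finset.mul_prod_erase _ (fun j => ν (s j)) (Finset.mem_univ i)]
  have h2 : ∏ j ∈ Finset.univ.erase i, ν (Function.update s i Set.univ j) =
      ∏ j ∈ Finset.univ.erase i, ν (s j) :=
    Finset.prod_congr rfl fun j hj => by rw [Function.update_of_ne (Finset.ne_of_mem_erase hj)]
  rw [h2, Function.update_self, measure_univ, one_mul, mul_comm]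

/-- The law of the first `n` terms of an independent identically distributed sequence. -/
lemma measurePreserving_sample {Ω S : Type*} [MeasurableSpace Ω] [MeasurableSpace S]
    {P : Measure Ω} [IsProbabilityMeasure P] {Z : ℕ → Ω → S} (hZ : ∀ i, Measurable (Z i))
    (hindep : iIndepFun Z P) (hident : ∀ i, IdentDistrib (Z i) (Z 0) P P) (n : ℕ) :
    MeasurePreserving (fun ω (i : Fin n) => Z i ω) P (Measure.pi fun _ : Fin n => P.map (Z 0)) := by
  refine ⟨measurable_pi_lambda _ fun i => hZ i, ?_⟩
  have h1 : iIndepFun (fun i : Fin n => Z i) P := hindep.precomp Fin.val_injective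
  rw [(iIndepFun_iff_map_fun_eq_pi_map fun i : Fin n => (hZ i).aemeasurable).1 h1]
  congr 1
  ext1 i
  exact (hident i).map_eq

end Resampling

section Balls

variable {p : ℕ}

local notation "V" => EuclideanSpace ℝ (Fin p)

/-- Almost every point for a finite measure has small balls of measure at least of the order of
their Lebesgue measure. -/
lemma ae_exists_mul_pow_le_measure_closedBall (μ : Measure V) [IsFiniteMeasure μ] :
    ∀ᵐ x ∂μ, ∃ κ > 0, ∀ᶠ r in 𝓝[>] (0 : ℝ), κ * r ^ p ≤ μ.real (Metric.closedBall x r) := by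
  filter_upwards [Besicovitch.ae_tendsto_rnDeriv (volume : Measure V) μ,
    Measure.rnDeriv_lt_top (volume : Measure V) μ] with x hx hx'
  set L := (volume : Measure V).rnDeriv μ x with hL
  set v := (volume : Measure V).real (Metric.ball (0 : V) 1) with hv
  have hv0 : 0 < v := by
    rw [hv, measureReal_def]
    exact ENNReal.toReal_pos (Metric.measure_ball_pos _ _ one_pos).ne' measure_ball_lt_top.ne
  refine ⟨v / (L.toReal + 1), by positivity, ?_⟩
  have h1 : L < ENNReal.ofReal (L.toReal + 1) := by
    rw [ENNReal.ofReal_add ENNReal.toReal_nonneg zero_le_one, ENNReal.ofReal_toReal hx'.ne]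
    simpa using ENNReal.lt_add_right hx'.ne one_ne_zero
  filter_upwards [hx.eventually (gt_mem_nhds h1), self_mem_nhdsWithin] with r hr hr0
  have hr0' : (0 : ℝ) < r := hr0
  have hpos : (0 : ENNReal) < volume (Metric.closedBall x r) :=
    Metric.measure_closedBall_pos _ _ hr0'
  have hμ0 : μ (Metric.closedBall x r) ≠ 0 := by
    intro h0
    rw [h0, ENNReal.div_zero hpos.ne'] at hr
    exact absurd hr (by simp)
  have h2 : volume (Metric.closedBall x r) ≤
      ENNReal.ofReal (L.toReal + 1) * μ (Metric.closedBall x r) :=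
    (ENNReal.div_le_iff hμ0 (measure_ne_top _ _)).1 hr.le
  have h3 : (volume (Metric.closedBall x r)).toReal = r ^ p * v := by
    rw [Measure.addHaar_closedBall _ _ hr0'.le, ENNReal.toReal_mul, finrank_euclideanSpace,
      Fintype.card_fin, ENNReal.toReal_ofReal (by positivity), hv, measureReal_def]
  have h4 := ENNReal.toReal_mono (by finiteness) h2
  rw [h3, ENNReal.toReal_mul, ENNReal.toReal_ofReal (by positivity)] at h4
  rw [div_mul_eq_mul_div, div_le_iff₀ (by positivity), measureReal_def]
  linarith

/-- Lebesgue's differentiation theorem along closed balls. -/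
lemma ae_tendsto_average_abs_sub (μ : Measure V) [IsFiniteMeasure μ] {u : V → ℝ}
    (hu : Integrable u μ) :
    ∀ᵐ x ∂μ, Tendsto (fun r => ⨍ y in Metric.closedBall x r, |u y - u x| ∂μ) (𝓝[>] 0) (𝓝 0) := by
  filter_upwards [(Besicovitch.vitaliFamily μ).ae_tendsto_average_norm_sub hu.locallyIntegrable]
    with x hx
  exact hx.comp (Besicovitch.tendsto_filterAt μ x)

end Balls

/-! ### Consistency of the inverse probability weights -/

section Weights

variable {p : ℕ} {S : Type*}

/-- The two-sided comparison of a kernel with the indicator of the ball of radius `ρ`. -/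
structure IsBallKernel (K : EuclideanSpace ℝ (Fin p) → ℝ) (C₁ C₂ ρ : ℝ) : Prop where
  measurable : Measurable K
  lower_pos : 0 < C₁
  radius_pos : 0 < ρ
  lower : ∀ u, C₁ * (Metric.closedBall (0 : EuclideanSpace ℝ (Fin p)) ρ).indicator 1 u ≤ K u
  upper : ∀ u, K u ≤ C₂ * (Metric.closedBall (0 : EuclideanSpace ℝ (Fin p)) ρ).indicator 1 u

lemma IsBallKernel.nonneg {K : EuclideanSpace ℝ (Fin p) → ℝ} {C₁ C₂ ρ : ℝ}
    (hK : IsBallKernel K C₁ C₂ ρ) (u : EuclideanSpace ℝ (Fin p)) :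
    0 ≤ K u := by
  refine le_trans (mul_nonneg hK.lower_pos.le ?_) (hK.lower u)
  exact Set.indicator_nonneg (fun _ _ => zero_le_one) _

lemma IsBallKernel.le_zero {K : EuclideanSpace ℝ (Fin p) → ℝ} {C₁ C₂ ρ : ℝ}
    (hK : IsBallKernel K C₁ C₂ ρ) : C₁ ≤ K 0 := by
  have := hK.lower 0
  rwa [Set.indicator_of_mem (by simpa using hK.radius_pos.le), Pi.one_apply, mul_one] at this

lemma IsBallKernel.zero_le {K : EuclideanSpace ℝ (Fin p) → ℝ} {C₁ C₂ ρ : ℝ}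
    (hK : IsBallKernel K C₁ C₂ ρ) : K 0 ≤ C₂ := by
  have := hK.upper 0
  rwa [Set.indicator_of_mem (by simpa using hK.radius_pos.le), Pi.one_apply, mul_one] at this

lemma IsBallKernel.le_upper {K : EuclideanSpace ℝ (Fin p) → ℝ} {C₁ C₂ ρ : ℝ}
    (hK : IsBallKernel K C₁ C₂ ρ) (u : EuclideanSpace ℝ (Fin p)) :
    K u ≤ C₂ := by
  refine (hK.upper u).trans ?_
  have h0 : 0 ≤ C₂ := hK.lower_pos.le.trans (hK.le_zero.trans hK.zero_le)
  refine mul_le_of_le_one_right h0 ?_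
  exact Set.indicator_le_self' (fun _ _ => zero_le_one) u |>.trans (by simp)

/-- The error of the kernel estimate of the weight `o / π` of the `i`-th unit of a sample `z`; here
`X` is the covariate and `o` the indicator of observation of a unit, and `π` the selection
probability as a function of the covariate. -/
noncomputable def weightErr (X : S → EuclideanSpace ℝ (Fin p)) (o : S → ℝ)
    (π K : EuclideanSpace ℝ (Fin p) → ℝ) (h : ℝ) {n : ℕ} (z : Fin n → S)
    (i : Fin n) : ℝ :=
  o (z i) / piHat K h (fun j => X (z j)) (fun j => o (z j)) (X (z i)) - o (z i) / π (X (z i))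

lemma weightErr_of_obs_eq_zero {X : S → EuclideanSpace ℝ (Fin p)} {o : S → ℝ}
    {π K : EuclideanSpace ℝ (Fin p) → ℝ} {h : ℝ} {n : ℕ}
    {z : Fin n → S} {i : Fin n} (hi : o (z i) = 0) : weightErr X o π K h z i = 0 := by
  simp [weightErr, hi]

lemma weightErr_update_of_obs_eq_one {X : S → EuclideanSpace ℝ (Fin p)} {o : S → ℝ}
    {π K : EuclideanSpace ℝ (Fin p) → ℝ} {h : ℝ} {n : ℕ}
    (z : Fin n → S) (i : Fin n) {a : S} (ha : o a = 1) :
    weightErr X o π K h (Function.update z i a) i =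
      max 1 (K 0 + ∑ j ∈ Finset.univ.erase i, K (h⁻¹ • (X (z j) - X a))) /
        (K 0 + ∑ j ∈ Finset.univ.erase i, o (z j) * K (h⁻¹ • (X (z j) - X a))) - 1 / π (X a) := by
  have h1 : ∑ j, K (h⁻¹ • (X (Function.update z i a j) - X a)) =
      K 0 + ∑ j ∈ Finset.univ.erase i, K (h⁻¹ • (X (z j) - X a)) := by
    rw [← Finset.add_sum_erase _ _ (Finset.mem_univ i), Function.update_self, sub_self, smul_zero]
    congr 1
    exact Finset.sum_congr rfl fun j hj => by
      rw [Function.update_of_ne (Finset.ne_of_mem_erase hj)]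
  have h2 : ∑ j, o (Function.update z i a j) * K (h⁻¹ • (X (Function.update z i a j) - X a)) =
      K 0 + ∑ j ∈ Finset.univ.erase i, o (z j) * K (h⁻¹ • (X (z j) - X a)) := by
    rw [← Finset.add_sum_erase _ _ (Finset.mem_univ i), Function.update_self, sub_self, smul_zero,
      ha, one_mul]
    congr 1
    exact Finset.sum_congr rfl fun j hj => by
      rw [Function.update_of_ne (Finset.ne_of_mem_erase hj)]
  simp only [weightErr, piHat, Function.update_self, ha, h1, h2, one_div_div]

variable [MeasurableSpace S]

/-- A unit of law `ν`, with covariate `X`, has its response observed (`o = 1`) with conditional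
probability `π X` given `X`, where `π` takes values in `[c, 1]`. -/
structure IsSelection (ν : Measure S) (X : S → EuclideanSpace ℝ (Fin p)) (o : S → ℝ)
    (π : EuclideanSpace ℝ (Fin p) → ℝ) (c : ℝ) : Prop where
  measurable_cov : Measurable X
  measurable_obs : Measurable o
  obs_eq : ∀ z, o z = 0 ∨ o z = 1
  measurable_sel : Measurable π
  pos : 0 < c
  le_sel : ∀ x, c ≤ π x
  sel_le : ∀ x, π x ≤ 1
  integral_obs_mul : ∀ φ : EuclideanSpace ℝ (Fin p) → ℝ, Measurable φ → (∃ C, ∀ x, |φ x| ≤ C) →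
    ∫ z, o z * φ (X z) ∂ν = ∫ z, π (X z) * φ (X z) ∂ν

lemma measurable_piHat {X : S → EuclideanSpace ℝ (Fin p)} {o : S → ℝ}
    {K : EuclideanSpace ℝ (Fin p) → ℝ} (hX : Measurable X)
    (ho : Measurable o) (hK : Measurable K) (h : ℝ) (n : ℕ) :
    Measurable fun q : (Fin n → S) × EuclideanSpace ℝ (Fin p) =>
      piHat K h (fun j => X (q.1 j)) (fun j => o (q.1 j)) q.2 := by
  unfold piHat
  fun_prop

lemma measurable_weightErr {X : S → EuclideanSpace ℝ (Fin p)} {o : S → ℝ}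
    {π K : EuclideanSpace ℝ (Fin p) → ℝ} (hX : Measurable X)
    (ho : Measurable o) (hπ : Measurable π) (hK : Measurable K) (h : ℝ) (n : ℕ) (i : Fin n) :
    Measurable fun z : Fin n → S => weightErr X o π K h z i := by
  have h1 : Measurable fun z : Fin n → S => piHat K h (fun j => X (z j)) (fun j => o (z j))
      (X (z i)) :=
    (measurable_piHat hX ho hK h n).comp (measurable_id.prodMk (hX.comp (measurable_pi_apply i)))
  unfold weightErr
  fun_prop

variable {ν : Measure S} [IsProbabilityMeasure ν] {X : S → EuclideanSpace ℝ (Fin p)} {o : S → ℝ}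
  {π K : EuclideanSpace ℝ (Fin p) → ℝ}
  {c C₁ C₂ ρ : ℝ}

/-- The mean square of the error of the weight of a unit with covariate `x`, given that unit. -/
noncomputable def condSqErr (ν : Measure S) (X : S → EuclideanSpace ℝ (Fin p)) (o : S → ℝ)
    (π K : EuclideanSpace ℝ (Fin p) → ℝ) (h : ℝ) {n : ℕ}
    (i : Fin n) (x : EuclideanSpace ℝ (Fin p)) : ENNReal :=
  ∫⁻ z, ENNReal.ofReal ((max 1 (K 0 + ∑ j ∈ Finset.univ.erase i, K (h⁻¹ • (X (z j) - x))) /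
    (K 0 + ∑ j ∈ Finset.univ.erase i, o (z j) * K (h⁻¹ • (X (z j) - x))) - 1 / π x) ^ 2)
    ∂(Measure.pi fun _ : Fin n => ν)

lemma measurable_condSqErr (hsel : IsSelection ν X o π c) (hK : IsBallKernel K C₁ C₂ ρ) (h : ℝ)
    {n : ℕ} (i : Fin n) : Measurable (condSqErr ν X o π K h i) := by
  have := hsel.measurable_cov
  have := hsel.measurable_obs
  have := hsel.measurable_sel
  have := hK.measurable
  unfold condSqErr
  refine Measurable.lintegral_prod_right'
      (f := fun q : EuclideanSpace ℝ (Fin p) × (Fin n → S) => ENNReal.ofReal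
    ((max 1 (K 0 + ∑ j ∈ Finset.univ.erase i, K (h⁻¹ • (X (q.2 j) - q.1))) /
    (K 0 + ∑ j ∈ Finset.univ.erase i, o (q.2 j) * K (h⁻¹ • (X (q.2 j) - q.1))) - 1 / π q.1) ^ 2)) ?_
  fun_prop

/-- The mean square error of the weight of a unit is bounded by resampling that unit: it
has an error only if it is observed, and then the other units enter through `condSqErr`. -/
lemma lintegral_weightErr_sq_le (hsel : IsSelection ν X o π c) (hK : IsBallKernel K C₁ C₂ ρ)
    (h : ℝ) {n : ℕ} (i : Fin n) {w : S → ENNReal} (hw : Measurable w) :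
    ∫⁻ z, w (z i) * ENNReal.ofReal (weightErr X o π K h z i ^ 2) ∂(Measure.pi fun _ : Fin n => ν) ≤
      ∫⁻ a, w a * condSqErr ν X o π K h i (X a) ∂ν := by
  have hEm := measurable_weightErr hsel.measurable_cov hsel.measurable_obs hsel.measurable_sel
    hK.measurable h n i
  have hFm : Measurable fun z : Fin n → S =>
      w (z i) * ENNReal.ofReal (weightErr X o π K h z i ^ 2) := by fun_prop
  have hmp := measurePreserving_update_prod ν i
  rw [← hmp.lintegral_comp hFm]
  have hFm' := hFm.comp hmp.measurable
  refine (lintegral_prod_symm' _ hFm').trans_le ?_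
  refine lintegral_mono fun a => ?_
  simp only [Function.comp_apply, Function.update_self]
  have h2 : Measurable fun z : Fin n → S =>
      ENNReal.ofReal (weightErr X o π K h (Function.update z i a) i ^ 2) := by
    have : Measurable fun z : Fin n → S => Function.update z i a :=
      measurable_update'.comp (measurable_id.prodMk measurable_const)
    have := hEm.comp this
    exact (this.pow_const 2).ennreal_ofReal
  rw [lintegral_const_mul _ h2]
  gcongr
  refine lintegral_mono fun z => ?_
  rcases hsel.obs_eq a with ha | ha
  · rw [weightErr_of_obs_eq_zero (by rw [Function.update_self, ha])]
    simp
  · rw [weightErr_update_of_obs_eq_one z i ha]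

/-- Bounds for `condSqErr`, with the expected number of neighbours and the oscillation of `π` around
the point. -/
lemma exists_condSqErr_le (hsel : IsSelection ν X o π c) (hK : IsBallKernel K C₁ C₂ ρ) :
    ∃ C : ℝ, 0 ≤ C ∧ ∀ (n : ℕ) (i : Fin n) (x : EuclideanSpace ℝ (Fin p)) (h : ℝ), 0 < h →
      condSqErr ν X o π K h i x ≤ ENNReal.ofReal C ∧
      (0 < ((n - 1 : ℕ) : ℝ) * (ν.map X).real (Metric.closedBall x (ρ * h)) →
        condSqErr ν X o π K h i x ≤ ENNReal.ofReal
          (C * (1 / (((n - 1 : ℕ) : ℝ) * (ν.map X).real (Metric.closedBall x (ρ * h))) ^ 2 +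
            1 / (((n - 1 : ℕ) : ℝ) * (ν.map X).real (Metric.closedBall x (ρ * h))) +
            (C₂ / c * ⨍ y in Metric.closedBall x (ρ * h), |π y - π x| ∂(ν.map X)) ^ 2))) := by
  obtain ⟨C, hC0, hC⟩ := exists_lintegral_ratio_sq_le hK.lower_pos (hK.le_zero.trans hK.zero_le)
    hsel.pos
  refine ⟨C, hC0, fun n i x h hh => ?_⟩
  have hXm := hsel.measurable_cov
  have hom := hsel.measurable_obs
  have hπm := hsel.measurable_sel
  have hKm := hK.measurable
  have hc := hsel.pos
  have hC2 : 0 < C₂ := hK.lower_pos.trans_le (hK.le_zero.trans hK.zero_le)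
  have : IsProbabilityMeasure (ν.map X) := Measure.isProbabilityMeasure_map hXm.aemeasurable
  set b : Set (EuclideanSpace ℝ (Fin p)) := Metric.closedBall x (ρ * h) with hb
  have hbm : MeasurableSet b := Metric.isClosed_closedBall.measurableSet
  set m := (ν.map X).real b with hm
  have hball : ∀ y : EuclideanSpace ℝ (Fin p), h⁻¹ • (y - x) ∈ Metric.closedBall
      (0 : EuclideanSpace ℝ (Fin p)) ρ ↔ y ∈ b := by
    intro y
    rw [mem_closedBall_zero_iff, norm_smul, hb, Metric.mem_closedBall, dist_eq_norm,
      Real.norm_of_nonneg (by positivity), inv_mul_le_iff₀ hh, mul_comm h]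
  have hind : ∀ y : EuclideanSpace ℝ (Fin p),
      (Metric.closedBall (0 : EuclideanSpace ℝ (Fin p)) ρ).indicator
      (1 : EuclideanSpace ℝ (Fin p) → ℝ) (h⁻¹ • (y - x)) =
      b.indicator 1 y := by
    intro y
    by_cases hy : y ∈ b
    · rw [Set.indicator_of_mem hy, Set.indicator_of_mem ((hball y).2 hy)]; rfl
    · rw [Set.indicator_of_notMem hy, Set.indicator_of_notMem (fun h' => hy ((hball y).1 h'))]
  have hindm : Measurable (b.indicator (1 : EuclideanSpace ℝ (Fin p) → ℝ)) :=
      measurable_one.indicator hbm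
  have hind01 : ∀ y, b.indicator (1 : EuclideanSpace ℝ (Fin p) → ℝ) y = 0 ∨ b.indicator
      (1 : EuclideanSpace ℝ (Fin p) → ℝ) y = 1 := by
    intro y
    by_cases hy : y ∈ b <;> simp [hy]
  have hint : ∫ y, b.indicator (1 : EuclideanSpace ℝ (Fin p) → ℝ) y ∂(ν.map X) = m := by
    rw [integral_indicator_one hbm]
  have hev : ∀ (j : Fin n) (G : S → ℝ), Measurable G →
      ∫ z : Fin n → S, G (z j) ∂(Measure.pi fun _ : Fin n => ν) = ∫ a, G a ∂ν := by
    intro j G hG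
    exact (measurePreserving_eval (fun _ : Fin n => ν) j).hasLaw.integral_comp
      hG.aestronglyMeasurable
  have hKx : Measurable fun y : EuclideanSpace ℝ (Fin p) => K (h⁻¹ • (y - x)) := by fun_prop
  have hKb : ∃ L, ∀ y : EuclideanSpace ℝ (Fin p), |K (h⁻¹ • (y - x))| ≤ L :=
    ⟨C₂, fun y => by rw [abs_of_nonneg (hK.nonneg _)]; exact hK.le_upper _⟩
  have hint1 : Integrable (fun y => b.indicator (1 : EuclideanSpace ℝ (Fin p) → ℝ) y) (ν.map X) :=
    (integrable_const (1 : ℝ)).indicator hbm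
  have key := hC (Measure.pi fun _ : Fin n => ν) (Finset.univ.erase i)
    (a := fun j z => K (h⁻¹ • (X (z j) - x))) (o := fun j z => o (z j))
    (I := fun j z => b.indicator 1 (X (z j))) (K₀ := K 0) (π := π x) (m := m)
    (b := C₂ / c * ⨍ y in b, |π y - π x| ∂(ν.map X))
    hK.le_zero hK.zero_le (hsel.le_sel x) (hsel.sel_le x) (fun j => by fun_prop)
    (fun j => by fun_prop) (fun j => by fun_prop) (fun j z => hsel.obs_eq _)
    (fun j z => hind01 _) (fun j z => by rw [← hind]; exact hK.lower _)
    (fun j z => by rw [← hind]; exact hK.upper _) ?_ ?_ ?_ ?_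
  · rw [Finset.card_erase_of_mem (Finset.mem_univ i), Finset.card_univ, Fintype.card_fin] at key
    exact key
  · refine iIndepFun_pi (μ := fun _ : Fin n => ν)
      (X := fun _ a =>
        (b.indicator (1 : EuclideanSpace ℝ (Fin p) → ℝ) (X a), o a, K (h⁻¹ • (X a - x)))) fun j =>
        ?_
    exact Measurable.aemeasurable (by fun_prop)
  · intro j
    rw [hev j (fun a => b.indicator 1 (X a)) (by fun_prop), ← hint,
      integral_map hXm.aemeasurable hindm.aestronglyMeasurable]
  · intro j
    rw [hev j (fun a => o a * b.indicator 1 (X a)) (by fun_prop),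
      hsel.integral_obs_mul _ hindm ⟨1, fun y => by rcases hind01 y with h | h <;> simp [h]⟩,
      ← integral_map (f := fun y => π y * b.indicator 1 y) hXm.aemeasurable
        (hπm.mul hindm).aestronglyMeasurable, ← hint, ← integral_const_mul]
    refine integral_mono (hint1.const_mul _) ?_ fun y => ?_
    · refine hint1.mono' (hπm.mul hindm).aestronglyMeasurable (Eventually.of_forall fun y => ?_)
      have h1 := hsel.sel_le y
      have h2 := hc.le.trans (hsel.le_sel y)
      rcases hind01 y with h | h <;> simp [h, abs_of_nonneg h2, h1]
    · have h1 := hsel.le_sel y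
      rcases hind01 y with h | h <;> simp [h, h1]
  · intro j
    have hG : Measurable fun a => (1 - o a / π x) * K (h⁻¹ • (X a - x)) := by fun_prop
    rw [hev j (fun a => (1 - o a / π x) * K (h⁻¹ • (X a - x))) hG]
    have hπx : 0 < π x := hc.trans_le (hsel.le_sel x)
    have hKint : Integrable (fun a => K (h⁻¹ • (X a - x))) ν := by
      refine (integrable_const C₂).mono' (hKx.comp hXm).aestronglyMeasurable
        (Eventually.of_forall fun a => ?_)
      rw [Real.norm_of_nonneg (hK.nonneg _)]
      exact hK.le_upper _
    have hoK : Integrable (fun a => o a * K (h⁻¹ • (X a - x))) ν := by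
      refine hKint.mono (hom.mul (hKx.comp hXm)).aestronglyMeasurable
        (Eventually.of_forall fun a => ?_)
      rcases hsel.obs_eq a with h | h <;> simp [h]
    have hπK : Integrable (fun a => π (X a) * K (h⁻¹ • (X a - x))) ν := by
      refine hKint.mono ((hπm.comp hXm).mul (hKx.comp hXm)).aestronglyMeasurable
        (Eventually.of_forall fun a => ?_)
      rw [norm_mul]
      refine mul_le_of_le_one_left (norm_nonneg _) ?_
      rw [Real.norm_of_nonneg (hc.le.trans (hsel.le_sel _))]
      exact hsel.sel_le _
    -- by the missing-at-random property `o` may be replaced by `π X`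
    have h1 : ∫ a, (1 - o a / π x) * K (h⁻¹ • (X a - x)) ∂ν =
        ∫ a, (π x)⁻¹ * ((π x - π (X a)) * K (h⁻¹ • (X a - x))) ∂ν := by
      have e1 : ∀ a, (1 - o a / π x) * K (h⁻¹ • (X a - x)) =
          K (h⁻¹ • (X a - x)) - (π x)⁻¹ * (o a * K (h⁻¹ • (X a - x))) := fun a => by ring
      have e2 : ∀ a, (π x)⁻¹ * ((π x - π (X a)) * K (h⁻¹ • (X a - x))) =
          K (h⁻¹ • (X a - x)) - (π x)⁻¹ * (π (X a) * K (h⁻¹ • (X a - x))) := fun a => by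
        field_simp
      simp only [e1, e2]
      rw [integral_sub hKint (hoK.const_mul _), integral_sub hKint (hπK.const_mul _),
        integral_const_mul, integral_const_mul, hsel.integral_obs_mul _ hKx hKb]
    have hπint : Integrable π (ν.map X) :=
      (integrable_const (1 : ℝ)).mono' hπm.aestronglyMeasurable (Eventually.of_forall fun y => by
        rw [Real.norm_of_nonneg (hc.le.trans (hsel.le_sel _))]; exact hsel.sel_le _)
    have hosc : Integrable (fun y => |π y - π x|) (ν.map X) :=
      (hπint.sub (integrable_const _)).abs
    have h2 : (∫ y in b, |π y - π x| ∂(ν.map X)) = (⨍ y in b, |π y - π x| ∂(ν.map X)) * m := by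
      rw [setAverage_eq, smul_eq_mul]
      rcases eq_or_ne m 0 with h0 | h0
      · rw [h0, mul_zero]
        refine setIntegral_measure_zero _ ?_
        rw [hm, measureReal_def] at h0
        exact ((ENNReal.toReal_eq_zero_iff _).1 h0).resolve_right (measure_ne_top _ _)
      · rw [← hm]; field_simp
    rw [h1, mul_assoc, ← h2, ← integral_indicator hbm, ← integral_const_mul,
      integral_map hXm.aemeasurable
        (((hπm.sub_const _).abs.indicator hbm).const_mul _).aestronglyMeasurable]
    refine norm_integral_le_of_norm_le (f := fun a => (π x)⁻¹ * ((π x - π (X a)) *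
      K (h⁻¹ • (X a - x)))) ?_ (Eventually.of_forall fun a => ?_)
    · exact ((hosc.indicator hbm).const_mul (C₂ / c)).comp_measurable hXm
    · have h3 : (π x)⁻¹ ≤ c⁻¹ := inv_anti₀ hc (hsel.le_sel x)
      have h4 : K (h⁻¹ • (X a - x)) ≤ C₂ * b.indicator 1 (X a) := by
        rw [← hind]; exact hK.upper _
      rw [norm_mul, norm_mul, Real.norm_of_nonneg (by positivity), Real.norm_of_nonneg
          (hK.nonneg _),
        Real.norm_eq_abs, abs_sub_comm]
      calc (π x)⁻¹ * (|π (X a) - π x| * K (h⁻¹ • (X a - x)))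
          ≤ c⁻¹ * (|π (X a) - π x| * (C₂ * b.indicator 1 (X a))) := by
            gcongr
            exact mul_nonneg (abs_nonneg _) (hK.nonneg _)
        _ = C₂ / c * b.indicator (fun y => |π y - π x|) (X a) := by
            by_cases hy : X a ∈ b
            · simp [hy]; ring
            · simp [hy]

lemma ennreal_average_le {n : ℕ} {u : Fin n → ENNReal} {b : ENNReal} (hu : ∀ i, u i ≤ b) :
    (n : ENNReal)⁻¹ * ∑ i, u i ≤ b := by
  have h1 : ∑ i, u i ≤ n * b := by
    simpa using Finset.sum_le_card_nsmul Finset.univ u b fun i _ => hu i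
  calc (n : ENNReal)⁻¹ * ∑ i, u i ≤ (n : ENNReal)⁻¹ * (n * b) := by gcongr
    _ = ((n : ENNReal)⁻¹ * n) * b := by rw [mul_assoc]
    _ ≤ 1 * b := by gcongr; exact ENNReal.inv_mul_le_one _
    _ = b := one_mul b

/-- The kernel weights are consistent in mean square, for any integrable weighting of the units.
By Lebesgue's differentiation theorem no smoothness of the selection probability is needed. -/
theorem tendsto_lintegral_weightErr_sq (hsel : IsSelection ν X o π c) (hK : IsBallKernel K C₁ C₂ ρ)
    {h : ℕ → ℝ} (hpos : ∀ n, 0 < h n) (hzero : Tendsto h atTop (𝓝 0))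
    (hnh : Tendsto (fun n : ℕ => n * h n ^ p) atTop atTop) {w : S → ENNReal} (hw : Measurable w)
    (hwint : ∫⁻ a, w a ∂ν ≠ ⊤) :
    Tendsto (fun n : ℕ => (n : ENNReal)⁻¹ * ∑ i : Fin n, ∫⁻ z, w (z i) *
      ENNReal.ofReal (weightErr X o π K (h n) z i ^ 2) ∂(Measure.pi fun _ : Fin n => ν))
      atTop (𝓝 0) := by
  obtain ⟨C, hC0, hC⟩ := exists_condSqErr_le hsel hK
  have hXm := hsel.measurable_cov
  have : IsProbabilityMeasure (ν.map X) := Measure.isProbabilityMeasure_map hXm.aemeasurable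
  have hρ := hK.radius_pos
  have hcm : ∀ (n : ℕ) (i : Fin n), Measurable fun a => condSqErr ν X o π K (h n) i (X a) :=
    fun n i => (measurable_condSqErr hsel hK (h n) i).comp hXm
  have havm : ∀ n : ℕ, Measurable fun a =>
      (n : ENNReal)⁻¹ * ∑ i : Fin n, condSqErr ν X o π K (h n) i (X a) := fun n =>
    (Finset.measurable_sum _ fun i _ => hcm n i).const_mul _
  have hlim : Tendsto (fun n : ℕ => ∫⁻ a, w a * ((n : ENNReal)⁻¹ *
      ∑ i : Fin n, condSqErr ν X o π K (h n) i (X a)) ∂ν) atTop (𝓝 (∫⁻ _, 0 ∂ν)) := by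
    refine tendsto_lintegral_of_dominated_convergence (fun a => w a * ENNReal.ofReal C)
      (fun n => hw.mul (havm n)) (fun n => Eventually.of_forall fun a => ?_) ?_ ?_
    · have := ennreal_average_le fun i : Fin n => (hC n i (X a) (h n) (hpos n)).1
      show w a * _ ≤ w a * _
      gcongr
    · rw [lintegral_mul_const _ hw]
      exact ENNReal.mul_ne_top hwint ENNReal.ofReal_ne_top
    · have hπint : Integrable π (ν.map X) :=
        (integrable_const (1 : ℝ)).mono' hsel.measurable_sel.aestronglyMeasurable
          (Eventually.of_forall fun y => by
            rw [Real.norm_of_nonneg (hsel.pos.le.trans (hsel.le_sel _))]; exact hsel.sel_le _)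
      filter_upwards [ae_lt_top hw hwint, ae_of_ae_map hXm.aemeasurable
        (ae_exists_mul_pow_le_measure_closedBall (ν.map X)), ae_of_ae_map hXm.aemeasurable
        (ae_tendsto_average_abs_sub (ν.map X) hπint)] with a hwa hball hosc
      obtain ⟨κ, hκ, hball⟩ := hball
      have hrad : Tendsto (fun n => ρ * h n) atTop (𝓝[>] 0) := by
        refine tendsto_nhdsWithin_iff.2 ⟨by simpa using hzero.const_mul ρ,
          Eventually.of_forall fun n => ?_⟩
        have := hpos n
        exact mul_pos hρ this
      have hM : Tendsto (fun n : ℕ => ((n - 1 : ℕ) : ℝ) *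
          (ν.map X).real (Metric.closedBall (X a) (ρ * h n))) atTop atTop := by
        have h1 : Tendsto (fun n : ℕ => κ * ρ ^ p / 2 * (n * h n ^ p)) atTop atTop :=
          hnh.const_mul_atTop (by positivity)
        refine tendsto_atTop_mono' atTop ?_ h1
        filter_upwards [hrad.eventually hball, eventually_ge_atTop 2] with n hn hn2
        have h2 : (n : ℝ) / 2 ≤ ((n - 1 : ℕ) : ℝ) := by
          rw [Nat.cast_sub (by omega)]
          have : (2 : ℝ) ≤ n := by exact_mod_cast hn2
          push_cast; linarith
        have := hpos n
        calc κ * ρ ^ p / 2 * (n * h n ^ p) = (n : ℝ) / 2 * (κ * (ρ * h n) ^ p) := by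
              rw [mul_pow]; ring
          _ ≤ _ := by gcongr
      have hG : Tendsto (fun n : ℕ => C * (1 / (((n - 1 : ℕ) : ℝ) *
          (ν.map X).real (Metric.closedBall (X a) (ρ * h n))) ^ 2 + 1 / (((n - 1 : ℕ) : ℝ) *
          (ν.map X).real (Metric.closedBall (X a) (ρ * h n))) + (C₂ / c *
          ⨍ y in Metric.closedBall (X a) (ρ * h n), |π y - π (X a)| ∂(ν.map X)) ^ 2))
          atTop (𝓝 0) := by
        have h1 := hM.inv_tendsto_atTop
        have h2 := ((hosc.comp hrad).const_mul (C₂ / c)).pow 2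
        have h3 := (((h1.pow 2).add h1).add h2).const_mul C
        simp only [one_div, ← inv_pow]
        simpa using h3
      have hG' := ENNReal.tendsto_ofReal hG
      rw [ENNReal.ofReal_zero] at hG'
      have h4 : Tendsto (fun n : ℕ => (n : ENNReal)⁻¹ *
          ∑ i : Fin n, condSqErr ν X o π K (h n) i (X a)) atTop (𝓝 0) := by
        refine tendsto_of_tendsto_of_tendsto_of_le_of_le' tendsto_const_nhds hG'
          (Eventually.of_forall fun _ => zero_le) ?_
        filter_upwards [hM.eventually_gt_atTop 0] with n hn
        exact ennreal_average_le fun i => (hC n i (X a) (h n) (hpos n)).2 hn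
      simpa using ENNReal.Tendsto.const_mul h4 (Or.inr hwa.ne)
  rw [lintegral_zero] at hlim
  refine tendsto_of_tendsto_of_tendsto_of_le_of_le tendsto_const_nhds hlim
    (fun _ => zero_le) fun n => ?_
  show (n : ENNReal)⁻¹ * _ ≤ ∫⁻ a, w a * _ ∂ν
  calc _ ≤ (n : ENNReal)⁻¹ * ∑ i : Fin n, ∫⁻ a, w a * condSqErr ν X o π K (h n) i (X a) ∂ν := by
        gcongr with i _
        exact lintegral_weightErr_sq_le hsel hK (h n) i hw
    _ = ∫⁻ a, w a * ((n : ENNReal)⁻¹ * ∑ i : Fin n, condSqErr ν X o π K (h n) i (X a)) ∂ν := by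
        have hm : ∀ i : Fin n, Measurable fun a => w a * condSqErr ν X o π K (h n) i (X a) :=
          fun i => hw.mul (hcm n i)
        rw [← lintegral_finsetSum _ fun i _ => hm i, ← lintegral_const_mul _
          (Finset.measurable_sum _ fun i _ => hm i)]
        refine lintegral_congr fun a => ?_
        rw [← Finset.mul_sum, mul_left_comm]

end Weights

/-! ### Sums of errors weighted by the errors of the inverse probability weights -/

section WeightedErrors

variable {p : ℕ} {S : Type*} [MeasurableSpace S] {ν : Measure S} [IsProbabilityMeasure ν]
  {X : S → EuclideanSpace ℝ (Fin p)} {o : S → ℝ} {π K : EuclideanSpace ℝ (Fin p) → ℝ}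
  {c C₁ C₂ ρ : ℝ}

/-- Two errors of distinct units remain uncorrelated after multiplication by a function of the
covariates and of the indicators of observation that vanishes when the first unit is unobserved:
given all other units, the dependence on the first one is through its covariate only. -/
lemma integral_mul_mul_eq_zero (hsel : IsSelection ν X o π c) {e : S → ℝ}
    (heL : MemLp e 2 ν) (hmean : ∀ ψ : EuclideanSpace ℝ (Fin p) → ℝ, Measurable ψ →
      (∃ C, ∀ x, |ψ x| ≤ C) → ∫ a, e a * (o a * ψ (X a)) ∂ν = 0) {n : ℕ} {i j : Fin n}
    (hij : i ≠ j) {H : (Fin n → EuclideanSpace ℝ (Fin p) × ℝ) → ℝ} (hH : Measurable H) {C : ℝ}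
    (hHC : ∀ y, (∀ k, (y k).2 = 0 ∨ (y k).2 = 1) → |H y| ≤ C) (hH0 : ∀ y, (y i).2 = 0 → H y = 0) :
    ∫ z, e (z i) * e (z j) * H (fun k => (X (z k), o (z k))) ∂(Measure.pi fun _ : Fin n => ν) =
      0 := by
  have hXm := hsel.measurable_cov
  have hom := hsel.measurable_obs
  have hL : ∀ k : Fin n, MemLp (fun z : Fin n → S => e (z k)) 2 (Measure.pi fun _ => ν) := fun k =>
    heL.comp_measurePreserving (measurePreserving_eval (fun _ : Fin n => ν) k)
  have hHm : Measurable fun z : Fin n → S => H (fun k => (X (z k), o (z k))) := by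
    refine hH.comp ?_
    fun_prop
  have hint : Integrable (fun z : Fin n → S => e (z i) * e (z j) * H (fun k => (X (z k), o (z k))))
      (Measure.pi fun _ => ν) :=
    ((hL i).integrable_mul (hL j)).mul_bdd hHm.aestronglyMeasurable
      (Eventually.of_forall fun z => hHC _ fun k => hsel.obs_eq _)
  have hmp := measurePreserving_update_prod ν i
  rw [← hmp.map_eq, integral_map hmp.measurable.aemeasurable
    (by rw [hmp.map_eq]; exact hint.aestronglyMeasurable),
    integral_prod (fun q : (Fin n → S) × S => e (Function.update q.1 i q.2 i) *
      e (Function.update q.1 i q.2 j) * H (fun k => (X (Function.update q.1 i q.2 k),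
        o (Function.update q.1 i q.2 k)))) (hmp.integrable_comp_of_integrable hint)]
  refine integral_eq_zero_of_ae (Eventually.of_forall fun z => ?_)
  simp only [Function.update_self, Function.update_of_ne hij.symm, Pi.zero_apply]
  set ψ : EuclideanSpace ℝ (Fin p) → ℝ := fun x =>
    H (Function.update (fun k => (X (z k), o (z k))) i (x, 1)) with hψ
  have hψm : Measurable ψ := hH.comp <| (measurable_update _).comp (by fun_prop)
  have hψb : ∀ x, |ψ x| ≤ C := fun x => by
    refine hHC _ fun k => ?_
    by_cases hk : k = i
    · subst hk; simp
    · rw [Function.update_of_ne hk]; exact hsel.obs_eq _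
  have h1 : ∀ a, e a * e (z j) * H (fun k => (X (Function.update z i a k),
      o (Function.update z i a k))) = e (z j) * (e a * (o a * ψ (X a))) := by
    intro a
    have h2 : (fun k => (X (Function.update z i a k), o (Function.update z i a k))) =
        Function.update (fun k => (X (z k), o (z k))) i (X a, o a) := by
      ext1 k
      by_cases hk : k = i
      · subst hk; simp
      · simp [Function.update_of_ne hk]
    rw [h2]
    rcases hsel.obs_eq a with ha | ha
    · rw [hH0 _ (by simp [ha]), ha]; ring
    · rw [ha, hψ]; ring
  simp only [h1]
  rw [integral_const_mul, hmean ψ hψm ⟨C, hψb⟩, mul_zero]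

lemma abs_weightErr_le (hK : IsBallKernel K C₁ C₂ ρ) (hc : 0 < c) (hπ : ∀ x, c ≤ π x) (h : ℝ)
    {n : ℕ} (z : Fin n → S) (ho : ∀ j, o (z j) = 0 ∨ o (z j) = 1) (i : Fin n) :
    |weightErr X o π K h z i| ≤ max 1 (C₂ + n * C₂) / C₁ + 1 / c := by
  have hC2 : 0 < C₂ := hK.lower_pos.trans_le (hK.le_zero.trans hK.zero_le)
  have hC1 := hK.lower_pos
  rcases ho i with h0 | h1
  · rw [weightErr_of_obs_eq_zero h0, abs_zero]
    positivity
  · have h2 := weightErr_update_of_obs_eq_one (X := X) (π := π) (K := K) (h := h) z i h1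
    rw [Function.update_eq_self] at h2
    rw [h2]
    have hnum : K 0 + ∑ j ∈ Finset.univ.erase i, K (h⁻¹ • (X (z j) - X (z i))) ≤ C₂ + n * C₂ := by
      refine add_le_add hK.zero_le ?_
      refine (Finset.sum_le_card_nsmul _ _ C₂ fun j _ => hK.le_upper _).trans ?_
      rw [nsmul_eq_mul]
      gcongr
      simp
    have hden : C₁ ≤ K 0 + ∑ j ∈ Finset.univ.erase i, o (z j) * K (h⁻¹ • (X (z j) - X (z i))) := by
      refine le_add_of_le_of_nonneg hK.le_zero (Finset.sum_nonneg fun j _ => mul_nonneg ?_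
        (hK.nonneg _))
      rcases ho j with h | h <;> simp [h]
    refine (abs_sub _ _).trans (add_le_add ?_ ?_)
    · rw [abs_of_nonneg (div_nonneg (zero_le_one.trans (le_max_left _ _)) (hC1.le.trans hden))]
      gcongr
    · rw [abs_of_nonneg (one_div_nonneg.2 (hc.le.trans (hπ _)))]
      exact one_div_le_one_div_of_le hc (hπ _)

/-- The second moment of a sum of errors weighted by the errors of the inverse probability weights:
the cross terms vanish. -/
lemma lintegral_sum_sq_eq (hsel : IsSelection ν X o π c) (hK : IsBallKernel K C₁ C₂ ρ)
    {e : S → ℝ} (hem : Measurable e) (heL : MemLp e 2 ν)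
    (hmean : ∀ ψ : EuclideanSpace ℝ (Fin p) → ℝ, Measurable ψ →
      (∃ C, ∀ x, |ψ x| ≤ C) → ∫ a, e a * (o a * ψ (X a)) ∂ν = 0)
    {φ : EuclideanSpace ℝ (Fin p) → ℝ} (hφm : Measurable φ) {C : ℝ} (hφ : ∀ x, |φ x| ≤ C) (h : ℝ)
    (n : ℕ) :
    ∫⁻ z, ENNReal.ofReal ((∑ i, e (z i) * φ (X (z i)) * weightErr X o π K h z i) ^ 2)
        ∂(Measure.pi fun _ : Fin n => ν) =
      ∑ i, ∫⁻ z, ENNReal.ofReal ((e (z i) * φ (X (z i))) ^ 2) *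
        ENNReal.ofReal (weightErr X o π K h z i ^ 2) ∂(Measure.pi fun _ : Fin n => ν) := by
  have hXm := hsel.measurable_cov
  have hom := hsel.measurable_obs
  have hKm := hK.measurable
  have hπm := hsel.measurable_sel
  have hC : 0 ≤ C := (abs_nonneg _).trans (hφ 0)
  set B := max 1 (C₂ + n * C₂) / C₁ + 1 / c with hB
  have hEm : ∀ i : Fin n, Measurable fun z : Fin n → S => weightErr X o π K h z i :=
    measurable_weightErr hXm hom hπm hKm h n
  have hEB : ∀ (i : Fin n) (z : Fin n → S), |weightErr X o π K h z i| ≤ B := fun i z =>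
    abs_weightErr_le hK hsel.pos hsel.le_sel h z (fun j => hsel.obs_eq _) i
  have hB0 : 0 ≤ B := by
    have := hsel.pos
    have := hK.lower_pos
    rw [hB]; positivity
  have hL : ∀ k : Fin n, MemLp (fun z : Fin n → S => e (z k)) 2 (Measure.pi fun _ => ν) := fun k =>
    heL.comp_measurePreserving (measurePreserving_eval (fun _ : Fin n => ν) k)
  set T : Fin n → (Fin n → S) → ℝ := fun i z => e (z i) * φ (X (z i)) * weightErr X o π K h z i
    with hT
  have hTm : ∀ i, Measurable (T i) := fun i => by
    have := hEm i
    simp only [hT]; fun_prop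
  have hTL : ∀ i, MemLp (T i) 2 (Measure.pi fun _ : Fin n => ν) := fun i => by
    refine MemLp.of_le_mul (c := C * B) (hL i) (hTm i).aestronglyMeasurable
      (Eventually.of_forall fun z => ?_)
    simp only [hT, norm_mul, Real.norm_eq_abs]
    calc |e (z i)| * |φ (X (z i))| * |weightErr X o π K h z i| ≤ |e (z i)| * C * B := by
          gcongr
          · exact hφ _
          · exact hEB _ _
      _ = C * B * |e (z i)| := by ring
  have hTT : ∀ i j, Integrable (fun z => T i z * T j z) (Measure.pi fun _ : Fin n => ν) :=
    fun i j => (hTL i).integrable_mul (hTL j)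
  have hcross : ∀ i j, i ≠ j → ∫ z, T i z * T j z ∂(Measure.pi fun _ : Fin n => ν) = 0 := by
    intro i j hij
    set H : (Fin n → EuclideanSpace ℝ (Fin p) × ℝ) → ℝ := fun y => φ (y i).1 * φ (y j).1 *
      (weightErr Prod.fst Prod.snd π K h y i * weightErr Prod.fst Prod.snd π K h y j) with hH
    have hWm : ∀ k : Fin n, Measurable fun y : Fin n → EuclideanSpace ℝ (Fin p) × ℝ =>
        weightErr Prod.fst Prod.snd π K h y k :=
      measurable_weightErr measurable_fst measurable_snd hπm hKm h n
    have hWb := fun (y : Fin n → EuclideanSpace ℝ (Fin p) × ℝ)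
      (hy : ∀ k, (y k).2 = 0 ∨ (y k).2 = 1) (k : Fin n) =>
      abs_weightErr_le (X := Prod.fst) (o := Prod.snd) hK hsel.pos hsel.le_sel h y hy k
    rw [← integral_mul_mul_eq_zero hsel heL hmean hij (H := H) (C := C * C * (B * B)) ?_ ?_ ?_]
    · refine integral_congr_ae (Eventually.of_forall fun z => ?_)
      simp only [hT, hH, weightErr]
      ring
    · have := hWm i
      have := hWm j
      simp only [hH]; fun_prop
    · intro y hy
      simp only [hH, abs_mul]
      gcongr
      · exact hφ _
      · exact hφ _
      · exact hWb y hy i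
      · exact hWb y hy j
    · intro y hy
      simp only [hH]
      rw [weightErr_of_obs_eq_zero hy]; ring
  have hsum : ∀ z, (∑ i, T i z) ^ 2 = ∑ i, ∑ j, T i z * T j z := fun z => by
    rw [sq, Finset.sum_mul_sum]
  have hint : Integrable (fun z => (∑ i, T i z) ^ 2) (Measure.pi fun _ : Fin n => ν) := by
    simp only [hsum]
    exact integrable_finsetSum _ fun i _ => integrable_finsetSum _ fun j _ => hTT i j
  rw [← ofReal_integral_eq_lintegral_ofReal hint (Eventually.of_forall fun z => sq_nonneg _)]
  have h1 : ∫ z, (∑ i, T i z) ^ 2 ∂(Measure.pi fun _ : Fin n => ν) =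
      ∑ i, ∫ z, T i z * T i z ∂(Measure.pi fun _ : Fin n => ν) := by
    simp only [hsum]
    rw [integral_finsetSum _ fun (i : Fin n) _ => integrable_finsetSum _ fun j _ => hTT i j]
    refine Finset.sum_congr rfl fun i _ => ?_
    rw [integral_finsetSum _ fun (j : Fin n) _ => hTT i j]
    exact Finset.sum_eq_single i (fun j _ hj => hcross i j hj.symm) (by simp)
  rw [h1, ENNReal.ofReal_sum_of_nonneg fun i _ => integral_nonneg fun z => mul_self_nonneg _]
  refine Finset.sum_congr rfl fun i _ => ?_
  rw [ofReal_integral_eq_lintegral_ofReal (hTT i i) (Eventually.of_forall fun z =>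
    mul_self_nonneg _)]
  refine lintegral_congr fun z => ?_
  rw [← ENNReal.ofReal_mul (sq_nonneg _)]
  congr 1
  simp only [hT]; ring

variable {Ω : Type*} [MeasurableSpace Ω] {P : Measure Ω} [IsProbabilityMeasure P]
  {Z : ℕ → Ω → S} {h : ℕ → ℝ}

/-- Averages of squared errors of the weights, weighted by an integrable function of the unit. -/
lemma tendsto_inProb_average_weightErr_sq (hZ : ∀ i, Measurable (Z i)) (hindep : iIndepFun Z P)
    (hident : ∀ i, IdentDistrib (Z i) (Z 0) P P) (hsel : IsSelection (P.map (Z 0)) X o π c)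
    (hK : IsBallKernel K C₁ C₂ ρ) (hpos : ∀ n, 0 < h n) (hzero : Tendsto h atTop (𝓝 0))
    (hnh : Tendsto (fun n : ℕ => n * h n ^ p) atTop atTop) {w : S → ℝ} (hwm : Measurable w)
    (hw0 : ∀ a, 0 ≤ w a) (hw : Integrable w (P.map (Z 0))) :
    Tendsto (fun a : ℕ × Ω => (a.1 : ℝ)⁻¹ * ∑ i : Fin a.1, w (Z i a.2) *
      weightErr X o π K (h a.1) (fun j : Fin a.1 => Z j a.2) i ^ 2) (inProb P) (𝓝 0) := by
  have : IsProbabilityMeasure (P.map (Z 0)) :=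
    Measure.isProbabilityMeasure_map (hZ 0).aemeasurable
  have hEm := fun n => measurable_weightErr hsel.measurable_cov hsel.measurable_obs
    hsel.measurable_sel hK.measurable (h n) n
  have hmp := measurePreserving_sample hZ hindep hident
  have hlim := tendsto_lintegral_weightErr_sq hsel hK hpos hzero hnh hwm.ennreal_ofReal
    (by rw [← ofReal_integral_eq_lintegral_ofReal hw (Eventually.of_forall hw0)]; simp)
  refine tendsto_inProb_of_lintegral (X := fun n ω => (n : ℝ)⁻¹ * ∑ i : Fin n, w (Z i ω) *
    weightErr X o π K (h n) (fun j : Fin n => Z j ω) i ^ 2) (fun n => ?_) ?_ hlim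
  · have := fun i => (hEm n i).comp (hmp n).measurable
    simp only [Function.comp_def] at this
    exact Measurable.aemeasurable (by fun_prop)
  · filter_upwards [eventually_gt_atTop 0] with n hn
    have hn' : (0 : ℝ) < n := by exact_mod_cast hn
    have hm : ∀ i : Fin n, Measurable fun z : Fin n → S => ENNReal.ofReal (w (z i)) *
        ENNReal.ofReal (weightErr X o π K (h n) z i ^ 2) := fun i => by
      have := hEm n i
      fun_prop
    have h1 : ∀ i : Fin n, ∫⁻ z, ENNReal.ofReal (w (z i)) *
        ENNReal.ofReal (weightErr X o π K (h n) z i ^ 2) ∂(Measure.pi fun _ : Fin n => P.map (Z 0))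
        = ∫⁻ ω, ENNReal.ofReal (w (Z i ω)) *
          ENNReal.ofReal (weightErr X o π K (h n) (fun j : Fin n => Z j ω) i ^ 2) ∂P := fun i =>
      ((hmp n).lintegral_comp (hm i)).symm
    have hm' := fun i => (hm i).comp (hmp n).measurable
    simp only [Function.comp_def] at hm'
    simp only [h1]
    rw [← lintegral_finsetSum _ fun i _ => hm' i, ← lintegral_const_mul _
      (Finset.measurable_sum _ fun i _ => hm' i)]
    refine lintegral_mono fun ω => le_of_eq ?_
    have h2 : ∀ i : Fin n, 0 ≤ w (Z i ω) *
        weightErr X o π K (h n) (fun j : Fin n => Z j ω) i ^ 2 := fun i =>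
      mul_nonneg (hw0 _) (sq_nonneg _)
    rw [abs_of_nonneg (mul_nonneg (by positivity) (Finset.sum_nonneg fun i _ => h2 i)),
      ENNReal.ofReal_mul (by positivity), ENNReal.ofReal_inv_of_pos hn', ENNReal.ofReal_natCast,
      ENNReal.ofReal_sum_of_nonneg fun i _ => h2 i]
    congr 1
    exact Finset.sum_congr rfl fun i _ => ENNReal.ofReal_mul (hw0 _)

/-- Root-`n` normalized sums of errors weighted by the errors of the weights are negligible. -/
lemma tendsto_inProb_sum_mul_weightErr (hZ : ∀ i, Measurable (Z i)) (hindep : iIndepFun Z P)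
    (hident : ∀ i, IdentDistrib (Z i) (Z 0) P P) (hsel : IsSelection (P.map (Z 0)) X o π c)
    (hK : IsBallKernel K C₁ C₂ ρ) (hpos : ∀ n, 0 < h n) (hzero : Tendsto h atTop (𝓝 0))
    (hnh : Tendsto (fun n : ℕ => n * h n ^ p) atTop atTop) {e : S → ℝ} (hem : Measurable e)
    (heL : MemLp e 2 (P.map (Z 0)))
    (hmean : ∀ ψ : EuclideanSpace ℝ (Fin p) → ℝ, Measurable ψ →
      (∃ C, ∀ x, |ψ x| ≤ C) → ∫ a, e a * (o a * ψ (X a)) ∂(P.map (Z 0)) = 0)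
    {φ : EuclideanSpace ℝ (Fin p) → ℝ} (hφm : Measurable φ) {C : ℝ} (hφ : ∀ x, |φ x| ≤ C) :
    Tendsto (fun a : ℕ × Ω => (√(a.1 : ℝ))⁻¹ * ∑ i : Fin a.1, e (Z i a.2) * φ (X (Z i a.2)) *
      weightErr X o π K (h a.1) (fun j : Fin a.1 => Z j a.2) i) (inProb P) (𝓝 0) := by
  have : IsProbabilityMeasure (P.map (Z 0)) :=
    Measure.isProbabilityMeasure_map (hZ 0).aemeasurable
  have hXm := hsel.measurable_cov
  have hEm := fun n => measurable_weightErr hsel.measurable_cov hsel.measurable_obs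
    hsel.measurable_sel hK.measurable (h n) n
  have hmp := measurePreserving_sample hZ hindep hident
  have hC : 0 ≤ C := (abs_nonneg _).trans (hφ 0)
  have hwm : Measurable fun a => ENNReal.ofReal ((e a * φ (X a)) ^ 2) := by fun_prop
  have hLp : MemLp (fun a => e a * φ (X a)) 2 (P.map (Z 0)) := by
    refine MemLp.of_le_mul (c := C) heL (by fun_prop) (Eventually.of_forall fun a => ?_)
    rw [norm_mul, mul_comm]
    gcongr
    exact hφ _
  have hlim := tendsto_lintegral_weightErr_sq hsel hK hpos hzero hnh hwm
    (by rw [← ofReal_integral_eq_lintegral_ofReal hLp.integrable_sq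
          (Eventually.of_forall fun a => sq_nonneg _)]
        simp)
  have hsq : Tendsto (fun a : ℕ × Ω => ((√(a.1 : ℝ))⁻¹ * ∑ i : Fin a.1, e (Z i a.2) *
      φ (X (Z i a.2)) * weightErr X o π K (h a.1) (fun j : Fin a.1 => Z j a.2) i) ^ 2)
      (inProb P) (𝓝 0) := by
    refine tendsto_inProb_of_lintegral (X := fun n ω => ((√(n : ℝ))⁻¹ * ∑ i : Fin n, e (Z i ω) *
      φ (X (Z i ω)) * weightErr X o π K (h n) (fun j : Fin n => Z j ω) i) ^ 2) (fun n => ?_) ?_ hlim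
    · have := fun i => (hEm n i).comp (hmp n).measurable
      simp only [Function.comp_def] at this
      exact Measurable.aemeasurable (by fun_prop)
    · filter_upwards [eventually_gt_atTop 0] with n hn
      have hn' : (0 : ℝ) < n := by exact_mod_cast hn
      have hm : Measurable fun z : Fin n → S => ENNReal.ofReal ((∑ i, e (z i) * φ (X (z i)) *
          weightErr X o π K (h n) z i) ^ 2) := by
        have := hEm n
        fun_prop
      rw [← lintegral_sum_sq_eq hsel hK hem heL hmean hφm hφ, ← (hmp n).lintegral_comp hm,
        ← lintegral_const_mul _ (by exact hm.comp (hmp n).measurable)]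
      refine lintegral_mono fun ω => le_of_eq ?_
      rw [abs_of_nonneg (sq_nonneg _), mul_pow, ENNReal.ofReal_mul (by positivity), inv_pow,
        Real.sq_sqrt hn'.le, ENNReal.ofReal_inv_of_pos hn', ENNReal.ofReal_natCast]
  have h1 := (Real.continuous_sqrt.tendsto 0).comp hsq
  rw [Real.sqrt_zero] at h1
  refine (tendsto_zero_iff_abs_tendsto_zero _).2 (h1.congr fun a => ?_)
  simp only [Function.comp_apply, Real.sqrt_sq_eq_abs]

end WeightedErrors

/-! ### Consistency of minimum contrast estimators -/

section Consistency

variable {Ω S : Type*} [MeasurableSpace Ω] [MeasurableSpace S] {P : Measure Ω}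
  [IsProbabilityMeasure P] {Z : ℕ → Ω → S}

/-- The law of large numbers for a function of the units. -/
lemma tendsto_inProb_average_comp (hZ : ∀ i, Measurable (Z i)) (hindep : iIndepFun Z P)
    (hident : ∀ i, IdentDistrib (Z i) (Z 0) P P) {w : S → ℝ} (hwm : Measurable w)
    (hw : Integrable w (P.map (Z 0))) :
    Tendsto (fun a : ℕ × Ω => (a.1 : ℝ)⁻¹ * ∑ i : Fin a.1, w (Z i a.2)) (inProb P)
      (𝓝 (∫ z, w z ∂(P.map (Z 0)))) := by
  rw [integral_map (hZ 0).aemeasurable hwm.aestronglyMeasurable]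
  have h := tendsto_inProb_average (X := fun i ω => w (Z i ω)) (P := P)
    (hw.comp_measurable (hZ 0)) (hindep.comp (fun _ => w) fun _ => hwm)
    (fun i => (hident i).comp hwm)
  simpa only [smul_eq_mul] using h

variable {B : Type*} [MetricSpace B] [SecondCountableTopology B]

/-- Wald's argument: around each parameter with a larger expected contrast there is a neighbourhood
on which the infimum of the contrast still has a larger expectation, so that it is eventually free
of minimizers of the empirical contrast; finitely many neighbourhoods suffice by compactness. -/
lemma tendsto_inProb_of_contrast (hZ : ∀ i, Measurable (Z i)) (hindep : iIndepFun Z P)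
    (hident : ∀ i, IdentDistrib (Z i) (Z 0) P P) {Γ : Set B} (hΓ : IsCompact Γ) {β₀ : B}
    (hβ₀ : β₀ ∈ Γ) {m : S → B → ℝ} (hm : ∀ β ∈ Γ, Measurable fun z => m z β)
    (hm0 : ∀ z β, 0 ≤ m z β) (hmc : ∀ z, ContinuousOn (m z) Γ)
    (hmint : ∀ β ∈ Γ, Integrable (fun z => m z β) (P.map (Z 0)))
    (hlt : ∀ β ∈ Γ, β ≠ β₀ → ∫ z, m z β₀ ∂(P.map (Z 0)) < ∫ z, m z β ∂(P.map (Z 0)))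
    {b : ℕ → Ω → B} (hb : ∀ n ω, b n ω ∈ Γ)
    (hbmin : ∀ n ω, ∑ i : Fin n, m (Z i ω) (b n ω) ≤ ∑ i : Fin n, m (Z i ω) β₀) :
    Tendsto (fun a : ℕ × Ω => b a.1 a.2) (inProb P) (𝓝 β₀) := by
  have hlocal : ∀ β₁ ∈ Γ, β₁ ≠ β₀ → ∃ r > 0, ∀ᶠ a in inProb P,
      b a.1 a.2 ∉ Metric.ball β₁ r := by
    intro β₁ hβ₁ hne
    set r : ℕ → ℝ := fun k => 1 / ((k : ℝ) + 1) with hr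
    have hr0 : ∀ k, 0 < r k := fun k => by simp only [hr]; positivity
    set T : ℕ → Set B := fun k => Γ ∩ Metric.ball β₁ (r k) with hT
    have hne' : ∀ k, Nonempty (T k) := fun k => ⟨⟨β₁, hβ₁, Metric.mem_ball_self (hr0 k)⟩⟩
    set D : (k : ℕ) → ℕ → T k := fun k => TopologicalSpace.denseSeq (T k) with hD
    set I : ℕ → S → ℝ := fun k z => ⨅ j, m z (D k j) with hI
    have hIm : ∀ k, Measurable (I k) := fun k => Measurable.iInf fun j => hm _ (D k j).2.1
    have hbdd : ∀ k z, BddBelow (Set.range fun j => m z (D k j)) := fun k z =>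
      ⟨0, by rintro _ ⟨j, rfl⟩; exact hm0 _ _⟩
    have hI0 : ∀ k z, 0 ≤ I k z := fun k z => le_ciInf fun j => hm0 _ _
    -- by density and continuity, the infimum along the sequence bounds `m z` on all of `T k`
    have hIle : ∀ k z, ∀ β ∈ T k, I k z ≤ m z β := by
      intro k z β hβ
      have hc : Continuous fun β : T k => m z β :=
        continuousOn_iff_continuous_domRestrict.1 ((hmc z).mono Set.inter_subset_left)
      have hcl : IsClosed {β : T k | I k z ≤ m z β} := isClosed_le continuous_const hc
      have hsub : Set.range (D k) ⊆ {β : T k | I k z ≤ m z β} := by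
        rintro _ ⟨j, rfl⟩
        exact ciInf_le (hbdd k z) j
      exact hcl.closure_subset_iff.2 hsub (TopologicalSpace.denseRange_denseSeq (T k) ⟨β, hβ⟩)
    have hI1 : ∀ k z, I k z ≤ m z β₁ := fun k z =>
      hIle k z β₁ ⟨hβ₁, Metric.mem_ball_self (hr0 k)⟩
    have hIint : ∀ k, Integrable (I k) (P.map (Z 0)) := fun k =>
      (hmint β₁ hβ₁).mono' (hIm k).aestronglyMeasurable (Eventually.of_forall fun z => by
        rw [Real.norm_of_nonneg (hI0 k z)]; exact hI1 k z)
    have hlim : Tendsto (fun k => ∫ z, I k z ∂(P.map (Z 0))) atTop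
        (𝓝 (∫ z, m z β₁ ∂(P.map (Z 0)))) := by
      refine tendsto_integral_of_dominated_convergence (fun z => m z β₁)
        (fun k => (hIm k).aestronglyMeasurable) (hmint β₁ hβ₁)
        (fun k => Eventually.of_forall fun z => by
          rw [Real.norm_of_nonneg (hI0 k z)]; exact hI1 k z)
        (Eventually.of_forall fun z => ?_)
      rw [Metric.tendsto_atTop]
      intro η hη
      obtain ⟨s, hs, hs'⟩ := Metric.continuousWithinAt_iff.1 (hmc z β₁ hβ₁) (η / 2) (by positivity)
      obtain ⟨k₀, hk₀⟩ := exists_nat_one_div_lt hs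
      refine ⟨k₀, fun k hk => ?_⟩
      have hrs : r k < s := (Nat.one_div_le_one_div hk).trans_lt hk₀
      have h1 : m z β₁ - η / 2 ≤ I k z := by
        refine le_ciInf fun j => ?_
        have := hs' (D k j).2.1 ((Metric.mem_ball.1 (D k j).2.2).trans hrs)
        rw [Real.dist_eq, abs_lt] at this
        linarith
      rw [Real.dist_eq, abs_lt]
      constructor
      · linarith
      · linarith [hI1 k z]
    obtain ⟨k, hk⟩ := (hlim.eventually (lt_mem_nhds (hlt β₁ hβ₁ hne))).exists
    refine ⟨r k, hr0 k, ?_⟩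
    have h1 := tendsto_inProb_average_comp hZ hindep hident (hm β₀ hβ₀) (hmint β₀ hβ₀)
    have h2 := tendsto_inProb_average_comp hZ hindep hident (hIm k) (hIint k)
    filter_upwards [h1.eventually_lt h2 hk] with a ha hmem
    have h3 : ∑ i : Fin a.1, I k (Z i a.2) ≤ ∑ i : Fin a.1, m (Z i a.2) β₀ :=
      (Finset.sum_le_sum fun i _ => hIle k _ _ ⟨hb _ _, hmem⟩).trans (hbmin a.1 a.2)
    exact absurd ha (not_lt.2 (mul_le_mul_of_nonneg_left h3 (inv_nonneg.2 (Nat.cast_nonneg _))))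
  rw [Metric.tendsto_nhds]
  intro η hη
  have hcomp : IsCompact (Γ \ Metric.ball β₀ η) := hΓ.diff Metric.isOpen_ball
  set p : Set B → Prop := fun s => ∀ᶠ a in inProb P, b a.1 a.2 ∉ s with hp
  have : p (Γ \ Metric.ball β₀ η) := by
    refine IsCompact.induction_on (p := p) hcomp ?_ ?_ ?_ ?_
    · exact Eventually.of_forall fun a => Set.notMem_empty _
    · intro s t hst ht
      rw [hp] at ht ⊢
      filter_upwards [ht] with a ha h'
      exact ha (hst h')
    · intro s t hs ht
      rw [hp] at hs ht ⊢
      filter_upwards [hs, ht] with a ha hb' h'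
      exact h'.elim ha hb'
    · intro β hβ
      obtain ⟨r, hr, hr'⟩ := hlocal β hβ.1 (by
        rintro rfl; exact hβ.2 (Metric.mem_ball_self hη))
      exact ⟨Metric.ball β r, mem_nhdsWithin_of_mem_nhds (Metric.ball_mem_nhds _ hr), hr'⟩
  rw [hp] at this
  filter_upwards [this] with a ha
  by_contra hcon
  exact ha ⟨hb _ _, hcon⟩

end Consistency

/-! ### Rate of convergence of the least squares estimator -/

section Rate

variable {p d : ℕ}

/-- The regression function `F` has, on the ball of radius `s` around `β₀`, a second-order expansion
in the parameter with gradient `G x` and Hessian entries `Hs a b x`, with a remainder that is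
controlled uniformly in the covariate only to first order. -/
structure HasExpansion (F : EuclideanSpace ℝ (Fin p) → EuclideanSpace ℝ (Fin d) → ℝ)
    (β₀ : EuclideanSpace ℝ (Fin d)) (s C : ℝ)
    (G : EuclideanSpace ℝ (Fin p) → EuclideanSpace ℝ (Fin d))
    (Hs : Fin d → Fin d → EuclideanSpace ℝ (Fin p) → ℝ) : Prop where
  radius_pos : 0 < s
  const_nonneg : 0 ≤ C
  measurable_grad : Measurable G
  measurable_hess : ∀ a b, Measurable (Hs a b)
  norm_grad_le : ∀ x, ‖G x‖ ≤ C
  abs_hess_le : ∀ a b x, |Hs a b x| ≤ C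
  continuousOn : ∀ x, ContinuousOn (F x) (Metric.ball β₀ s)
  measurable : ∀ β ∈ Metric.ball β₀ s, Measurable fun x => F x β
  abs_sub_le : ∀ x θ, ‖θ‖ < s → |F x (β₀ + θ) - F x β₀ - inner ℝ (G x) θ| ≤ C * ‖θ‖ ^ 2
  isLittleO : ∀ x, (fun θ => F x (β₀ + θ) - F x β₀ - inner ℝ (G x) θ -
    2⁻¹ * ∑ a, ∑ b, θ a * θ b * Hs a b x) =o[𝓝 0] fun θ => ‖θ‖ ^ 2

lemma abs_sum_mul_mul_le (θ : EuclideanSpace ℝ (Fin d)) (q : Fin d → Fin d → ℝ) :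
    |∑ a, ∑ b, θ a * θ b * q a b| ≤ ‖θ‖ ^ 2 * ∑ a, ∑ b, |q a b| := by
  rw [Finset.mul_sum]
  refine (Finset.abs_sum_le_sum_abs _ _).trans (Finset.sum_le_sum fun a _ => ?_)
  rw [Finset.mul_sum]
  refine (Finset.abs_sum_le_sum_abs _ _).trans (Finset.sum_le_sum fun b _ => ?_)
  rw [abs_mul, abs_mul, sq]
  gcongr
  · exact PiLp.norm_apply_le θ a
  · exact PiLp.norm_apply_le θ b

variable {F : EuclideanSpace ℝ (Fin p) → EuclideanSpace ℝ (Fin d) → ℝ}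
  {β₀ : EuclideanSpace ℝ (Fin d)} {s C : ℝ}
  {G : EuclideanSpace ℝ (Fin p) → EuclideanSpace ℝ (Fin d)}
  {Hs : Fin d → Fin d → EuclideanSpace ℝ (Fin p) → ℝ}

/-- A measurable modulus for the second-order remainder, tending to zero pointwise and boundedly. -/
lemma HasExpansion.exists_modulus (hF : HasExpansion F β₀ s C G Hs) :
    ∃ (r : ℕ → ℝ) (κ : ℕ → EuclideanSpace ℝ (Fin p) → ℝ) (C' : ℝ), (∀ k, 0 < r k) ∧
      (∀ k, Measurable (κ k)) ∧ (∀ k x, 0 ≤ κ k x) ∧ (∀ k x, κ k x ≤ C') ∧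
      (∀ x, Tendsto (fun k => κ k x) atTop (𝓝 0)) ∧
      ∀ k x θ, ‖θ‖ < r k → |F x (β₀ + θ) - F x β₀ - inner ℝ (G x) θ -
        2⁻¹ * ∑ a, ∑ b, θ a * θ b * Hs a b x| ≤ κ k x * ‖θ‖ ^ 2 := by
  set R : EuclideanSpace ℝ (Fin p) → EuclideanSpace ℝ (Fin d) → ℝ := fun x θ =>
    F x (β₀ + θ) - F x β₀ - inner ℝ (G x) θ - 2⁻¹ * ∑ a, ∑ b, θ a * θ b * Hs a b x with hR
  set C' : ℝ := C + 2⁻¹ * ∑ _a : Fin d, ∑ _b : Fin d, C with hC'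
  have hs := hF.radius_pos
  have hC := hF.const_nonneg
  have hC'0 : 0 ≤ C' := by positivity
  have hRC : ∀ x θ, ‖θ‖ < s → |R x θ| ≤ C' * ‖θ‖ ^ 2 := by
    intro x θ hθ
    refine (abs_sub _ _).trans ?_
    have h1 := hF.abs_sub_le x θ hθ
    have h2 := abs_sum_mul_mul_le θ fun a b => Hs a b x
    have h3 : ∑ a, ∑ b, |Hs a b x| ≤ ∑ _a : Fin d, ∑ _b : Fin d, C :=
      Finset.sum_le_sum fun a _ => Finset.sum_le_sum fun b _ => hF.abs_hess_le a b x
    rw [abs_mul, abs_of_nonneg (by norm_num : (0 : ℝ) ≤ 2⁻¹)]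
    have h4 := mul_le_mul_of_nonneg_left h3 (sq_nonneg ‖θ‖)
    rw [hC']
    linarith
  set r : ℕ → ℝ := fun k => s * (1 / ((k : ℝ) + 1)) with hr
  have hr0 : ∀ k, 0 < r k := fun k => by simp only [hr]; positivity
  have hrs : ∀ k, r k ≤ s := fun k => by
    simp only [hr]
    refine mul_le_of_le_one_right hs.le ?_
    rw [div_le_one (by positivity)]
    linarith [(Nat.cast_nonneg k : (0 : ℝ) ≤ k)]
  have hrlim : Tendsto r atTop (𝓝 0) := by
    simpa [hr] using (tendsto_one_div_add_atTop_nhds_zero_nat (𝕜 := ℝ)).const_mul s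
  set T : ℕ → Set (EuclideanSpace ℝ (Fin d)) := fun k => Metric.ball 0 (r k) with hT
  have hne : ∀ k, Nonempty (T k) := fun k => ⟨⟨0, Metric.mem_ball_self (hr0 k)⟩⟩
  set D : (k : ℕ) → ℕ → T k := fun k => TopologicalSpace.denseSeq (T k) with hD
  have hDn : ∀ k j, ‖(D k j : EuclideanSpace ℝ (Fin d))‖ < r k := fun k j =>
    mem_ball_zero_iff.1 (D k j).2
  set κ : ℕ → EuclideanSpace ℝ (Fin p) → ℝ := fun k x =>
    ⨆ j, |R x (D k j)| / ‖(D k j : EuclideanSpace ℝ (Fin d))‖ ^ 2 with hκ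
  have hle : ∀ k x j, |R x (D k j)| / ‖(D k j : EuclideanSpace ℝ (Fin d))‖ ^ 2 ≤ C' := by
    intro k x j
    exact div_le_of_le_mul₀ (by positivity) hC'0 (hRC x _ ((hDn k j).trans_le (hrs k)))
  have hbdd : ∀ k x, BddAbove (Set.range fun j =>
      |R x (D k j)| / ‖(D k j : EuclideanSpace ℝ (Fin d))‖ ^ 2) := fun k x =>
    ⟨C', by rintro _ ⟨j, rfl⟩; exact hle k x j⟩
  have hκ0 : ∀ k x, 0 ≤ κ k x := fun k x => Real.iSup_nonneg fun j => by positivity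
  have hmem : ∀ θ : EuclideanSpace ℝ (Fin d), ‖θ‖ < s → β₀ + θ ∈ Metric.ball β₀ s := fun θ hθ => by
    rw [Metric.mem_ball, dist_eq_norm]; simpa using hθ
  refine ⟨r, κ, C', hr0, fun k => Measurable.iSup fun j => ?_, hκ0, fun k x => ciSup_le (hle k x),
    fun x => ?_, fun k x θ hθ => ?_⟩
  · have h1 := hF.measurable _ (hmem _ ((hDn k j).trans_le (hrs k)))
    have h2 := hF.measurable _ (Metric.mem_ball_self hs)
    have h3 := hF.measurable_grad
    have h4 := hF.measurable_hess
    have h5 : Measurable fun x => R x (D k j) := by simp only [hR]; fun_prop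
    exact h5.abs.div_const _
  · rw [Metric.tendsto_nhds]
    intro η hη
    have h1 := (hF.isLittleO x).bound (half_pos hη)
    obtain ⟨t, ht, ht'⟩ := Metric.eventually_nhds_iff_ball.1 h1
    filter_upwards [hrlim.eventually (gt_mem_nhds ht)] with k hk
    rw [Real.dist_eq, sub_zero, abs_of_nonneg (hκ0 k x)]
    refine (ciSup_le fun j => ?_).trans_lt (half_lt_self hη)
    refine div_le_of_le_mul₀ (by positivity) (by positivity) ?_
    have h2 := ht' (D k j) (mem_ball_zero_iff.2 ((hDn k j).trans hk))
    simpa only [Real.norm_eq_abs, abs_pow, abs_norm] using h2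
  · have hc : Continuous fun θ : T k => R x θ := by
      have h1 : Continuous fun θ : T k => F x (β₀ + θ) :=
        (hF.continuousOn x).comp_continuous (by fun_prop) fun θ =>
          hmem _ ((mem_ball_zero_iff.1 θ.2).trans_le (hrs k))
      have h2 : Continuous fun θ : EuclideanSpace ℝ (Fin d) => F x β₀ + inner ℝ (G x) θ +
          2⁻¹ * ∑ a, ∑ b, θ a * θ b * Hs a b x := by fun_prop
      refine (h1.sub (h2.comp continuous_subtype_val)).congr fun θ => ?_
      simp only [hR, Pi.sub_apply, Function.comp_apply, sub_sub]
    have hcl : IsClosed {θ : T k | |R x θ| ≤ κ k x * ‖(θ : EuclideanSpace ℝ (Fin d))‖ ^ 2} :=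
      isClosed_le hc.abs (by fun_prop)
    have hsub : Set.range (D k) ⊆
        {θ : T k | |R x θ| ≤ κ k x * ‖(θ : EuclideanSpace ℝ (Fin d))‖ ^ 2} := by
      rintro _ ⟨j, rfl⟩
      show |R x (D k j)| ≤ κ k x * _
      rcases eq_or_ne (D k j : EuclideanSpace ℝ (Fin d)) 0 with h0 | h0
      · have := hRC x (D k j) ((hDn k j).trans_le (hrs k))
        rw [h0] at this ⊢
        simpa using this
      · rw [← div_le_iff₀ (by positivity)]
        exact le_ciSup (hbdd k x) j
    exact hcl.closure_subset_iff.2 hsub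
      (TopologicalSpace.denseRange_denseSeq (T k) ⟨θ, mem_ball_zero_iff.2 hθ⟩)

/-- The deterministic step: a parameter whose sum of squares is at most that of the true one lies
within a distance that is governed by the score. -/
lemma norm_le_of_sum_sq_le {ι : Type*} (s : Finset ι) {o e Δ k : ι → ℝ}
    {θ : EuclideanSpace ℝ (Fin d)} {v : ι → EuclideanSpace ℝ (Fin d)}
    {q : ι → Fin d → Fin d → ℝ} {N L B D c Q C : ℝ} (hN : 0 < N) (hcard : (s.card : ℝ) = N)
    (ho : ∀ i, o i = 0 ∨ o i = 1)
    (hmin : ∑ i ∈ s, o i * (e i - Δ i) ^ 2 ≤ ∑ i ∈ s, o i * e i ^ 2)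
    (hfirst : ∀ i, |Δ i - inner ℝ (v i) θ| ≤ C * ‖θ‖ ^ 2)
    (hsecond : ∀ i, |Δ i - inner ℝ (v i) θ - 2⁻¹ * ∑ a, ∑ b, θ a * θ b * q i a b| ≤
      k i * ‖θ‖ ^ 2)
    (hquad : (L - D) * ‖θ‖ ^ 2 ≤ N⁻¹ * ∑ i ∈ s, o i * inner ℝ (v i) θ ^ 2)
    (hscore : ‖N⁻¹ • ∑ i ∈ s, (e i * o i) • v i‖ ≤ B)
    (hhess : ∑ a, ∑ b, |N⁻¹ * ∑ i ∈ s, e i * (o i * q i a b)| ≤ c)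
    (hk : N⁻¹ * ∑ i ∈ s, |e i| * k i ≤ Q) :
    (L / 2 - D / 2 - C ^ 2 * ‖θ‖ ^ 2 - c - 2 * Q) * ‖θ‖ ≤ 2 * B := by
  have hB : 0 ≤ B := (norm_nonneg _).trans hscore
  rcases eq_or_ne θ 0 with rfl | hθ
  · rw [norm_zero, mul_zero]; positivity
  have hθ0 : 0 < ‖θ‖ := norm_pos_iff.2 hθ
  have hNi : 0 ≤ N⁻¹ := by positivity
  have h1 : ∑ i ∈ s, o i * Δ i ^ 2 ≤ 2 * ∑ i ∈ s, e i * o i * Δ i := by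
    have e1 : ∑ i ∈ s, o i * (e i - Δ i) ^ 2 = ∑ i ∈ s, o i * e i ^ 2 -
        2 * ∑ i ∈ s, e i * o i * Δ i + ∑ i ∈ s, o i * Δ i ^ 2 := by
      rw [Finset.mul_sum, ← Finset.sum_sub_distrib, ← Finset.sum_add_distrib]
      exact Finset.sum_congr rfl fun i _ => by ring
    linarith
  have h2 : 2⁻¹ * ∑ i ∈ s, o i * inner ℝ (v i) θ ^ 2 - N * (C ^ 2 * ‖θ‖ ^ 4) ≤
      ∑ i ∈ s, o i * Δ i ^ 2 := by
    rw [← hcard, ← nsmul_eq_mul, ← Finset.sum_const, Finset.mul_sum, ← Finset.sum_sub_distrib]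
    refine Finset.sum_le_sum fun i _ => ?_
    have h3 : (Δ i - inner ℝ (v i) θ) ^ 2 ≤ C ^ 2 * ‖θ‖ ^ 4 := by
      have := pow_le_pow_left₀ (abs_nonneg _) (hfirst i) 2
      rw [sq_abs] at this
      calc _ ≤ _ := this
        _ = C ^ 2 * ‖θ‖ ^ 4 := by ring
    rcases ho i with h | h
    · rw [h]; nlinarith [sq_nonneg (Δ i - inner ℝ (v i) θ)]
    · rw [h]; nlinarith [sq_nonneg (2 * Δ i - inner ℝ (v i) θ)]
  have h3 : ∑ i ∈ s, e i * o i * Δ i ≤ inner ℝ (∑ i ∈ s, (e i * o i) • v i) θ +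
      2⁻¹ * ∑ a, ∑ b, θ a * θ b * ∑ i ∈ s, e i * (o i * q i a b) +
      ‖θ‖ ^ 2 * ∑ i ∈ s, |e i| * k i := by
    have e1 : ∑ a, ∑ b, θ a * θ b * ∑ i ∈ s, e i * (o i * q i a b) =
        ∑ i ∈ s, e i * o i * ∑ a, ∑ b, θ a * θ b * q i a b := by
      simp only [Finset.mul_sum]
      rw [Finset.sum_comm (s := s)]
      refine Finset.sum_congr rfl fun a _ => ?_
      rw [Finset.sum_comm (s := s)]
      exact Finset.sum_congr rfl fun b _ => Finset.sum_congr rfl fun i _ => by ring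
    rw [sum_inner, e1, Finset.mul_sum, Finset.mul_sum, ← Finset.sum_add_distrib,
      ← Finset.sum_add_distrib]
    refine Finset.sum_le_sum fun i _ => ?_
    rw [real_inner_smul_left]
    have h4 : e i * o i * (Δ i - inner ℝ (v i) θ - 2⁻¹ * ∑ a, ∑ b, θ a * θ b * q i a b) ≤
        |e i| * (k i * ‖θ‖ ^ 2) := by
      refine (le_abs_self _).trans ?_
      rw [abs_mul, abs_mul]
      have h5 : |o i| ≤ 1 := by rcases ho i with h | h <;> simp [h]
      gcongr
      · exact mul_le_of_le_one_right (abs_nonneg _) h5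
      · exact hsecond i
    linarith
  have h4 : inner ℝ (N⁻¹ • ∑ i ∈ s, (e i * o i) • v i) θ ≤ B * ‖θ‖ :=
    (real_inner_le_norm _ _).trans (by gcongr)
  rw [real_inner_smul_left] at h4
  have h5 : N⁻¹ * ∑ a, ∑ b, θ a * θ b * ∑ i ∈ s, e i * (o i * q i a b) ≤ ‖θ‖ ^ 2 * c := by
    have h6 := (le_abs_self _).trans
      (abs_sum_mul_mul_le θ fun a b => N⁻¹ * ∑ i ∈ s, e i * (o i * q i a b))
    have h7 : N⁻¹ * ∑ a, ∑ b, θ a * θ b * ∑ i ∈ s, e i * (o i * q i a b) =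
        ∑ a, ∑ b, θ a * θ b * (N⁻¹ * ∑ i ∈ s, e i * (o i * q i a b)) := by
      simp only [Finset.mul_sum (s := (Finset.univ : Finset (Fin d)))]
      exact Finset.sum_congr rfl fun a _ => Finset.sum_congr rfl fun b _ => by ring
    rw [h7]
    exact h6.trans (by gcongr)
  have h6 := mul_le_mul_of_nonneg_left hk (sq_nonneg ‖θ‖)
  have h7 := mul_le_mul_of_nonneg_left (h2.trans (h1.trans (mul_le_mul_of_nonneg_left h3
    zero_le_two))) hNi
  have h8 : N⁻¹ * (N * (C ^ 2 * ‖θ‖ ^ 4)) = C ^ 2 * ‖θ‖ ^ 4 := by field_simp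
  have h9 : (L / 2 - D / 2 - C ^ 2 * ‖θ‖ ^ 2 - c - 2 * Q) * ‖θ‖ * ‖θ‖ ≤ 2 * B * ‖θ‖ := by
    rw [mul_sub, h8] at h7
    linarith
  exact le_of_mul_le_mul_right h9 hθ0

variable {S Ω : Type*} [MeasurableSpace S] [MeasurableSpace Ω] {P : Measure Ω}
  [IsProbabilityMeasure P] {Z : ℕ → Ω → S} {X : S → EuclideanSpace ℝ (Fin p)} {o : S → ℝ}
  {π : EuclideanSpace ℝ (Fin p) → ℝ} {c : ℝ}

/-- Root-`n` consistency of a consistent least squares estimator. The second-order terms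
`o e ⟪θ, Hs θ⟫` average to zero, and the remainder beyond is handled through its modulus. -/
lemma bddInProb_sqrt_mul_norm_sub (hZ : ∀ i, Measurable (Z i)) (hindep : iIndepFun Z P)
    (hident : ∀ i, IdentDistrib (Z i) (Z 0) P P) (hsel : IsSelection (P.map (Z 0)) X o π c)
    (hF : HasExpansion F β₀ s C G Hs) {e : S → ℝ} (hem : Measurable e)
    (heL : MemLp e 2 (P.map (Z 0)))
    (hmean : ∀ ψ : EuclideanSpace ℝ (Fin p) → ℝ, Measurable ψ →
      (∃ C, ∀ x, |ψ x| ≤ C) → ∫ a, e a * (o a * ψ (X a)) ∂(P.map (Z 0)) = 0)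
    {L : ℝ} (hL : 0 < L)
    (hLle : ∀ u, L * ‖u‖ ^ 2 ≤ ∫ z, o z * inner ℝ u (G (X z)) ^ 2 ∂(P.map (Z 0)))
    {b : ℕ → Ω → EuclideanSpace ℝ (Fin d)}
    (hb : Tendsto (fun a : ℕ × Ω => b a.1 a.2) (inProb P) (𝓝 β₀))
    (hbmin : ∀ n ω, ∑ i : Fin n, o (Z i ω) * (F (X (Z i ω)) β₀ + e (Z i ω) -
      F (X (Z i ω)) (b n ω)) ^ 2 ≤ ∑ i : Fin n, o (Z i ω) * e (Z i ω) ^ 2) :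
    BddInProb P fun a => √(a.1 : ℝ) * ‖b a.1 a.2 - β₀‖ := by
  have : IsProbabilityMeasure (P.map (Z 0)) :=
    Measure.isProbabilityMeasure_map (hZ 0).aemeasurable
  have hXm := hsel.measurable_cov
  have hom := hsel.measurable_obs
  have hGm := hF.measurable_grad
  have hHm := hF.measurable_hess
  have hC0 := hF.const_nonneg
  have ho1 : ∀ z, |o z| ≤ 1 := fun z => by rcases hsel.obs_eq z with h | h <;> simp [h]
  have he1 : Integrable e (P.map (Z 0)) := heL.integrable one_le_two
  obtain ⟨r, κ, C', hr, hκm, hκ0, hκC, hκlim, hκle⟩ := hF.exists_modulus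
  -- a level of the modulus at which its contribution is small
  have hκint : ∀ k, Integrable (fun z => |e z| * κ k (X z)) (P.map (Z 0)) := fun k =>
    he1.abs.mul_bdd (c := C') ((hκm k).comp hXm).aestronglyMeasurable
      (Eventually.of_forall fun z => by
        rw [Real.norm_of_nonneg (hκ0 _ _)]; exact hκC _ _)
  have hκE : Tendsto (fun k => ∫ z, |e z| * κ k (X z) ∂(P.map (Z 0))) atTop (𝓝 0) := by
    have h1 := tendsto_integral_of_dominated_convergence (μ := P.map (Z 0))
      (F := fun k z => |e z| * κ k (X z)) (f := fun _ => 0) (fun z => |e z| * C')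
      (fun k => (hκint k).aestronglyMeasurable) (he1.abs.mul_const _)
      (fun k => Eventually.of_forall fun z => by
        rw [norm_mul, Real.norm_of_nonneg (hκ0 _ _), Real.norm_of_nonneg (abs_nonneg _)]
        gcongr
        exact hκC _ _)
      (Eventually.of_forall fun z => by simpa using (hκlim (X z)).const_mul |e z|)
    simpa using h1
  obtain ⟨k, hk⟩ := (hκE.eventually (gt_mem_nhds (show (0 : ℝ) < L / 32 by positivity))).exists
  have hQ := tendsto_inProb_average_comp hZ hindep hident
    (w := fun z => |e z| * κ k (X z)) (by have := hκm k; fun_prop) (hκint k)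
  -- the empirical second moments of the gradient
  have hGsq : Integrable (fun z => o z * ‖G (X z)‖ ^ 2) (P.map (Z 0)) := by
    refine (integrable_const (C ^ 2)).mono' (by fun_prop) (Eventually.of_forall fun z => ?_)
    rw [norm_mul, norm_pow, norm_norm]
    calc ‖o z‖ * ‖G (X z)‖ ^ 2 ≤ 1 * C ^ 2 := by
          gcongr
          · exact ho1 z
          · exact hF.norm_grad_le _
      _ = C ^ 2 := one_mul _
  obtain ⟨D, hD, hDle⟩ := exists_tendsto_inProb_quadratic (P := P)
    (c := fun i ω => o (Z i ω)) (v := fun i ω => G (X (Z i ω)))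
    (hindep.comp (fun _ z => (o z, G (X z))) fun _ => by fun_prop)
    (fun i => (hident i).comp (u := fun z => (o z, G (X z))) (by fun_prop))
    (hGsq.comp_measurable (hZ 0))
  -- the score
  have hξm : Measurable fun z => (e z * o z) • G (X z) := by fun_prop
  have hξL : MemLp (fun z => (e z * o z) • G (X z)) 2 (P.map (Z 0)) := by
    refine MemLp.of_le_mul (c := C) heL hξm.aestronglyMeasurable (Eventually.of_forall fun z => ?_)
    rw [norm_smul, norm_mul]
    calc ‖e z‖ * ‖o z‖ * ‖G (X z)‖ ≤ ‖e z‖ * 1 * C := by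
          gcongr
          · exact ho1 z
          · exact hF.norm_grad_le _
      _ = C * ‖e z‖ := by ring
  have hB := bddInProb_norm_sqrt_sum (P := P) (ξ := fun i ω => (e (Z i ω) * o (Z i ω)) •
      G (X (Z i ω))) (hindep.comp (fun _ z => (e z * o z) • G (X z)) fun _ => hξm)
    (fun i => (hident i).comp hξm)
    (hξL.comp_measurePreserving ⟨hZ 0, rfl⟩) (fun u => by
      rw [← integral_map (f := fun z => inner ℝ u ((e z * o z) • G (X z))) (hZ 0).aemeasurable
        (Measurable.aestronglyMeasurable (by fun_prop)),
        ← hmean (fun x => inner ℝ u (G x)) (by fun_prop) ⟨‖u‖ * C, fun x =>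
          (abs_real_inner_le_norm _ _).trans (by gcongr; exact hF.norm_grad_le x)⟩]
      refine integral_congr_ae (Eventually.of_forall fun z => ?_)
      simp only [real_inner_smul_right]
      ring)
  -- the second-order terms
  have hH : Tendsto (fun a : ℕ × Ω => ∑ j, ∑ l, |(a.1 : ℝ)⁻¹ * ∑ i : Fin a.1,
      e (Z i a.2) * (o (Z i a.2) * Hs j l (X (Z i a.2)))|) (inProb P) (𝓝 0) := by
    have h1 : ∀ j l, Tendsto (fun a : ℕ × Ω => |(a.1 : ℝ)⁻¹ * ∑ i : Fin a.1,
        e (Z i a.2) * (o (Z i a.2) * Hs j l (X (Z i a.2)))|) (inProb P) (𝓝 0) := by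
      intro j l
      have hm : Measurable fun z => o z * Hs j l (X z) := by
        have := hHm j l
        fun_prop
      have h2 := tendsto_inProb_average_comp hZ hindep hident
        (w := fun z => e z * (o z * Hs j l (X z))) (by fun_prop)
        (he1.mul_bdd (c := C) hm.aestronglyMeasurable (Eventually.of_forall fun z => by
          rw [norm_mul]
          exact (mul_le_mul (ho1 z) (hF.abs_hess_le j l _) (abs_nonneg _) zero_le_one).trans_eq
            (one_mul C)))
      rw [hmean _ (hHm j l) ⟨C, hF.abs_hess_le j l⟩] at h2
      simpa using h2.abs
    simpa using tendsto_finsetSum Finset.univ fun j _ =>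
      tendsto_finsetSum Finset.univ fun l _ => h1 j l
  have hθ : Tendsto (fun a : ℕ × Ω => ‖b a.1 a.2 - β₀‖) (inProb P) (𝓝 0) := by
    simpa using (hb.sub_const β₀).norm
  have hθ2 : Tendsto (fun a : ℕ × Ω => C ^ 2 * ‖b a.1 a.2 - β₀‖ ^ 2) (inProb P) (𝓝 0) := by
    simpa using (hθ.pow 2).const_mul (C ^ 2)
  have hL8 : (0 : ℝ) < L / 16 := by positivity
  refine (hB.const_mul (8 / L)).of_le ?_
  filter_upwards [hQ.eventually (gt_mem_nhds hk), hD.eventually (gt_mem_nhds hL8),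
    hH.eventually (gt_mem_nhds hL8), hθ2.eventually (gt_mem_nhds hL8),
    hθ.eventually (gt_mem_nhds hF.radius_pos), hθ.eventually (gt_mem_nhds (hr k)),
    (tendsto_fst_inProb P).eventually (eventually_gt_atTop 0)] with a hQa hDa hHa hθa hsa hra ha
  have ha0 : (0 : ℝ) < a.1 := by exact_mod_cast ha
  set θ := b a.1 a.2 - β₀ with hθdef
  have hbθ : β₀ + θ = b a.1 a.2 := by rw [hθdef]; abel
  have hsq : √(a.1 : ℝ) * √(a.1 : ℝ) = a.1 := Real.mul_self_sqrt ha0.le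
  have hsq0 : 0 < √(a.1 : ℝ) := Real.sqrt_pos.2 ha0
  set v := ∑ i : Fin a.1, (e (Z i a.2) * o (Z i a.2)) • G (X (Z i a.2)) with hv
  have key := norm_le_of_sum_sq_le (Finset.univ : Finset (Fin a.1)) (o := fun i => o (Z i a.2))
    (e := fun i => e (Z i a.2)) (Δ := fun i => F (X (Z i a.2)) (β₀ + θ) - F (X (Z i a.2)) β₀)
    (k := fun i => κ k (X (Z i a.2))) (θ := θ) (v := fun i => G (X (Z i a.2)))
    (q := fun i j l => Hs j l (X (Z i a.2))) (N := a.1) (L := L) (D := L / 16)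
    (B := (√(a.1 : ℝ))⁻¹ * ‖(√(a.1 : ℝ))⁻¹ • v‖) (c := L / 16) (Q := L / 32) (C := C) ha0 (by simp)
    (fun i => hsel.obs_eq _) ?_ (fun i => hF.abs_sub_le _ _ hsa) (fun i => hκle _ _ _ hra) ?_ ?_
    hHa.le hQa.le
  · have h1 : L / 4 * ‖θ‖ ≤ 2 * ((√(a.1 : ℝ))⁻¹ * ‖(√(a.1 : ℝ))⁻¹ • v‖) := by
      refine le_trans ?_ key
      gcongr
      linarith
    rw [abs_of_nonneg (by positivity), abs_of_nonneg (by positivity)]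
    generalize ‖(√(a.1 : ℝ))⁻¹ • v‖ = y at h1 ⊢
    calc √(a.1 : ℝ) * ‖θ‖ = 4 / L * (√(a.1 : ℝ) * (L / 4 * ‖θ‖)) := by field_simp
      _ ≤ 4 / L * (√(a.1 : ℝ) * (2 * ((√(a.1 : ℝ))⁻¹ * y))) := by gcongr
      _ = 8 / L * y := by
        rw [mul_left_comm (√(a.1 : ℝ)), mul_inv_cancel_left₀ hsq0.ne']; ring
  · refine le_trans (le_of_eq ?_) (hbmin a.1 a.2)
    refine Finset.sum_congr rfl fun i _ => ?_
    rw [hbθ]; ring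
  · have h1 := (abs_le.1 (hDle a θ θ)).1
    have h2 := hLle θ
    rw [integral_map (hZ 0).aemeasurable (Measurable.aestronglyMeasurable (by fun_prop))] at h2
    simp only [← sq] at h1
    have h3 : ∀ i : Fin a.1, inner ℝ (G (X (Z i a.2))) θ = inner ℝ θ (G (X (Z i a.2))) :=
      fun i => real_inner_comm _ _
    simp only [h3]
    have h4 : D a * ‖θ‖ ^ 2 ≤ L / 16 * ‖θ‖ ^ 2 := by gcongr
    linarith
  · rw [norm_smul, norm_smul, norm_inv, norm_inv, Real.norm_of_nonneg ha0.le,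
      Real.norm_of_nonneg hsq0.le, ← mul_assoc, ← mul_inv, hsq]

end Rate

/-! ### The estimating functions are asymptotically equivalent to independent ones -/

section Linearization

variable {p d : ℕ} {S Ω : Type*} [MeasurableSpace S] [MeasurableSpace Ω] {P : Measure Ω}
  [IsProbabilityMeasure P] {Z : ℕ → Ω → S} {X : S → EuclideanSpace ℝ (Fin p)} {o : S → ℝ}
  {π K : EuclideanSpace ℝ (Fin p) → ℝ} {c C₁ C₂ ρ : ℝ} {h : ℕ → ℝ}
  {F : EuclideanSpace ℝ (Fin p) → EuclideanSpace ℝ (Fin d) → ℝ}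
  {β₀ : EuclideanSpace ℝ (Fin d)} {s C : ℝ}
  {G : EuclideanSpace ℝ (Fin p) → EuclideanSpace ℝ (Fin d)}
  {Hs : Fin d → Fin d → EuclideanSpace ℝ (Fin p) → ℝ}

lemma HasExpansion.abs_sub_le_mul (hF : HasExpansion F β₀ s C G Hs)
    (x : EuclideanSpace ℝ (Fin p)) {β : EuclideanSpace ℝ (Fin d)} (hβ : ‖β - β₀‖ < s) :
    |F x β - F x β₀| ≤ C * (1 + s) * ‖β - β₀‖ := by
  have h1 := hF.abs_sub_le x (β - β₀) hβ
  rw [add_sub_cancel] at h1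
  have h2 : |inner ℝ (G x) (β - β₀)| ≤ C * ‖β - β₀‖ :=
    (abs_real_inner_le_norm _ _).trans (by gcongr; exact hF.norm_grad_le x)
  have hC := hF.const_nonneg
  have h3 : C * ‖β - β₀‖ ^ 2 ≤ C * s * ‖β - β₀‖ := by
    rw [sq, mul_assoc C s]
    gcongr
  have h4 := abs_add_le (F x β - F x β₀ - inner ℝ (G x) (β - β₀)) (inner ℝ (G x) (β - β₀))
  rw [sub_add_cancel] at h4
  linarith

lemma IsSelection.abs_one_sub_div_le {ν : Measure S} (hsel : IsSelection ν X o π c) (z : S) :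
    |1 - o z / π (X z)| ≤ 1 / c := by
  have hπ : 0 < π (X z) := hsel.pos.trans_le (hsel.le_sel _)
  have h2 : 1 / π (X z) ≤ 1 / c := one_div_le_one_div_of_le hsel.pos (hsel.le_sel _)
  have h3 : 1 ≤ 1 / π (X z) := by rw [le_div_iff₀ hπ]; linarith [hsel.sel_le (X z)]
  rcases hsel.obs_eq z with h | h
  · rw [h, zero_div, sub_zero, abs_one]; linarith
  · rw [h, abs_of_nonpos (by linarith)]; linarith

variable {e : S → ℝ} {b : ℕ → Ω → EuclideanSpace ℝ (Fin d)}
  {g : (n : ℕ) → Fin n → Ω → EuclideanSpace ℝ (Fin d)}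

/-- The difference between the estimating function with estimated weights and regression function,
and the one with the true weights and errors. -/
noncomputable def scoreErr (X : S → EuclideanSpace ℝ (Fin p)) (o e : S → ℝ)
    (π K : EuclideanSpace ℝ (Fin p) → ℝ)
    (F : EuclideanSpace ℝ (Fin p) → EuclideanSpace ℝ (Fin d) → ℝ)
    (G : EuclideanSpace ℝ (Fin p) → EuclideanSpace ℝ (Fin d)) (β₀ β : EuclideanSpace ℝ (Fin d))
    (h : ℝ) {n : ℕ} (z : Fin n → S) (i : Fin n) : EuclideanSpace ℝ (Fin d) :=
  (e (z i) * weightErr X o π K h z i + (1 - o (z i) / π (X (z i)) - weightErr X o π K h z i) *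
    (F (X (z i)) β - F (X (z i)) β₀)) • G (X (z i))

lemma tendsto_inProb_average_scoreErr_sq (hZ : ∀ i, Measurable (Z i)) (hindep : iIndepFun Z P)
    (hident : ∀ i, IdentDistrib (Z i) (Z 0) P P) (hsel : IsSelection (P.map (Z 0)) X o π c)
    (hK : IsBallKernel K C₁ C₂ ρ) (hpos : ∀ n, 0 < h n) (hzero : Tendsto h atTop (𝓝 0))
    (hnh : Tendsto (fun n : ℕ => n * h n ^ p) atTop atTop) (hF : HasExpansion F β₀ s C G Hs)
    (hem : Measurable e) (heL : MemLp e 2 (P.map (Z 0)))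
    (hb : Tendsto (fun a : ℕ × Ω => b a.1 a.2) (inProb P) (𝓝 β₀)) :
    Tendsto (fun a : ℕ × Ω => (a.1 : ℝ)⁻¹ * ∑ i : Fin a.1, ‖scoreErr X o e π K F G β₀ (b a.1 a.2)
      (h a.1) (fun j : Fin a.1 => Z j a.2) i‖ ^ 2) (inProb P) (𝓝 0) := by
  have : IsProbabilityMeasure (P.map (Z 0)) :=
    Measure.isProbabilityMeasure_map (hZ 0).aemeasurable
  have hC := hF.const_nonneg
  have hs := hF.radius_pos
  have hc := hsel.pos
  have h1 := tendsto_inProb_average_weightErr_sq hZ hindep hident hsel hK hpos hzero hnh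
    (w := fun z => e z ^ 2) (by fun_prop) (fun z => sq_nonneg _) heL.integrable_sq
  have h2 := tendsto_inProb_average_weightErr_sq hZ hindep hident hsel hK hpos hzero hnh
    (w := fun _ => 1) (by fun_prop) (fun _ => zero_le_one) (integrable_const _)
  have hθ : Tendsto (fun a : ℕ × Ω => ‖b a.1 a.2 - β₀‖) (inProb P) (𝓝 0) := by
    simpa using (hb.sub_const β₀).norm
  have hlim := ((h1.const_mul 2).add ((((hθ.const_mul (C * (1 + s))).pow 2).const_mul 4).mul
    ((h2.const_add ((1 / c) ^ 2))))).const_mul (C ^ 2)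
  simp only [mul_zero, ne_eq, OfNat.ofNat_ne_zero, not_false_eq_true, zero_pow, zero_mul,
    add_zero] at hlim
  refine squeeze_zero' (Eventually.of_forall fun a => mul_nonneg (by positivity)
    (Finset.sum_nonneg fun i _ => sq_nonneg _)) ?_ hlim
  filter_upwards [hθ.eventually (gt_mem_nhds hs), (tendsto_fst_inProb P).eventually
    (eventually_gt_atTop 0)] with a ha hn
  have hn' : (0 : ℝ) < a.1 := by exact_mod_cast hn
  set θ := b a.1 a.2 - β₀ with hθdef
  have h3 : ∀ i : Fin a.1, ‖scoreErr X o e π K F G β₀ (b a.1 a.2) (h a.1)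
      (fun j : Fin a.1 => Z j a.2) i‖ ^ 2 ≤ C ^ 2 * (2 * (e (Z i a.2) ^ 2 *
        weightErr X o π K (h a.1) (fun j : Fin a.1 => Z j a.2) i ^ 2) +
        4 * (C * (1 + s) * ‖θ‖) ^ 2 * ((1 / c) ^ 2 +
        1 * weightErr X o π K (h a.1) (fun j : Fin a.1 => Z j a.2) i ^ 2)) := by
    intro i
    have e1 := hF.norm_grad_le (X (Z i a.2))
    have e2 := hF.abs_sub_le_mul (X (Z i a.2)) ha
    have e3 := hsel.abs_one_sub_div_le (Z i a.2)
    rw [scoreErr, norm_smul, mul_pow, Real.norm_eq_abs, sq_abs, mul_comm]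
    generalize weightErr X o π K (h a.1) (fun j : Fin a.1 => Z j a.2) i = E
    have e2' := sq_le_sq' (neg_le_of_abs_le e2) (le_of_abs_le e2)
    have e3' := sq_le_sq' (neg_le_of_abs_le e3) (le_of_abs_le e3)
    generalize F (X (Z i a.2)) (b a.1 a.2) - F (X (Z i a.2)) β₀ = Δ at *
    generalize 1 - o (Z i a.2) / π (X (Z i a.2)) = t at *
    have e4 : (t - E) ^ 2 ≤ 2 * ((1 / c) ^ 2 + 1 * E ^ 2) := by nlinarith [sq_nonneg (t + E)]
    have e5 : (e (Z i a.2) * E + (t - E) * Δ) ^ 2 ≤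
        2 * (e (Z i a.2) ^ 2 * E ^ 2) + 2 * ((t - E) ^ 2 * Δ ^ 2) := by
      nlinarith [sq_nonneg (e (Z i a.2) * E - (t - E) * Δ)]
    have e6 : (t - E) ^ 2 * Δ ^ 2 ≤ 2 * ((1 / c) ^ 2 + 1 * E ^ 2) * (C * (1 + s) * ‖θ‖) ^ 2 := by
      gcongr
    gcongr
    linarith
  calc _ ≤ (a.1 : ℝ)⁻¹ * ∑ i : Fin a.1, C ^ 2 * (2 * (e (Z i a.2) ^ 2 *
        weightErr X o π K (h a.1) (fun j : Fin a.1 => Z j a.2) i ^ 2) +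
        4 * (C * (1 + s) * ‖θ‖) ^ 2 * ((1 / c) ^ 2 +
        1 * weightErr X o π K (h a.1) (fun j : Fin a.1 => Z j a.2) i ^ 2)) :=
        mul_le_mul_of_nonneg_left (Finset.sum_le_sum fun i _ => h3 i) (by positivity)
    _ = _ := by
        simp only [← Finset.mul_sum, Finset.sum_add_distrib, Finset.sum_const, Finset.card_univ,
          Fintype.card_fin, nsmul_eq_mul]
        field_simp

lemma tendsto_inProb_sqrt_sum_scoreErr (hZ : ∀ i, Measurable (Z i)) (hindep : iIndepFun Z P)
    (hident : ∀ i, IdentDistrib (Z i) (Z 0) P P) (hsel : IsSelection (P.map (Z 0)) X o π c)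
    (hK : IsBallKernel K C₁ C₂ ρ) (hpos : ∀ n, 0 < h n) (hzero : Tendsto h atTop (𝓝 0))
    (hnh : Tendsto (fun n : ℕ => n * h n ^ p) atTop atTop) (hF : HasExpansion F β₀ s C G Hs)
    (hem : Measurable e) (heL : MemLp e 2 (P.map (Z 0)))
    (hmean : ∀ ψ : EuclideanSpace ℝ (Fin p) → ℝ, Measurable ψ →
      (∃ C, ∀ x, |ψ x| ≤ C) → ∫ a, e a * (o a * ψ (X a)) ∂(P.map (Z 0)) = 0)
    (hb : Tendsto (fun a : ℕ × Ω => b a.1 a.2) (inProb P) (𝓝 β₀))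
    (hbn : BddInProb P fun a => √(a.1 : ℝ) * ‖b a.1 a.2 - β₀‖) :
    Tendsto (fun a : ℕ × Ω => (√(a.1 : ℝ))⁻¹ • ∑ i : Fin a.1, scoreErr X o e π K F G β₀
      (b a.1 a.2) (h a.1) (fun j : Fin a.1 => Z j a.2) i) (inProb P) (𝓝 0) := by
  have : IsProbabilityMeasure (P.map (Z 0)) :=
    Measure.isProbabilityMeasure_map (hZ 0).aemeasurable
  have hC := hF.const_nonneg
  have hs := hF.radius_pos
  have hc := hsel.pos
  have hGm := hF.measurable_grad
  have hXm := hsel.measurable_cov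
  have hom := hsel.measurable_obs
  have hπm := hsel.measurable_sel
  have hθ : Tendsto (fun a : ℕ × Ω => ‖b a.1 a.2 - β₀‖) (inProb P) (𝓝 0) := by
    simpa using (hb.sub_const β₀).norm
  -- the errors, weighted by the errors of the weights
  have hV1 : Tendsto (fun a : ℕ × Ω => ‖(√(a.1 : ℝ))⁻¹ • ∑ i : Fin a.1, (e (Z i a.2) *
      weightErr X o π K (h a.1) (fun j : Fin a.1 => Z j a.2) i) • G (X (Z i a.2))‖)
      (inProb P) (𝓝 0) := by
    have h1 : ∀ k, Tendsto (fun a : ℕ × Ω => |(√(a.1 : ℝ))⁻¹ * ∑ i : Fin a.1, e (Z i a.2) *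
        G (X (Z i a.2)) k * weightErr X o π K (h a.1) (fun j : Fin a.1 => Z j a.2) i|)
        (inProb P) (𝓝 0) := fun k => by
      have := tendsto_inProb_sum_mul_weightErr hZ hindep hident hsel hK hpos hzero hnh hem heL hmean
        (φ := fun x => G x k) (by fun_prop) (C := C)
        (fun x => (PiLp.norm_apply_le (G x) k).trans (hF.norm_grad_le x))
      simpa using this.abs
    have h2 := tendsto_finsetSum Finset.univ fun k _ => h1 k
    simp only [Finset.sum_const_zero] at h2
    refine squeeze_zero (fun _ => norm_nonneg _) (fun a => ?_) h2
    refine (EuclideanSpace.norm_le_sum_abs _).trans (le_of_eq ?_)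
    refine Finset.sum_congr rfl fun k _ => ?_
    rw [PiLp.smul_apply, WithLp.ofLp_sum, Finset.sum_apply, smul_eq_mul]
    congr 2
    refine Finset.sum_congr rfl fun i _ => ?_
    rw [PiLp.smul_apply, smul_eq_mul]; ring
  -- the linear part of the error of the regression function
  have hGsq : Integrable (fun z => (1 - o z / π (X z)) * ‖G (X z)‖ ^ 2) (P.map (Z 0)) := by
    refine (integrable_const (1 / c * C ^ 2)).mono' (by fun_prop)
      (Eventually.of_forall fun z => ?_)
    rw [norm_mul, norm_pow, norm_norm]
    gcongr
    · exact hsel.abs_one_sub_div_le z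
    · exact hF.norm_grad_le _
  obtain ⟨D, hD, hDle⟩ := exists_tendsto_inProb_quadratic (P := P)
    (c := fun i ω => 1 - o (Z i ω) / π (X (Z i ω))) (v := fun i ω => G (X (Z i ω)))
    (hindep.comp (fun _ z => (1 - o z / π (X z), G (X z))) fun _ => by fun_prop)
    (fun i => (hident i).comp (u := fun z => (1 - o z / π (X z), G (X z))) (by fun_prop))
    (hGsq.comp_measurable (hZ 0))
  have hzeroMean : ∀ u w, ∫ ω, (1 - o (Z 0 ω) / π (X (Z 0 ω))) *
      (inner ℝ u (G (X (Z 0 ω))) * inner ℝ w (G (X (Z 0 ω)))) ∂P = 0 := by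
    intro u w
    set ψ : EuclideanSpace ℝ (Fin p) → ℝ := fun x =>
      (π x)⁻¹ * (inner ℝ u (G x) * inner ℝ w (G x)) with hψ
    have hψm : Measurable ψ := by simp only [hψ]; fun_prop
    have hψb : ∀ x, |ψ x| ≤ c⁻¹ * (‖u‖ * C * (‖w‖ * C)) := fun x => by
      simp only [hψ, abs_mul]
      have e1 : |(π x)⁻¹| ≤ c⁻¹ := by
        rw [abs_of_nonneg (inv_nonneg.2 (hc.le.trans (hsel.le_sel x)))]
        exact inv_anti₀ hc (hsel.le_sel x)
      have e2 : ∀ u : EuclideanSpace ℝ (Fin d), |inner ℝ u (G x)| ≤ ‖u‖ * C := fun u =>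
        (abs_real_inner_le_norm _ _).trans (by gcongr; exact hF.norm_grad_le x)
      gcongr
      · exact e2 u
      · exact e2 w
    have hbd : ∀ z, ‖ψ (X z)‖ ≤ c⁻¹ * (‖u‖ * C * (‖w‖ * C)) := fun z => hψb _
    have hψi : Integrable (fun z => ψ (X z)) (P.map (Z 0)) :=
      (integrable_const _).mono' (hψm.comp hXm).aestronglyMeasurable (Eventually.of_forall hbd)
    have i1 : Integrable (fun z => π (X z) * ψ (X z)) (P.map (Z 0)) :=
      hψi.bdd_mul (c := 1) (hπm.comp hXm).aestronglyMeasurable (Eventually.of_forall fun z => by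
        rw [Real.norm_of_nonneg (hc.le.trans (hsel.le_sel _))]; exact hsel.sel_le _)
    have i2 : Integrable (fun z => o z * ψ (X z)) (P.map (Z 0)) :=
      hψi.bdd_mul (c := 1) hom.aestronglyMeasurable (Eventually.of_forall fun z => by
        rcases hsel.obs_eq z with h | h <;> simp [h])
    rw [← integral_map (f := fun z => (1 - o z / π (X z)) *
      (inner ℝ u (G (X z)) * inner ℝ w (G (X z)))) (hZ 0).aemeasurable
      (Measurable.aestronglyMeasurable (by fun_prop))]
    have e3 : ∀ z, (1 - o z / π (X z)) * (inner ℝ u (G (X z)) * inner ℝ w (G (X z))) =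
        π (X z) * ψ (X z) - o z * ψ (X z) := fun z => by
      have : π (X z) ≠ 0 := (hc.trans_le (hsel.le_sel _)).ne'
      simp only [hψ]
      field_simp
    simp only [e3]
    rw [integral_sub i1 i2, hsel.integral_obs_mul ψ hψm ⟨_, hψb⟩, sub_self]
  -- the mean absolute error of the weights
  have hE2 := tendsto_inProb_average_weightErr_sq hZ hindep hident hsel hK hpos hzero hnh
    (w := fun _ => 1) (by fun_prop) (fun _ => zero_le_one) (integrable_const _)
  have hE1 : Tendsto (fun a : ℕ × Ω => √((a.1 : ℝ)⁻¹ * ∑ i : Fin a.1, 1 *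
      weightErr X o π K (h a.1) (fun j : Fin a.1 => Z j a.2) i ^ 2)) (inProb P) (𝓝 0) := by
    simpa only [Real.sqrt_zero, Function.comp_def] using (Real.continuous_sqrt.tendsto 0).comp hE2
  have hrest := hD.add ((hθ.const_mul (1 / c * C * C)).add (hE1.const_mul (C * (1 + s) * C)))
  simp only [mul_zero, add_zero] at hrest
  have hlim := hV1.add (hbn _ hrest)
  rw [add_zero] at hlim
  refine squeeze_zero_norm' ?_ hlim
  filter_upwards [hθ.eventually (gt_mem_nhds hs), (tendsto_fst_inProb P).eventually
    (eventually_gt_atTop 0)] with a ha hn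
  have hn' : (0 : ℝ) < a.1 := by exact_mod_cast hn
  have hsq0 : 0 < √(a.1 : ℝ) := Real.sqrt_pos.2 hn'
  have hsq : (√(a.1 : ℝ))⁻¹ = √(a.1 : ℝ) * (a.1 : ℝ)⁻¹ := by
    rw [← div_eq_mul_inv, Real.sqrt_div_self', one_div]
  set θ := b a.1 a.2 - β₀ with hθdef
  set E : Fin a.1 → ℝ := weightErr X o π K (h a.1) (fun j : Fin a.1 => Z j a.2) with hE
  set t : Fin a.1 → ℝ := fun i => 1 - o (Z i a.2) / π (X (Z i a.2)) with ht
  set v : Fin a.1 → EuclideanSpace ℝ (Fin d) := fun i => G (X (Z i a.2)) with hv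
  set Δ : Fin a.1 → ℝ := fun i => F (X (Z i a.2)) (b a.1 a.2) - F (X (Z i a.2)) β₀ with hΔ
  have hvC : ∀ i, ‖v i‖ ≤ C := fun i => hF.norm_grad_le _
  have htc : ∀ i, |t i| ≤ 1 / c := fun i => hsel.abs_one_sub_div_le _
  have hΔ1 : ∀ i, |Δ i| ≤ C * (1 + s) * ‖θ‖ := fun i => hF.abs_sub_le_mul _ ha
  have hΔ2 : ∀ i, |Δ i - inner ℝ (v i) θ| ≤ C * ‖θ‖ ^ 2 := fun i => by
    have := hF.abs_sub_le (X (Z i a.2)) θ ha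
    rwa [hθdef, add_sub_cancel, ← hθdef] at this
  have hdec : ∑ i : Fin a.1, scoreErr X o e π K F G β₀ (b a.1 a.2) (h a.1)
      (fun j : Fin a.1 => Z j a.2) i = ∑ i : Fin a.1, (e (Z i a.2) * E i) • v i +
      (∑ i : Fin a.1, (t i * inner ℝ θ (v i)) • v i +
      (∑ i : Fin a.1, (t i * (Δ i - inner ℝ (v i) θ)) • v i - ∑ i : Fin a.1, (E i * Δ i) • v i)) :=
        by
    rw [← Finset.sum_sub_distrib, ← Finset.sum_add_distrib, ← Finset.sum_add_distrib]
    refine Finset.sum_congr rfl fun i _ => ?_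
    rw [← sub_smul, ← add_smul, ← add_smul, real_inner_comm]
    simp only [scoreErr, hE, ht, hv, hΔ]
    congr 1
    ring
  have hA : ‖∑ i : Fin a.1, (t i * inner ℝ θ (v i)) • v i‖ ≤ a.1 * (D a * ‖θ‖) := by
    set y := ∑ i : Fin a.1, (t i * inner ℝ θ (v i)) • v i with hy
    have h1 := hDle a θ y
    rw [hzeroMean, sub_zero] at h1
    have h2 : ∑ i : Fin a.1, (1 - o (Z i a.2) / π (X (Z i a.2))) *
        (inner ℝ θ (G (X (Z i a.2))) * inner ℝ y (G (X (Z i a.2)))) = ‖y‖ ^ 2 := by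
      rw [← real_inner_self_eq_norm_sq]
      conv_rhs => rw [hy, inner_sum]
      refine Finset.sum_congr rfl fun i _ => ?_
      rw [real_inner_smul_right]
      simp only [ht, hv]
      ring
    rw [h2, abs_of_nonneg (by positivity), inv_mul_le_iff₀ hn'] at h1
    rcases eq_or_ne y 0 with h0 | h0
    · rw [h0, norm_zero]
      have h3 : 0 ≤ D a * (‖θ‖ * ‖θ‖) := (abs_nonneg _).trans (hDle a θ θ)
      rcases eq_or_ne θ 0 with h4 | h4
      · rw [h4, norm_zero, mul_zero, mul_zero]
      · have : 0 < ‖θ‖ := norm_pos_iff.2 h4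
        have : 0 ≤ D a * ‖θ‖ := by
          rw [← mul_assoc] at h3
          exact nonneg_of_mul_nonneg_left h3 this
        positivity
    · have h5 : 0 < ‖y‖ := norm_pos_iff.2 h0
      refine le_of_mul_le_mul_right (le_trans (le_of_eq (sq _).symm) (h1.trans_eq ?_)) h5
      ring
  have hB : ‖∑ i : Fin a.1, (t i * (Δ i - inner ℝ (v i) θ)) • v i‖ ≤
      a.1 * (1 / c * C * C * ‖θ‖ * ‖θ‖) := by
    refine (norm_sum_le_of_le (n := fun _ => 1 / c * C * C * ‖θ‖ * ‖θ‖) _ fun i _ => ?_).trans_eq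
      (by simp)
    rw [norm_smul, norm_mul]
    calc ‖t i‖ * ‖Δ i - inner ℝ (v i) θ‖ * ‖v i‖ ≤ 1 / c * (C * ‖θ‖ ^ 2) * C := by
          gcongr
          · exact htc i
          · exact hΔ2 i
          · exact hvC i
      _ = _ := by ring
  have hC' : ‖∑ i : Fin a.1, (E i * Δ i) • v i‖ ≤
      a.1 * (C * (1 + s) * C * √((a.1 : ℝ)⁻¹ * ∑ i : Fin a.1, 1 * E i ^ 2) * ‖θ‖) := by
    have h1 : ∑ i : Fin a.1, |E i| ≤ a.1 * √((a.1 : ℝ)⁻¹ * ∑ i : Fin a.1, 1 * E i ^ 2) := by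
      have h2 := sq_sum_le_card_mul_sum_sq (s := (Finset.univ : Finset (Fin a.1)))
        (f := fun i => |E i|)
      simp only [sq_abs, Finset.card_univ, Fintype.card_fin] at h2
      rw [← inv_mul_le_iff₀ hn']
      refine Real.le_sqrt_of_sq_le ?_
      rw [mul_pow, inv_pow, inv_mul_le_iff₀ (by positivity)]
      simp only [one_mul]
      refine h2.trans_eq ?_
      field_simp
    refine (norm_sum_le_of_le (n := fun i => C * (1 + s) * C * ‖θ‖ * |E i|) _
      fun i _ => ?_).trans ?_
    · rw [norm_smul, norm_mul]
      calc ‖E i‖ * ‖Δ i‖ * ‖v i‖ ≤ |E i| * (C * (1 + s) * ‖θ‖) * C := by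
            gcongr
            · exact le_refl _
            · exact hΔ1 i
            · exact hvC i
        _ = _ := by ring
    · rw [← Finset.mul_sum]
      refine (mul_le_mul_of_nonneg_left h1 (by positivity)).trans_eq ?_
      ring
  rw [hdec, smul_add]
  refine (norm_add_le _ _).trans (add_le_add le_rfl ?_)
  rw [norm_smul, Real.norm_of_nonneg (by positivity), hsq]
  have h6 := (norm_add_le (∑ i : Fin a.1, (t i * inner ℝ θ (v i)) • v i) _).trans
    (add_le_add hA ((norm_sub_le _ _).trans (add_le_add hB hC')))
  refine (mul_le_mul_of_nonneg_left h6 (by positivity)).trans_eq ?_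
  field_simp

end Linearization

/-! ### Second-order expansion of the regression function -/

section Expansion

variable {p d : ℕ}

lemma fderiv_apply_eq_inner_gradient {φ : EuclideanSpace ℝ (Fin d) → ℝ}
    (β θ : EuclideanSpace ℝ (Fin d)) : fderiv ℝ φ β θ = inner ℝ (gradient φ β) θ := by
  rw [gradient, InnerProductSpace.toDual_symm_apply]

lemma norm_gradient_sub_le {φ : EuclideanSpace ℝ (Fin d) → ℝ} {β₀ : EuclideanSpace ℝ (Fin d)}
    {s C : ℝ} (hg : ∀ β ∈ Metric.ball β₀ s, DifferentiableAt ℝ (gradient φ) β)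
    (hC : ∀ β ∈ Metric.ball β₀ s, ‖fderiv ℝ (gradient φ) β‖ ≤ C) {β : EuclideanSpace ℝ (Fin d)}
    (hβ : β ∈ Metric.ball β₀ s) : ‖gradient φ β - gradient φ β₀‖ ≤ C * ‖β - β₀‖ :=
  (convex_ball β₀ s).norm_image_sub_le_of_norm_fderiv_le hg hC
    (Metric.mem_ball_self (dist_nonneg.trans_lt hβ)) hβ

lemma abs_sub_sub_inner_gradient_le {φ : EuclideanSpace ℝ (Fin d) → ℝ}
    {β₀ : EuclideanSpace ℝ (Fin d)} {s C : ℝ}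
    (hφ : ∀ β ∈ Metric.ball β₀ s, DifferentiableAt ℝ φ β)
    (hg : ∀ β ∈ Metric.ball β₀ s, DifferentiableAt ℝ (gradient φ) β)
    (hC : ∀ β ∈ Metric.ball β₀ s, ‖fderiv ℝ (gradient φ) β‖ ≤ C) {θ : EuclideanSpace ℝ (Fin d)}
    (hθ : ‖θ‖ < s) : |φ (β₀ + θ) - φ β₀ - inner ℝ (gradient φ β₀) θ| ≤ C * ‖θ‖ ^ 2 := by
  have hsub : ∀ τ ∈ Set.Icc (0 : ℝ) 1, β₀ + τ • θ ∈ Metric.ball β₀ s := fun τ hτ => by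
    rw [Metric.mem_ball, dist_eq_norm, add_sub_cancel_left, norm_smul, Real.norm_of_nonneg hτ.1]
    exact (mul_le_of_le_one_left (norm_nonneg _) hτ.2).trans_lt hθ
  have hC0 : 0 ≤ C := (norm_nonneg _).trans (hC β₀ (Metric.mem_ball_self
    ((norm_nonneg _).trans_lt hθ)))
  have hderiv : ∀ τ ∈ Set.Icc (0 : ℝ) 1,
      HasDerivWithinAt (fun τ : ℝ => φ (β₀ + τ • θ) - τ * inner ℝ (gradient φ β₀) θ)
        (inner ℝ (gradient φ (β₀ + τ • θ)) θ - inner ℝ (gradient φ β₀) θ) (Set.Icc 0 1) τ := by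
    intro τ hτ
    have h1 : HasDerivAt (fun τ : ℝ => β₀ + τ • θ) θ τ := by
      simpa using ((hasDerivAt_id τ).smul_const θ).const_add β₀
    have h2 := ((hφ _ (hsub τ hτ)).hasFDerivAt.comp_hasDerivAt τ h1).sub
      ((hasDerivAt_id τ).mul_const (inner ℝ (gradient φ β₀) θ))
    rw [fderiv_apply_eq_inner_gradient, one_mul] at h2
    exact h2.hasDerivWithinAt
  have h3 := norm_image_sub_le_of_norm_deriv_le_segment_01' hderiv (C := C * ‖θ‖ ^ 2)
    (fun τ hτ => by
      have hτ' := Set.Ico_subset_Icc_self hτ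
      rw [← inner_sub_left]
      refine (norm_inner_le_norm _ _).trans ?_
      have h4 := norm_gradient_sub_le hg hC (hsub τ hτ')
      rw [add_sub_cancel_left, norm_smul, Real.norm_of_nonneg hτ.1] at h4
      have h5 : τ * ‖θ‖ ≤ ‖θ‖ := mul_le_of_le_one_left (norm_nonneg _) hτ.2.le
      calc _ ≤ C * ‖θ‖ * ‖θ‖ := by
            gcongr
            exact h4.trans (by gcongr)
        _ = C * ‖θ‖ ^ 2 := by ring)
  refine le_trans (le_of_eq ?_) h3
  rw [Real.norm_eq_abs]
  congr 1
  simp only [one_smul, zero_smul, add_zero, one_mul, zero_mul, sub_zero]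
  ring

/-- Taylor's formula of second order at a point, where only the gradient is differentiable. -/
lemma isLittleO_sub_sub_inner_gradient {φ : EuclideanSpace ℝ (Fin d) → ℝ}
    {β₀ : EuclideanSpace ℝ (Fin d)} {s : ℝ} (hs : 0 < s)
    (hφ : ∀ β ∈ Metric.ball β₀ s, DifferentiableAt ℝ φ β)
    (hg : DifferentiableAt ℝ (gradient φ) β₀) :
    (fun θ => φ (β₀ + θ) - φ β₀ - inner ℝ (gradient φ β₀) θ -
      2⁻¹ * inner ℝ (fderiv ℝ (gradient φ) β₀ θ) θ) =o[𝓝 0] fun θ => ‖θ‖ ^ 2 := by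
  rw [isLittleO_iff]
  intro η hη
  have h1 := (hasFDerivAt_iff_isLittleO_nhds_zero.1 hg.hasFDerivAt).bound hη
  obtain ⟨t, ht, ht'⟩ := Metric.eventually_nhds_iff_ball.1 h1
  filter_upwards [Metric.ball_mem_nhds (0 : EuclideanSpace ℝ (Fin d)) (lt_min hs ht)] with θ hθ
  rw [mem_ball_zero_iff, lt_min_iff] at hθ
  set H := fderiv ℝ (gradient φ) β₀ with hH
  have hle : ∀ τ ∈ Set.Icc (0 : ℝ) 1, ‖τ • θ‖ ≤ ‖θ‖ := fun τ hτ => by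
    rw [norm_smul, Real.norm_of_nonneg hτ.1]
    exact mul_le_of_le_one_left (norm_nonneg _) hτ.2
  have hsub : ∀ τ ∈ Set.Icc (0 : ℝ) 1, β₀ + τ • θ ∈ Metric.ball β₀ s := fun τ hτ => by
    rw [Metric.mem_ball, dist_eq_norm, add_sub_cancel_left]
    exact (hle τ hτ).trans_lt hθ.1
  have hderiv : ∀ τ ∈ Set.Icc (0 : ℝ) 1,
      HasDerivWithinAt (fun τ : ℝ => φ (β₀ + τ • θ) - τ * inner ℝ (gradient φ β₀) θ -
          τ ^ 2 * (2⁻¹ * inner ℝ (H θ) θ))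
        (inner ℝ (gradient φ (β₀ + τ • θ)) θ - inner ℝ (gradient φ β₀) θ -
          inner ℝ (H (τ • θ)) θ) (Set.Icc 0 1) τ := by
    intro τ hτ
    have h1 : HasDerivAt (fun τ : ℝ => β₀ + τ • θ) θ τ := by
      simpa using ((hasDerivAt_id τ).smul_const θ).const_add β₀
    have h2 := (((hφ _ (hsub τ hτ)).hasFDerivAt.comp_hasDerivAt τ h1).sub
      ((hasDerivAt_id τ).mul_const (inner ℝ (gradient φ β₀) θ))).sub
      ((hasDerivAt_pow 2 τ).mul_const (2⁻¹ * inner ℝ (H θ) θ))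
    rw [fderiv_apply_eq_inner_gradient, one_mul] at h2
    refine (h2.congr_deriv ?_).hasDerivWithinAt
    rw [map_smul, real_inner_smul_left]
    norm_num
    ring
  have h3 := norm_image_sub_le_of_norm_deriv_le_segment_01' hderiv (C := η * ‖θ‖ ^ 2)
    (fun τ hτ => by
      have hτ' := Set.Ico_subset_Icc_self hτ
      rw [← inner_sub_left, ← inner_sub_left]
      refine (norm_inner_le_norm _ _).trans ?_
      have h4 := ht' (τ • θ) (mem_ball_zero_iff.2 ((hle τ hτ').trans_lt hθ.2))
      have h5 := hle τ hτ'
      calc _ ≤ η * ‖θ‖ * ‖θ‖ := by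
            gcongr
            exact h4.trans (by gcongr)
        _ = η * ‖θ‖ ^ 2 := by ring)
  rw [norm_pow, norm_norm]
  refine le_trans (le_of_eq ?_) h3
  congr 1
  simp only [one_smul, zero_smul, add_zero, one_mul, zero_mul, sub_zero, one_pow, ne_eq,
    OfNat.ofNat_ne_zero, not_false_eq_true, zero_pow]
  ring

lemma inner_apply_self_eq_sum (H : EuclideanSpace ℝ (Fin d) →L[ℝ] EuclideanSpace ℝ (Fin d))
    (θ : EuclideanSpace ℝ (Fin d)) :
    inner ℝ (H θ) θ = ∑ a, ∑ b, θ a * θ b * H (EuclideanSpace.single b 1) a := by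
  have h1 : θ = ∑ b, θ b • EuclideanSpace.single b (1 : ℝ) := by
    ext a
    simp [Finset.sum_apply, Pi.single_apply]
  have h2 : ∀ a, H θ a = ∑ b, θ b * H (EuclideanSpace.single b 1) a := by
    intro a
    conv_lhs => rw [h1, map_sum]
    simp
  rw [PiLp.inner_apply]
  refine Finset.sum_congr rfl fun a _ => ?_
  simp only [RCLike.inner_apply, conj_trivial, h2]
  rw [Finset.mul_sum]
  exact Finset.sum_congr rfl fun b _ => by ring

/-- The derivative in a parameter, at a fixed value of the parameter, is measurable in the other
variable, as a limit of difference quotients. -/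
lemma measurable_fderiv_apply_of_forall {α E W : Type*} [MeasurableSpace α] [NormedAddCommGroup E]
    [NormedSpace ℝ E] [MeasurableSpace E] [BorelSpace E] [SecondCountableTopology E]
    [NormedAddCommGroup W] [NormedSpace ℝ W] {u : α → W → E} {β : W} {U : Set W} (hU : U ∈ 𝓝 β)
    (hu : ∀ x, DifferentiableAt ℝ (u x) β) (hm : ∀ β' ∈ U, Measurable fun x => u x β') (v : W) :
    Measurable fun x => fderiv ℝ (u x) β v := by
  have h0 : Tendsto (fun n : ℕ => ((n : ℝ))⁻¹) atTop (𝓝 0) :=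
    tendsto_inv_atTop_zero.comp tendsto_natCast_atTop_atTop
  have h1 : Tendsto (fun n : ℕ => β + ((n : ℝ))⁻¹ • v) atTop (𝓝 β) := by
    simpa using (h0.smul_const v).const_add β
  obtain ⟨N, hN⟩ := eventually_atTop.1 (h1.eventually hU)
  refine measurable_of_tendsto_metrizable (f := fun n x =>
    ((n + N : ℕ) : ℝ) • (u x (β + (((n + N : ℕ) : ℝ))⁻¹ • v) - u x β))
    (fun n => ((hm _ (hN _ (Nat.le_add_left N n))).sub (hm _ (mem_of_mem_nhds hU))).const_smul _) ?_
  rw [tendsto_pi_nhds]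
  intro x
  have h2 := ((hu x).hasFDerivAt.lim_real v).comp tendsto_natCast_atTop_atTop
  exact (tendsto_add_atTop_iff_nat N).2 h2

variable {Υ : Set (EuclideanSpace ℝ (Fin p))} {Γ : Set (EuclideanSpace ℝ (Fin d))}
  {f : EuclideanSpace ℝ (Fin p) → EuclideanSpace ℝ (Fin d) → ℝ}

lemma measurable_indicator_apply_of_continuousOn (hΥ : IsCompact Υ)
    {β : EuclideanSpace ℝ (Fin d)} (hf : ContinuousOn (fun x => f x β) Υ) :
    Measurable fun x => Υ.indicator f x β := by
  have h1 : (fun x => Υ.indicator f x β) = Υ.indicator fun x => f x β := by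
    ext x
    by_cases hx : x ∈ Υ <;> simp [hx]
  classical
  rw [h1, ← Set.piecewise_eq_indicator]
  exact hf.measurable_piecewise continuousOn_const hΥ.isClosed.measurableSet

lemma exists_abs_indicator_apply_le (hΥ : IsCompact Υ)
    {β : EuclideanSpace ℝ (Fin d)} (hf : ContinuousOn (fun x => f x β) Υ) :
    ∃ C, ∀ x, |Υ.indicator f x β| ≤ C := by
  obtain ⟨C, hC⟩ := hΥ.exists_bound_of_continuousOn hf
  refine ⟨max C 0, fun x => ?_⟩
  by_cases hx : x ∈ Υ
  · rw [Set.indicator_of_mem hx]; exact (hC x hx).trans (le_max_left _ _)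
  · rw [Set.indicator_of_notMem hx]; simp

lemma continuousOn_indicator_apply (hf : ∀ x ∈ Υ, ContinuousOn (f x) Γ)
    (x : EuclideanSpace ℝ (Fin p)) : ContinuousOn (Υ.indicator f x) Γ := by
  by_cases hx : x ∈ Υ
  · rw [Set.indicator_of_mem hx]; exact hf x hx
  · rw [Set.indicator_of_notMem hx]; exact continuousOn_const

/-- The regression function, set to zero off the domain of the covariates, has a second-order
expansion. -/
lemma exists_hasExpansion_indicator (hΥ : IsCompact Υ) {β₀ : EuclideanSpace ℝ (Fin d)}
    (hβ₀ : β₀ ∈ interior Γ)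
    (hf : ∀ x ∈ Υ, ContinuousOn (f x) Γ ∧ ∀ β ∈ interior Γ,
      DifferentiableAt ℝ (f x) β ∧ DifferentiableAt ℝ (gradient (f x)) β)
    (hfx : ∀ β ∈ Γ, ContinuousOn (fun x => f x β) Υ)
    (hbound : ∃ C : ℝ, ∀ᶠ β in 𝓝 β₀, ∀ x ∈ Υ,
      ‖gradient (f x) β‖ ≤ C ∧ ‖fderiv ℝ (gradient (f x)) β‖ ≤ C) :
    ∃ s C, HasExpansion (Υ.indicator f) β₀ s C (fun x => gradient (Υ.indicator f x) β₀)
      (fun a b x => fderiv ℝ (gradient (Υ.indicator f x)) β₀ (EuclideanSpace.single b 1) a) := by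
  obtain ⟨C, hC⟩ := hbound
  obtain ⟨s, hs, hs'⟩ := Metric.eventually_nhds_iff_ball.1
    (hC.and (isOpen_interior.mem_nhds hβ₀))
  have hint : ∀ β ∈ Metric.ball β₀ s, β ∈ interior Γ := fun β hβ => (hs' β hβ).2
  have hβs : β₀ ∈ Metric.ball β₀ s := Metric.mem_ball_self hs
  have hg0 : gradient (0 : EuclideanSpace ℝ (Fin d) → ℝ) = 0 := by
    ext1 β
    exact gradient_const β 0
  have hd : ∀ x, ∀ β ∈ Metric.ball β₀ s, DifferentiableAt ℝ (Υ.indicator f x) β := by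
    intro x β hβ
    by_cases hx : x ∈ Υ
    · rw [Set.indicator_of_mem hx]; exact ((hf x hx).2 β (hint β hβ)).1
    · rw [Set.indicator_of_notMem hx]; exact differentiableAt_const 0
  have hgd : ∀ x, ∀ β ∈ Metric.ball β₀ s, DifferentiableAt ℝ (gradient (Υ.indicator f x)) β := by
    intro x β hβ
    by_cases hx : x ∈ Υ
    · rw [Set.indicator_of_mem hx]; exact ((hf x hx).2 β (hint β hβ)).2
    · rw [Set.indicator_of_notMem hx, hg0]; exact differentiableAt_const 0
  have hb : ∀ x, ∀ β ∈ Metric.ball β₀ s, ‖gradient (Υ.indicator f x) β‖ ≤ max C 0 ∧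
      ‖fderiv ℝ (gradient (Υ.indicator f x)) β‖ ≤ max C 0 := by
    intro x β hβ
    by_cases hx : x ∈ Υ
    · rw [Set.indicator_of_mem hx]
      exact ⟨((hs' β hβ).1 x hx).1.trans (le_max_left _ _),
        ((hs' β hβ).1 x hx).2.trans (le_max_left _ _)⟩
    · rw [Set.indicator_of_notMem hx, hg0]
      simp
  have hm : ∀ β ∈ Metric.ball β₀ s, Measurable fun x => Υ.indicator f x β := fun β hβ =>
    measurable_indicator_apply_of_continuousOn hΥ (hfx β (interior_subset (hint β hβ)))
  have hgm : ∀ β ∈ Metric.ball β₀ s, Measurable fun x => gradient (Υ.indicator f x) β := by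
    intro β hβ
    have h1 : ∀ a, Measurable fun x => gradient (Υ.indicator f x) β a := by
      intro a
      have h2 := measurable_fderiv_apply_of_forall (Metric.isOpen_ball.mem_nhds hβ)
        (fun x => hd x β hβ) hm (EuclideanSpace.single a 1)
      have h3 : ∀ x, fderiv ℝ (Υ.indicator f x) β (EuclideanSpace.single a 1) =
          gradient (Υ.indicator f x) β a := fun x => by
        rw [fderiv_apply_eq_inner_gradient, EuclideanSpace.inner_single_right]
        simp
      simpa only [h3] using h2
    exact (PiLp.continuous_toLp 2 _).measurable.comp (measurable_pi_lambda _ h1)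
  refine ⟨s, max C 0, hs, le_max_right _ _, hgm β₀ hβs, fun a b => ?_, fun x => (hb x β₀ hβs).1,
    fun a b x => ?_, fun x => (continuousOn_indicator_apply (fun x hx => (hf x hx).1) x).mono
      fun β hβ => interior_subset (hint β hβ), hm, fun x θ hθ =>
      abs_sub_sub_inner_gradient_le (hd x) (hgd x) (fun β hβ => (hb x β hβ).2) hθ, fun x => ?_⟩
  · have h2 := measurable_fderiv_apply_of_forall (Metric.isOpen_ball.mem_nhds hβs)
      (fun x => hgd x β₀ hβs) hgm (EuclideanSpace.single b 1)
    fun_prop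
  · refine (PiLp.norm_apply_le (fderiv ℝ (gradient (Υ.indicator f x)) β₀
      (EuclideanSpace.single b 1)) a).trans ?_
    refine (ContinuousLinearMap.le_opNorm _ _).trans ?_
    simpa using (hb x β₀ hβs).2
  · simpa only [inner_apply_self_eq_sum] using
      isLittleO_sub_sub_inner_gradient hs (hd x) (hgd x β₀ hβs)

end Expansion

/-! ### The limit law for estimating functions with estimated weights -/

section Limit

variable {p d : ℕ} {S Ω : Type*} [MeasurableSpace S] [MeasurableSpace Ω] {P : Measure Ω}
  [IsProbabilityMeasure P] {Z : ℕ → Ω → S} {X : S → EuclideanSpace ℝ (Fin p)} {o : S → ℝ}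
  {π K : EuclideanSpace ℝ (Fin p) → ℝ} {c C₁ C₂ ρ : ℝ} {h : ℕ → ℝ}
  {F : EuclideanSpace ℝ (Fin p) → EuclideanSpace ℝ (Fin d) → ℝ}
  {β₀ : EuclideanSpace ℝ (Fin d)} {s C : ℝ}
  {G : EuclideanSpace ℝ (Fin p) → EuclideanSpace ℝ (Fin d)}
  {Hs : Fin d → Fin d → EuclideanSpace ℝ (Fin p) → ℝ}
  {e : S → ℝ} {b : ℕ → Ω → EuclideanSpace ℝ (Fin d)}
  {g : (n : ℕ) → Fin n → Ω → EuclideanSpace ℝ (Fin d)}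

/-- The limit law for estimating functions with estimated weights, for a root-`n` consistent
estimator of the parameter. -/
theorem empLogLik_tendsto_of_scoreErr (hZ : ∀ i, Measurable (Z i)) (hindep : iIndepFun Z P)
    (hident : ∀ i, IdentDistrib (Z i) (Z 0) P P) (hsel : IsSelection (P.map (Z 0)) X o π c)
    (hK : IsBallKernel K C₁ C₂ ρ) (hpos : ∀ n, 0 < h n) (hzero : Tendsto h atTop (𝓝 0))
    (hnh : Tendsto (fun n : ℕ => n * h n ^ p) atTop atTop) (hF : HasExpansion F β₀ s C G Hs)
    (hem : Measurable e) (heL : MemLp e 2 (P.map (Z 0))) (he0 : ∀ᵐ z ∂(P.map (Z 0)), e z ≠ 0)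
    (hmean : ∀ ψ : EuclideanSpace ℝ (Fin p) → ℝ, Measurable ψ →
      (∃ C, ∀ x, |ψ x| ≤ C) → ∫ a, e a * (o a * ψ (X a)) ∂(P.map (Z 0)) = 0)
    {L : ℝ} (hL : 0 < L)
    (hLle : ∀ u, L * ‖u‖ ^ 2 ≤ ∫ z, o z * inner ℝ u (G (X z)) ^ 2 ∂(P.map (Z 0)))
    (hb : Tendsto (fun a : ℕ × Ω => b a.1 a.2) (inProb P) (𝓝 β₀))
    (hbn : BddInProb P fun a => √(a.1 : ℝ) * ‖b a.1 a.2 - β₀‖)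
    (hgm : ∀ n i, Measurable (g n i))
    (hg : ∀ n (i : Fin n) ω, g n i ω = (o (Z i ω) * e (Z i ω) / π (X (Z i ω))) • G (X (Z i ω)) +
      scoreErr X o e π K F G β₀ (b n ω) (h n) (fun j : Fin n => Z j ω) i) :
    TendstoInDistribution (fun (n : ℕ) ω => empLogLik fun i : Fin n => g n i ω)
      atTop Real.toEReal (fun _ => P) (chiSquared d) := by
  have : IsProbabilityMeasure (P.map (Z 0)) :=
    Measure.isProbabilityMeasure_map (hZ 0).aemeasurable
  have hXm := hsel.measurable_cov
  have hom := hsel.measurable_obs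
  have hπm := hsel.measurable_sel
  have hGm := hF.measurable_grad
  have hc := hsel.pos
  have hπ0 : ∀ x, 0 < π x := fun x => hc.trans_le (hsel.le_sel x)
  have ho1 : ∀ z, |o z| ≤ 1 := fun z => by rcases hsel.obs_eq z with h | h <;> simp [h]
  set ζ : S → EuclideanSpace ℝ (Fin d) := fun z => (o z * e z / π (X z)) • G (X z) with hζ
  have hζm : Measurable ζ := by simp only [hζ]; fun_prop
  have hζL : MemLp ζ 2 (P.map (Z 0)) := by
    refine MemLp.of_le_mul (c := C / c) heL hζm.aestronglyMeasurable
      (Eventually.of_forall fun z => ?_)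
    simp only [hζ]
    rw [norm_smul, norm_div, norm_mul, Real.norm_of_nonneg (hπ0 _).le]
    calc ‖o z‖ * ‖e z‖ / π (X z) * ‖G (X z)‖ ≤ 1 * ‖e z‖ / c * C := by
          gcongr
          · exact ho1 z
          · exact hsel.le_sel _
          · exact hF.norm_grad_le _
      _ = C / c * ‖e z‖ := by ring
  have hζu : ∀ u : EuclideanSpace ℝ (Fin d), Measurable fun z => inner ℝ u (ζ z) := fun u => by
    fun_prop
  refine empLogLik_tendsto (ξ := fun i ω => ζ (Z i ω)) (hindep.comp (fun _ => ζ) fun _ => hζm)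
    (fun i => (hident i).comp hζm) (hζL.comp_measurePreserving ⟨hZ 0, rfl⟩) (fun u => ?_)
    (fun u hu => ?_) g hgm ?_ ?_
  · rw [← integral_map (f := fun z => inner ℝ u (ζ z)) (hZ 0).aemeasurable
      (hζu u).aestronglyMeasurable,
      ← hmean (fun x => (π x)⁻¹ * inner ℝ u (G x)) (by fun_prop) ⟨c⁻¹ * (‖u‖ * C), fun x => by
        rw [abs_mul, abs_of_nonneg (inv_nonneg.2 (hπ0 x).le)]
        have h1 : (π x)⁻¹ ≤ c⁻¹ := inv_anti₀ hc (hsel.le_sel x)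
        have h2 : |inner ℝ u (G x)| ≤ ‖u‖ * C :=
          (abs_real_inner_le_norm _ _).trans (by gcongr; exact hF.norm_grad_le x)
        gcongr⟩]
    refine integral_congr_ae (Eventually.of_forall fun z => ?_)
    simp only [hζ, real_inner_smul_right]
    ring
  · rw [← integral_map (f := fun z => inner ℝ u (ζ z) ^ 2) (hZ 0).aemeasurable
      ((hζu u).pow_const 2).aestronglyMeasurable]
    have hint : Integrable (fun z => inner ℝ u (ζ z) ^ 2) (P.map (Z 0)) :=
      (hζL.const_inner u).integrable_sq
    refine lt_of_le_of_ne (integral_nonneg fun z => sq_nonneg _) fun h0 => ?_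
    have h1 := (integral_eq_zero_iff_of_nonneg (fun z => sq_nonneg _) hint).1 h0.symm
    -- where the error does not vanish, neither does its multiple in the score
    have h2 : ∫ z, o z * inner ℝ u (G (X z)) ^ 2 ∂(P.map (Z 0)) = 0 := by
      refine integral_eq_zero_of_ae ?_
      filter_upwards [h1, he0] with z hz hez
      simp only [hζ, real_inner_smul_right, Pi.zero_apply] at hz ⊢
      rcases hsel.obs_eq z with h | h
      · rw [h, zero_mul]
      · rw [h, one_mul, sq_eq_zero_iff, mul_eq_zero] at hz
        rcases hz with hz | hz
        · exact absurd hz (div_ne_zero hez (hπ0 _).ne')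
        · rw [hz]; ring
    have h3 := hLle u
    rw [h2] at h3
    have : 0 < ‖u‖ := norm_pos_iff.2 hu
    exact absurd h3 (not_le.2 (by positivity))
  · simpa only [hg, hζ, add_sub_cancel_left] using
      tendsto_inProb_average_scoreErr_sq hZ hindep hident hsel hK hpos hzero hnh hF hem heL hb
  · simpa only [hg, hζ, add_sub_cancel_left] using
      tendsto_inProb_sqrt_sum_scoreErr hZ hindep hident hsel hK hpos hzero hnh hF hem heL hmean hb
        hbn

end Limit

/-! ### Data missing at random -/

section MissingAtRandom

variable {p d : ℕ} {Ω : Type*} {m₀ : MeasurableSpace Ω} {P : Measure Ω} [IsProbabilityMeasure P]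

lemma integral_mul_condExp {m : MeasurableSpace Ω} (hm : m ≤ m₀) {u v : Ω → ℝ}
    (hu : StronglyMeasurable[m] u) (hv : Integrable v P) (huv : Integrable (fun ω => u ω * v ω) P) :
    ∫ ω, u ω * (P[v | m]) ω ∂P = ∫ ω, u ω * v ω ∂P := by
  rw [← integral_condExp hm (f := fun ω => u ω * v ω)]
  exact integral_congr_ae (condExp_mul_of_stronglyMeasurable_left hu huv hv).symm

/-- The indicator of observation as a function of a unit `(x, ε, δ)`. -/
noncomputable def isObserved (z : EuclideanSpace ℝ (Fin p) × ℝ × ℝ) : ℝ :=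
  Set.indicator {z : EuclideanSpace ℝ (Fin p) × ℝ × ℝ | z.2.2 = 1} 1 z

/-- The selection probability, clamped to `[c, 1]`. At the covariate this changes nothing almost
surely, since `sel X` is a conditional probability. -/
noncomputable def clampedSel (sel : EuclideanSpace ℝ (Fin p) → ℝ) (c : ℝ)
    (x : EuclideanSpace ℝ (Fin p)) : ℝ :=
  max c (min (sel x) 1)

lemma measurable_isObserved : Measurable (isObserved (p := p)) :=
  measurable_one.indicator (measurableSet_eq_fun (by fun_prop) (by fun_prop))

lemma isObserved_eq (z : EuclideanSpace ℝ (Fin p) × ℝ × ℝ) :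
    isObserved z = 0 ∨ isObserved z = 1 := by
  by_cases hz : z.2.2 = 1 <;> simp [isObserved, hz]

variable {X : Ω → EuclideanSpace ℝ (Fin p)} {ε δ : Ω → ℝ} {sel : EuclideanSpace ℝ (Fin p) → ℝ}
  {c : ℝ}

lemma isObserved_comp : (fun ω => isObserved (X ω, ε ω, δ ω)) =
    Set.indicator {ω | δ ω = 1} fun _ => (1 : ℝ) := by
  ext ω
  by_cases hω : δ ω = 1 <;> simp [isObserved, hω]

lemma measurable_clampedSel (hsel : Measurable sel) : Measurable (clampedSel sel c) := by
  unfold clampedSel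
  fun_prop

lemma clampedSel_comp_ae_eq (hδ : Measurable δ)
    (hX : Measurable X)
    (hselX : P⟦{ω | δ ω = 1} | MeasurableSpace.comap X inferInstance⟧ =ᵐ[P] fun ω => sel (X ω))
    (hc : ∀ ω, c ≤ sel (X ω)) : (fun ω => clampedSel sel c (X ω)) =ᵐ[P]
      P⟦{ω | δ ω = 1} | MeasurableSpace.comap X inferInstance⟧ := by
  have hA : MeasurableSet {ω | δ ω = 1} := hδ (measurableSet_singleton 1)
  have h1 : P⟦{ω | δ ω = 1} | MeasurableSpace.comap X inferInstance⟧ ≤ᵐ[P]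
      P[fun _ => (1 : ℝ) | MeasurableSpace.comap X inferInstance] :=
    condExp_mono ((integrable_const _).indicator hA) (integrable_const _)
      (Eventually.of_forall fun ω => Set.indicator_le_self' (fun _ _ => zero_le_one) ω)
  rw [condExp_const hX.comap_le] at h1
  filter_upwards [h1, hselX] with ω h2 h3
  rw [h3] at h2 ⊢
  rw [clampedSel, min_eq_left h2, max_eq_right (hc ω)]

lemma isSelection_clampedSel (hX : Measurable X) (hε : Measurable ε) (hδ : Measurable δ)
    (hsel : Measurable sel)
    (hselX : P⟦{ω | δ ω = 1} | MeasurableSpace.comap X inferInstance⟧ =ᵐ[P] fun ω => sel (X ω))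
    (hc0 : 0 < c) (hc1 : c ≤ 1) (hc : ∀ ω, c ≤ sel (X ω)) :
    IsSelection (P.map fun ω => (X ω, ε ω, δ ω)) Prod.fst isObserved (clampedSel sel c) c where
  measurable_cov := measurable_fst
  measurable_obs := measurable_isObserved
  obs_eq := isObserved_eq
  measurable_sel := measurable_clampedSel hsel
  pos := hc0
  le_sel x := le_max_left _ _
  sel_le x := max_le hc1 (min_le_right _ _)
  integral_obs_mul φ hφ hφb := by
    obtain ⟨C, hC⟩ := hφb
    have hZ : Measurable fun ω => (X ω, ε ω, δ ω) := by fun_prop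
    have hA : MeasurableSet {ω | δ ω = 1} := hδ (measurableSet_singleton 1)
    have hom := measurable_isObserved (p := p)
    have hsm := measurable_clampedSel (c := c) hsel
    have hAint : Integrable (Set.indicator {ω | δ ω = 1} fun _ => (1 : ℝ)) P :=
      (integrable_const _).indicator hA
    have hφX : StronglyMeasurable[MeasurableSpace.comap X inferInstance] fun ω => φ (X ω) :=
      (hφ.comp (comap_measurable X)).stronglyMeasurable
    rw [integral_map hZ.aemeasurable (Measurable.aestronglyMeasurable (by fun_prop)),
      integral_map hZ.aemeasurable (Measurable.aestronglyMeasurable (by fun_prop))]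
    have h1 := integral_mul_condExp hX.comap_le hφX hAint
      (hAint.bdd_mul (c := C) (hφ.comp hX).aestronglyMeasurable
        (Eventually.of_forall fun ω => hC _))
    calc ∫ ω, isObserved (X ω, ε ω, δ ω) * φ (X ω) ∂P
        = ∫ ω, φ (X ω) * Set.indicator {ω | δ ω = 1} (fun _ => (1 : ℝ)) ω ∂P := by
          rw [← isObserved_comp (X := X) (ε := ε)]
          simp only [mul_comm]
      _ = _ := h1.symm
      _ = ∫ ω, clampedSel sel c (X ω) * φ (X ω) ∂P := by
          refine integral_congr_ae ?_
          filter_upwards [clampedSel_comp_ae_eq hδ hX hselX hc] with ω hω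
          rw [← hω, mul_comm]

/-- By the missing-at-random property the observed errors have conditional mean zero given the
covariate: the indicator of observation may be replaced by the selection probability. -/
lemma integral_error_mul_isObserved_mul {Y : Ω → ℝ} {F₀ : EuclideanSpace ℝ (Fin p) → ℝ}
    (hX : Measurable X) (hε : Measurable ε) (hδ : Measurable δ) (hsel : Measurable sel)
    (hF₀ : Measurable F₀) (hY : ∀ ω, Y ω = F₀ (X ω) + ε ω)
    (hMAR : P⟦{ω | δ ω = 1} | MeasurableSpace.comap (fun ω => (X ω, Y ω)) inferInstance⟧
      =ᵐ[P] P⟦{ω | δ ω = 1} | MeasurableSpace.comap X inferInstance⟧)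
    (hselX : P⟦{ω | δ ω = 1} | MeasurableSpace.comap X inferInstance⟧ =ᵐ[P] fun ω => sel (X ω))
    (hc0 : 0 < c) (hc1 : c ≤ 1) (hc : ∀ ω, c ≤ sel (X ω))
    (hεint : Integrable ε P)
    (hε0 : P[ε | MeasurableSpace.comap X inferInstance] =ᵐ[P] 0)
    {ψ : EuclideanSpace ℝ (Fin p) → ℝ} (hψ : Measurable ψ) (hψb : ∃ C, ∀ x, |ψ x| ≤ C) :
    ∫ z, z.2.1 * (isObserved z * ψ z.1) ∂(P.map fun ω => (X ω, ε ω, δ ω)) = 0 := by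
  obtain ⟨C, hC⟩ := hψb
  have hC0 : 0 ≤ C := (abs_nonneg _).trans (hC 0)
  have hZ : Measurable fun ω => (X ω, ε ω, δ ω) := by fun_prop
  have hom := measurable_isObserved (p := p)
  have hsm := measurable_clampedSel (c := c) hsel
  have hA : MeasurableSet {ω | δ ω = 1} := hδ (measurableSet_singleton 1)
  have hAint : Integrable (Set.indicator {ω | δ ω = 1} fun _ => (1 : ℝ)) P :=
    (integrable_const _).indicator hA
  have hYm : Measurable Y := by
    have : Y = fun ω => F₀ (X ω) + ε ω := funext hY
    rw [this]; fun_prop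
  have hXY : Measurable fun ω => (X ω, Y ω) := hX.prodMk hYm
  have hεψ : StronglyMeasurable[MeasurableSpace.comap (fun ω => (X ω, Y ω)) inferInstance]
      fun ω => ε ω * ψ (X ω) := by
    have h1 : (fun ω => ε ω * ψ (X ω)) =
        (fun q : EuclideanSpace ℝ (Fin p) × ℝ => (q.2 - F₀ q.1) * ψ q.1) ∘ fun ω => (X ω, Y ω) := by
      ext ω
      simp only [Function.comp_apply, hY, add_sub_cancel_left]
    rw [h1]
    exact Measurable.stronglyMeasurable
      (Measurable.comp (by fun_prop) (comap_measurable fun ω => (X ω, Y ω)))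
  have hεψi : Integrable (fun ω => ε ω * ψ (X ω)) P :=
    hεint.mul_bdd (c := C) (hψ.comp hX).aestronglyMeasurable (Eventually.of_forall fun ω => hC _)
  rw [integral_map hZ.aemeasurable (Measurable.aestronglyMeasurable (by fun_prop))]
  have h1 := integral_mul_condExp hXY.comap_le hεψ hAint
    (hεψi.mul_bdd (c := 1) hAint.aestronglyMeasurable (Eventually.of_forall fun ω => by
      by_cases hω : δ ω = 1 <;> simp [hω]))
  have hψπ : StronglyMeasurable[MeasurableSpace.comap X inferInstance]
      fun ω => ψ (X ω) * clampedSel sel c (X ω) :=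
    ((hψ.mul hsm).comp (comap_measurable X)).stronglyMeasurable
  have h2 := integral_mul_condExp hX.comap_le hψπ hεint
    (hεint.bdd_mul (c := C * 1) ((hψ.mul hsm).comp hX).aestronglyMeasurable
      (Eventually.of_forall fun ω => by
        rw [norm_mul]
        have h3 : 0 ≤ clampedSel sel c (X ω) := hc0.le.trans (le_max_left _ _)
        gcongr
        · exact hC _
        · rw [Real.norm_of_nonneg h3]
          exact max_le hc1 (min_le_right _ _)))
  calc ∫ ω, ε ω * (isObserved (X ω, ε ω, δ ω) * ψ (X ω)) ∂P
      = ∫ ω, ε ω * ψ (X ω) * Set.indicator {ω | δ ω = 1} (fun _ => (1 : ℝ)) ω ∂P := by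
        rw [← isObserved_comp (X := X) (ε := ε)]
        refine integral_congr_ae (Eventually.of_forall fun ω => ?_)
        simp only
        ring
    _ = _ := h1.symm
    _ = ∫ ω, ψ (X ω) * clampedSel sel c (X ω) * ε ω ∂P := by
        refine integral_congr_ae ?_
        filter_upwards [hMAR, clampedSel_comp_ae_eq hδ hX hselX hc] with ω h3 h4
        rw [h3, ← h4]
        ring
    _ = _ := h2.symm
    _ = 0 := by
        refine integral_eq_zero_of_ae ?_
        filter_upwards [hε0] with ω hω
        simp [hω]

end MissingAtRandom

/-! ### Consistency of the least squares estimator on the observed data -/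

section LeastSquares

variable {p d : ℕ} {S Ω : Type*} [MeasurableSpace S] [MeasurableSpace Ω] {P : Measure Ω}
  [IsProbabilityMeasure P] {Z : ℕ → Ω → S} {X : S → EuclideanSpace ℝ (Fin p)} {o : S → ℝ}
  {π : EuclideanSpace ℝ (Fin p) → ℝ} {c : ℝ}
  {F : EuclideanSpace ℝ (Fin p) → EuclideanSpace ℝ (Fin d) → ℝ}
  {Γ : Set (EuclideanSpace ℝ (Fin d))} {β₀ : EuclideanSpace ℝ (Fin d)}
  {e : S → ℝ} {b : ℕ → Ω → EuclideanSpace ℝ (Fin d)}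

/-- Consistency of the least squares estimator on the observed data: the expected sum of squares
at `β` exceeds the one at `β₀` by `E[π(X) (F(X, β₀) - F(X, β))²]`. -/
lemma tendsto_inProb_leastSquares (hZ : ∀ i, Measurable (Z i)) (hindep : iIndepFun Z P)
    (hident : ∀ i, IdentDistrib (Z i) (Z 0) P P) (hsel : IsSelection (P.map (Z 0)) X o π c)
    (hΓ : IsCompact Γ) (hβ₀ : β₀ ∈ Γ) (hFc : ∀ x, ContinuousOn (F x) Γ)
    (hFm : ∀ β ∈ Γ, Measurable fun x => F x β) (hFb : ∀ β ∈ Γ, ∃ C, ∀ x, |F x β| ≤ C)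
    (hid : ∀ β ∈ Γ, (∀ᵐ z ∂(P.map (Z 0)), F (X z) β = F (X z) β₀) → β = β₀)
    (hem : Measurable e) (heL : MemLp e 2 (P.map (Z 0)))
    (hmean : ∀ ψ : EuclideanSpace ℝ (Fin p) → ℝ, Measurable ψ →
      (∃ C, ∀ x, |ψ x| ≤ C) → ∫ a, e a * (o a * ψ (X a)) ∂(P.map (Z 0)) = 0)
    (hb : ∀ n ω, b n ω ∈ Γ)
    (hbmin : ∀ n ω, ∑ i : Fin n, o (Z i ω) * (F (X (Z i ω)) β₀ + e (Z i ω) -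
      F (X (Z i ω)) (b n ω)) ^ 2 ≤ ∑ i : Fin n, o (Z i ω) * e (Z i ω) ^ 2) :
    Tendsto (fun a : ℕ × Ω => b a.1 a.2) (inProb P) (𝓝 β₀) := by
  have : IsProbabilityMeasure (P.map (Z 0)) :=
    Measure.isProbabilityMeasure_map (hZ 0).aemeasurable
  have hXm := hsel.measurable_cov
  have hom := hsel.measurable_obs
  have hπm := hsel.measurable_sel
  have ho0 : ∀ z, 0 ≤ o z := fun z => by rcases hsel.obs_eq z with h | h <;> simp [h]
  have ho1 : ∀ z, ‖o z‖ ≤ 1 := fun z => by rcases hsel.obs_eq z with h | h <;> simp [h]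
  have hoe : Integrable (fun z => o z * e z ^ 2) (P.map (Z 0)) :=
    heL.integrable_sq.bdd_mul (c := 1) hom.aestronglyMeasurable (Eventually.of_forall ho1)
  have hDm : ∀ β ∈ Γ, Measurable fun x => F x β₀ - F x β := fun β hβ =>
    (hFm β₀ hβ₀).sub (hFm β hβ)
  have hDb : ∀ β ∈ Γ, ∃ C, ∀ x, |F x β₀ - F x β| ≤ C := fun β hβ => by
    obtain ⟨A, hA⟩ := hFb β hβ
    obtain ⟨B, hB⟩ := hFb β₀ hβ₀
    exact ⟨B + A, fun x => (abs_sub _ _).trans (add_le_add (hB x) (hA x))⟩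
  have hexp : ∀ z β, o z * (F (X z) β₀ + e z - F (X z) β) ^ 2 = o z * e z ^ 2 +
      2 * (e z * (o z * (F (X z) β₀ - F (X z) β))) + o z * (F (X z) β₀ - F (X z) β) ^ 2 :=
    fun z β => by ring
  have hcross : ∀ β ∈ Γ, Integrable (fun z => e z * (o z * (F (X z) β₀ - F (X z) β)))
      (P.map (Z 0)) := fun β hβ => by
    obtain ⟨C, hC⟩ := hDb β hβ
    refine (heL.integrable one_le_two).mul_bdd (c := 1 * C)
      (hom.mul ((hDm β hβ).comp hXm)).aestronglyMeasurable (Eventually.of_forall fun z => ?_)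
    rw [norm_mul]
    gcongr
    · exact ho1 z
    · exact hC _
  have hsqb : ∀ β ∈ Γ, ∃ C, ∀ x, |(F x β₀ - F x β) ^ 2| ≤ C := fun β hβ => by
    obtain ⟨C, hC⟩ := hDb β hβ
    refine ⟨C ^ 2, fun x => ?_⟩
    rw [abs_pow]
    gcongr
    exact hC x
  have hsqi : ∀ β ∈ Γ, ∀ u : S → ℝ, Measurable u → (∀ z, ‖u z‖ ≤ 1) →
      Integrable (fun z => u z * (F (X z) β₀ - F (X z) β) ^ 2) (P.map (Z 0)) := by
    intro β hβ u hu hu1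
    obtain ⟨C, hC⟩ := hsqb β hβ
    have hm : Measurable fun z => (F (X z) β₀ - F (X z) β) ^ 2 :=
      ((hDm β hβ).comp hXm).pow_const 2
    refine (integrable_const (1 * C)).mono' (hu.mul hm).aestronglyMeasurable
      (Eventually.of_forall fun z => ?_)
    rw [norm_mul]
    gcongr
    · exact hu1 z
    · exact hC _
  have hπ1 : ∀ z, ‖π (X z)‖ ≤ 1 := fun z => by
    rw [Real.norm_of_nonneg (hsel.pos.le.trans (hsel.le_sel _))]; exact hsel.sel_le _
  refine tendsto_inProb_of_contrast hZ hindep hident hΓ hβ₀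
    (m := fun z β => o z * (F (X z) β₀ + e z - F (X z) β) ^ 2) (fun β hβ => ?_)
    (fun z β => mul_nonneg (ho0 z) (sq_nonneg _)) (fun z => ?_) (fun β hβ => ?_)
    (fun β hβ hne => ?_) hb (fun n ω => ?_)
  · have h1 := (hFm β hβ).comp hXm
    have h2 := (hFm β₀ hβ₀).comp hXm
    exact hom.mul (((h2.add hem).sub h1).pow_const 2)
  · exact continuousOn_const.mul ((continuousOn_const.sub (hFc _)).pow 2)
  · simp only [hexp]
    exact (hoe.add ((hcross β hβ).const_mul 2)).add (hsqi β hβ o hom ho1)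
  · simp only [hexp]
    have i2 : Integrable (fun z => 2 * (e z * (o z * (F (X z) β₀ - F (X z) β)))) (P.map (Z 0)) :=
      (hcross β hβ).const_mul 2
    have i12 : Integrable (fun z => o z * e z ^ 2 +
        2 * (e z * (o z * (F (X z) β₀ - F (X z) β)))) (P.map (Z 0)) := hoe.add i2
    rw [integral_add i12 (hsqi β hβ o hom ho1), integral_add hoe i2, integral_const_mul,
      hmean _ (hDm β hβ) (hDb β hβ), hsel.integral_obs_mul (fun x => (F x β₀ - F x β) ^ 2)
        ((hDm β hβ).pow_const 2) (hsqb β hβ)]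
    simp only [sub_self, mul_zero, add_zero, ne_eq, OfNat.ofNat_ne_zero, not_false_eq_true,
      zero_pow]
    have hnn : ∀ z, 0 ≤ π (X z) * (F (X z) β₀ - F (X z) β) ^ 2 := fun z =>
      mul_nonneg (hsel.pos.le.trans (hsel.le_sel _)) (sq_nonneg _)
    refine lt_add_of_pos_right _ (lt_of_le_of_ne (integral_nonneg hnn) fun h0 => hne ?_)
    have h1 := (integral_eq_zero_iff_of_nonneg hnn
      (hsqi β hβ (fun z => π (X z)) (hπm.comp hXm) hπ1)).1 h0.symm
    refine hid β hβ ?_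
    filter_upwards [h1] with z hz
    have h2 := (mul_eq_zero.1 hz).resolve_left (hsel.pos.trans_le (hsel.le_sel _)).ne'
    exact (sub_eq_zero.1 (sq_eq_zero_iff.1 h2)).symm
  · simpa only [add_sub_cancel_left] using hbmin n ω

lemma exists_pos_mul_norm_sq_le {A : Matrix (Fin d) (Fin d) ℝ} (hA : A.PosDef) :
    ∃ L > 0, ∀ u : EuclideanSpace ℝ (Fin d), L * ‖u‖ ^ 2 ≤ ∑ j, ∑ k, u j * u k * A j k := by
  set Q : EuclideanSpace ℝ (Fin d) → ℝ := fun u => ∑ j, ∑ k, u j * u k * A j k with hQ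
  have hQc : Continuous Q := by simp only [hQ]; fun_prop
  have hQpos : ∀ u, u ≠ 0 → 0 < Q u := by
    intro u hu
    have h1 : u.ofLp ≠ 0 := fun h => hu (by ext j; simp [h])
    have h2 := hA.dotProduct_mulVec_pos h1
    refine h2.trans_eq ?_
    simp only [hQ, dotProduct, Matrix.mulVec, Pi.star_apply, star_trivial]
    refine Finset.sum_congr rfl fun j _ => ?_
    rw [Finset.mul_sum]
    exact Finset.sum_congr rfl fun k _ => by ring
  have hQsmul : ∀ (t : ℝ) u, Q (t • u) = t ^ 2 * Q u := by
    intro t u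
    simp only [hQ, PiLp.smul_apply, smul_eq_mul, Finset.mul_sum]
    exact Finset.sum_congr rfl fun j _ => Finset.sum_congr rfl fun k _ => by ring
  rcases (Metric.sphere (0 : EuclideanSpace ℝ (Fin d)) 1).eq_empty_or_nonempty with h0 | h0
  · refine ⟨1, one_pos, fun u => ?_⟩
    rcases eq_or_ne u 0 with rfl | hu
    · simp
    · have : ‖u‖⁻¹ • u ∈ Metric.sphere (0 : EuclideanSpace ℝ (Fin d)) 1 := by
        rw [mem_sphere_zero_iff_norm, norm_smul, norm_inv, norm_norm,
          inv_mul_cancel₀ (norm_ne_zero_iff.2 hu)]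
      rw [h0] at this
      exact this.elim
  · obtain ⟨v, hv, hmin⟩ := (isCompact_sphere (0 : EuclideanSpace ℝ (Fin d)) 1).exists_isMinOn h0
      hQc.continuousOn
    have hv0 : v ≠ 0 := by
      rintro rfl
      simp at hv
    refine ⟨Q v, hQpos v hv0, fun u => ?_⟩
    rcases eq_or_ne u 0 with rfl | hu
    · simp
    · have hu' : ‖u‖ ≠ 0 := norm_ne_zero_iff.2 hu
      have h1 : ‖u‖⁻¹ • u ∈ Metric.sphere (0 : EuclideanSpace ℝ (Fin d)) 1 := by
        rw [mem_sphere_zero_iff_norm, norm_smul, norm_inv, norm_norm, inv_mul_cancel₀ hu']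
      have h2 : Q v ≤ Q (‖u‖⁻¹ • u) := hmin h1
      rw [hQsmul] at h2
      calc Q v * ‖u‖ ^ 2 ≤ ‖u‖⁻¹ ^ 2 * Q u * ‖u‖ ^ 2 := by gcongr
        _ = Q u := by field_simp

end LeastSquares

/-! ### The asymptotic law of the empirical likelihood ratio -/

lemma tendsto_nat_mul_pow_atTop {p q : ℕ} (hq : p ≤ 2 * q) {h M : ℕ → ℝ} (hpos : ∀ n, 0 < h n)
    (hzero : Tendsto h atTop (𝓝 0)) (hMtop : Tendsto M atTop atTop)
    (H : Tendsto (fun n : ℕ => n * h n ^ (2 * q) / M n ^ (2 * q)) atTop atTop) :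
    Tendsto (fun n : ℕ => n * h n ^ p) atTop atTop := by
  refine tendsto_atTop_mono' atTop ?_ H
  filter_upwards [hzero.eventually (gt_mem_nhds one_pos), hMtop.eventually_ge_atTop 1]
    with n hn hM
  have h0 := (hpos n).le
  calc (n : ℝ) * h n ^ (2 * q) / M n ^ (2 * q) ≤ n * h n ^ (2 * q) :=
        div_le_self (by positivity) (one_le_pow₀ hM)
    _ ≤ n * h n ^ p :=
        mul_le_mul_of_nonneg_left (pow_le_pow_of_le_one h0 hn.le hq) (Nat.cast_nonneg n)

theorem theorem5 {Ω : Type*} [MeasurableSpace Ω] (P : Measure Ω) [IsProbabilityMeasure P]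
    (p d : ℕ)
    -- the domains and the regression function
    (Υ : Set (EuclideanSpace ℝ (Fin p))) (Γ : Set (EuclideanSpace ℝ (Fin d)))
    (hΥ : IsCompact Υ) (hΓ : IsCompact Γ)
    (f : EuclideanSpace ℝ (Fin p) → EuclideanSpace ℝ (Fin d) → ℝ)
    (β₀ : EuclideanSpace ℝ (Fin d)) (hβ₀ : β₀ ∈ interior Γ)
    -- covariates, errors, indicators of observation; the response is `f (X i) β₀ + ε i`
    (X : ℕ → Ω → EuclideanSpace ℝ (Fin p)) (ε δ Y : ℕ → Ω → ℝ)
    (hX : ∀ i, Measurable (X i)) (hε : ∀ i, Measurable (ε i)) (hδ : ∀ i, Measurable (δ i))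
    (hXΥ : ∀ i ω, X i ω ∈ Υ) (hδ01 : ∀ i ω, δ i ω = 0 ∨ δ i ω = 1)
    (hY : ∀ i ω, Y i ω = f (X i ω) β₀ + ε i ω)
    (hindep : iIndepFun (fun i ω => (X i ω, ε i ω, δ i ω)) P)
    (hident : ∀ i, IdentDistrib (fun ω => (X i ω, ε i ω, δ i ω))
      (fun ω => (X 0 ω, ε 0 ω, δ 0 ω)) P P)
    (hcont : P.map (fun ω => (ε 0 ω, X 0 ω)) ≪ volume)
    -- identifiability
    (hid : ∀ β ∈ Γ, ∀ β' ∈ Γ, (∀ᵐ ω ∂P, f (X 0 ω) β = f (X 0 ω) β') → β = β')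
    -- missing at random, and the selection probability function
    (sel : EuclideanSpace ℝ (Fin p) → ℝ) (hsel : Measurable sel)
    (hMAR : ∀ i, P⟦{ω | δ i ω = 1} | MeasurableSpace.comap (fun ω => (X i ω, Y i ω)) inferInstance⟧
      =ᵐ[P] P⟦{ω | δ i ω = 1} | MeasurableSpace.comap (X i) inferInstance⟧)
    (hselX : ∀ i, P⟦{ω | δ i ω = 1} | MeasurableSpace.comap (X i) inferInstance⟧
      =ᵐ[P] fun ω => sel (X i ω))
    (hselpos : ∃ c > 0, ∀ x ∈ Υ, c ≤ sel x)
    -- the least squares estimator on the completely observed data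
    (βLS : ℕ → Ω → EuclideanSpace ℝ (Fin d)) (hβLSmeas : ∀ n, Measurable (βLS n))
    (hβLS : ∀ n ω, βLS n ω ∈ Γ ∧ IsMinOn
      (sumSq f (fun i : Fin n => X i ω) (fun i => Y i ω) (fun i => δ i ω)) Γ (βLS n ω))
    -- kernel, bandwidth, and the dimension `q` in the conditions on them
    (K : EuclideanSpace ℝ (Fin p) → ℝ) (hK : Measurable K)
    (h : ℕ → ℝ) (hpos : ∀ n, 0 < h n) (hzero : Tendsto h atTop (𝓝 0))
    (M : ℕ → ℝ) (hMpos : ∀ n, 0 < M n) (hMtop : Tendsto M atTop atTop)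
    (q : ℕ) (hq : p ≤ 2 * q)
    (H1 : ∀ i, MemLp (ε i) 2 P ∧ P[ε i | MeasurableSpace.comap (X i) inferInstance] =ᵐ[P] 0)
    (H2 : (∀ x ∈ Υ, ContinuousOn (f x) Γ ∧ ∀ β ∈ interior Γ,
        DifferentiableAt ℝ (f x) β ∧ DifferentiableAt ℝ (gradient (f x)) β) ∧
      ∀ β ∈ Γ, ContinuousOn (fun x => f x β) Υ)
    (H3 : ∀ M' : ℕ → ℝ, (∀ n, 0 < M' n) → Tendsto M' atTop atTop →
      (fun n => P.real {ω | M' n < ‖X 0 ω‖}) =o[atTop] fun n : ℕ => (n : ℝ) ^ (-(1 / 2) : ℝ))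
    (H4 : ∃ C : ℝ, ∀ᶠ β in 𝓝 β₀, ∀ x ∈ Υ,
      ‖gradient (f x) β‖ ≤ C ∧ ‖fderiv ℝ (gradient (f x)) β‖ ≤ C)
    (HA : (Matrix.of fun a b : Fin d => ∫ ω, sel (X 0 ω) *
      (gradient (f (X 0 ω)) β₀ a * gradient (f (X 0 ω)) β₀ b) ∂P).PosDef)
    (H5 : Tendsto (fun n : ℕ => n * h n ^ (2 * q) / M n ^ (2 * q)) atTop atTop ∧
      Tendsto (fun n : ℕ => n * h n ^ (4 * max 2 (q - 1))) atTop (𝓝 0))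
    (H6 : ∃ C₁ > 0, ∃ C₂ > 0, ∃ ρ > 0, ∀ u,
      C₁ * (Metric.closedBall 0 ρ).indicator 1 u ≤ K u ∧
      K u ≤ C₂ * (Metric.closedBall 0 ρ).indicator 1 u)
    (H7 : HasBoundedPartialsAE sel (interior Υ) (max 2 (q - 1))) :
    TendstoInDistribution
      (fun (n : ℕ) ω => empLogLik fun i : Fin n => gImputed f K (h n)
        (fun j : Fin n => X j ω) (fun j => Y j ω) (fun j => δ j ω) (βLS n ω) β₀ i)
      atTop Real.toEReal (fun _ => P) (chiSquared d) := by
  classical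
  obtain ⟨c₀, hc₀, hsel_ge⟩ := hselpos
  obtain ⟨C₁, hC₁, C₂, hC₂, ρ, hρ, hKb⟩ := H6
  set c := min c₀ 1 with hc
  have hcpos : 0 < c := lt_min hc₀ one_pos
  have hc1 : c ≤ 1 := min_le_right _ _
  have hcsel : ∀ ω, c ≤ sel (X 0 ω) := fun ω => (min_le_left _ _).trans (hsel_ge _ (hXΥ 0 ω))
  have hβ₀Γ : β₀ ∈ Γ := interior_subset hβ₀
  -- off `Υ` the regression function is set to zero, so that its regularity holds at all covariates
  set F := Υ.indicator f with hFdef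
  set Z : ℕ → Ω → EuclideanSpace ℝ (Fin p) × ℝ × ℝ := fun i ω => (X i ω, ε i ω, δ i ω) with hZdef
  have hFX : ∀ i ω, F (X i ω) = f (X i ω) := fun i ω => Set.indicator_of_mem (hXΥ i ω) f
  have hδo : ∀ i ω, isObserved (Z i ω) = δ i ω := fun i ω => by
    rcases hδ01 i ω with h | h <;> simp [isObserved, hZdef, h]
  have hZ : ∀ i, Measurable (Z i) := fun i => (hX i).prodMk ((hε i).prodMk (hδ i))
  have hK' : IsBallKernel K C₁ C₂ ρ := ⟨hK, hC₁, hρ, fun u => (hKb u).1, fun u => (hKb u).2⟩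
  have hS : IsSelection (P.map (Z 0)) Prod.fst isObserved (clampedSel sel c) c :=
    isSelection_clampedSel (hX 0) (hε 0) (hδ 0) hsel (hselX 0) hcpos hc1 hcsel
  have hFm : ∀ β ∈ Γ, Measurable fun x => F x β := fun β hβ =>
    measurable_indicator_apply_of_continuousOn hΥ (H2.2 β hβ)
  have hFc : ∀ x, ContinuousOn (F x) Γ := continuousOn_indicator_apply fun x hx => (H2.1 x hx).1
  have hFb : ∀ β ∈ Γ, ∃ C, ∀ x, |F x β| ≤ C := fun β hβ =>
    exists_abs_indicator_apply_le hΥ (H2.2 β hβ)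
  have hem : Measurable fun z : EuclideanSpace ℝ (Fin p) × ℝ × ℝ => z.2.1 := by fun_prop
  have heL : MemLp (fun z : EuclideanSpace ℝ (Fin p) × ℝ × ℝ => z.2.1) 2 (P.map (Z 0)) :=
    (memLp_map_measure_iff hem.aestronglyMeasurable (hZ 0).aemeasurable).2 (H1 0).1
  have hmean : ∀ ψ : EuclideanSpace ℝ (Fin p) → ℝ, Measurable ψ → (∃ C, ∀ x, |ψ x| ≤ C) →
      ∫ z, z.2.1 * (isObserved z * ψ z.1) ∂(P.map (Z 0)) = 0 := fun ψ hψ hψb =>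
    integral_error_mul_isObserved_mul (Y := Y 0) (F₀ := fun x => F x β₀) (hX 0) (hε 0) (hδ 0) hsel
      (hFm β₀ hβ₀Γ) (fun ω => by rw [hFX]; exact hY 0 ω) (hMAR 0) (hselX 0) hcpos hc1 hcsel
      ((H1 0).1.integrable one_le_two) (H1 0).2 hψ hψb
  -- the errors do not vanish, as their joint law with the covariates has a density
  have he0 : ∀ᵐ z ∂(P.map (Z 0)), z.2.1 ≠ 0 := by
    have hmeas : MeasurableSet {z : EuclideanSpace ℝ (Fin p) × ℝ × ℝ | z.2.1 ≠ 0} :=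
      (hem (measurableSet_singleton 0)).compl
    rw [ae_map_iff (hZ 0).aemeasurable hmeas]
    have h1 : (volume : Measure (ℝ × EuclideanSpace ℝ (Fin p))) {q | q.1 = 0} = 0 := by
      have h2 : {q : ℝ × EuclideanSpace ℝ (Fin p) | q.1 = 0} = {0} ×ˢ Set.univ := by
        ext q; simp
      rw [h2, Measure.volume_eq_prod, Measure.prod_prod]
      simp
    have h3 := hcont h1
    rw [Measure.map_apply ((hε 0).prodMk (hX 0))
      (measurableSet_eq_fun measurable_fst measurable_const)] at h3
    exact measure_eq_zero_iff_ae_notMem.1 h3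
  obtain ⟨s, C, hF⟩ := exists_hasExpansion_indicator hΥ hβ₀ H2.1 H2.2 H4
  rw [← hFdef] at hF
  obtain ⟨L, hL, hLle⟩ := exists_pos_mul_norm_sq_le HA
  have hLle' : ∀ u : EuclideanSpace ℝ (Fin d), L * ‖u‖ ^ 2 ≤
      ∫ z, isObserved z * inner ℝ u (gradient (F z.1) β₀) ^ 2 ∂(P.map (Z 0)) := by
    intro u
    refine (hLle u).trans_eq ?_
    have hGm := hF.measurable_grad
    rw [hS.integral_obs_mul (fun x => inner ℝ u (gradient (F x) β₀) ^ 2) (by fun_prop)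
      ⟨(‖u‖ * C) ^ 2, fun x => by
        rw [abs_pow]
        gcongr
        exact (abs_real_inner_le_norm _ _).trans (by gcongr; exact hF.norm_grad_le x)⟩]
    have hsm := measurable_clampedSel (c := c) hsel
    have hGu : Measurable fun x => inner ℝ u (gradient (F x) β₀) ^ 2 :=
      (measurable_const.inner hGm).pow_const 2
    have hmap : AEStronglyMeasurable (fun z : EuclideanSpace ℝ (Fin p) × ℝ × ℝ =>
        clampedSel sel c z.1 * inner ℝ u (gradient (F z.1) β₀) ^ 2) (P.map (Z 0)) :=
      ((hsm.mul hGu).comp measurable_fst).aestronglyMeasurable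
    rw [integral_map (hZ 0).aemeasurable hmap]
    set G : Ω → EuclideanSpace ℝ (Fin d) := fun ω => gradient (F (X 0 ω)) β₀ with hG
    have hGXm : Measurable G := hGm.comp (hX 0)
    have hwm : Measurable fun ω => clampedSel sel c (X 0 ω) := hsm.comp (hX 0)
    have hint : ∀ j k, Integrable (fun ω => clampedSel sel c (X 0 ω) * (G ω j * G ω k)) P := by
      intro j k
      refine (integrable_const (1 * (C * C))).mono' (by fun_prop)
        (Eventually.of_forall fun ω => ?_)
      rw [norm_mul, norm_mul]
      have h1 : ‖clampedSel sel c (X 0 ω)‖ ≤ 1 := by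
        rw [Real.norm_of_nonneg (hcpos.le.trans (hS.le_sel _))]
        exact hS.sel_le _
      have h2 : ∀ j, ‖G ω j‖ ≤ C := fun j =>
        (PiLp.norm_apply_le (G ω) j).trans (hF.norm_grad_le _)
      have h3 := hF.const_nonneg
      gcongr
      · exact h2 j
      · exact h2 k
    have hA : ∀ j k, ∫ ω, sel (X 0 ω) *
        (gradient (f (X 0 ω)) β₀ j * gradient (f (X 0 ω)) β₀ k) ∂P =
        ∫ ω, clampedSel sel c (X 0 ω) * (G ω j * G ω k) ∂P := by
      intro j k
      refine integral_congr_ae ?_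
      filter_upwards [(clampedSel_comp_ae_eq (hδ 0) (hX 0) (hselX 0) hcsel).trans (hselX 0)]
        with ω hω
      simp only [hG, hω, hFX]
    simp only [Matrix.of_apply, hA, ← integral_const_mul]
    have hsum : ∀ j, ∑ k, ∫ ω, u j * u k * (clampedSel sel c (X 0 ω) * (G ω j * G ω k)) ∂P =
        ∫ ω, ∑ k, u j * u k * (clampedSel sel c (X 0 ω) * (G ω j * G ω k)) ∂P := fun j =>
      (integral_finsetSum _ fun (k : Fin d) _ => (hint j k).const_mul (u j * u k)).symm
    simp only [hsum]
    rw [← integral_finsetSum _ fun (j : Fin d) _ => integrable_finsetSum _ fun (k : Fin d) _ =>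
      (hint j k).const_mul (u j * u k)]
    refine integral_congr_ae (Eventually.of_forall fun ω => ?_)
    have h1 : inner ℝ u (G ω) = ∑ j, u j * G ω j := by
      rw [PiLp.inner_apply]
      exact Finset.sum_congr rfl fun j _ => by simp [mul_comm]
    show _ = clampedSel sel c (X 0 ω) * inner ℝ u (G ω) ^ 2
    rw [h1, sq, Finset.sum_mul_sum, Finset.mul_sum]
    refine Finset.sum_congr rfl fun j _ => ?_
    rw [Finset.mul_sum]
    exact Finset.sum_congr rfl fun k _ => by ring
  have hbmin : ∀ n ω, ∑ i : Fin n, isObserved (Z i ω) * (F (Z i ω).1 β₀ + (Z i ω).2.1 -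
      F (Z i ω).1 (βLS n ω)) ^ 2 ≤ ∑ i : Fin n, isObserved (Z i ω) * (Z i ω).2.1 ^ 2 := by
    intro n ω
    have h1 := (hβLS n ω).2 hβ₀Γ
    simp only [Set.mem_ofPred_eq, sumSq, hY, add_sub_cancel_left] at h1
    simp only [hδo]
    simp only [hZdef, hFX]
    exact h1
  have hid' : ∀ β ∈ Γ, (∀ᵐ z ∂(P.map (Z 0)), F z.1 β = F z.1 β₀) → β = β₀ := by
    intro β hβ h1
    refine hid β hβ β₀ hβ₀Γ ?_
    filter_upwards [ae_of_ae_map (hZ 0).aemeasurable h1] with ω hω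
    simpa only [hZdef, hFX] using hω
  have hnh := tendsto_nat_mul_pow_atTop hq hpos hzero hMtop H5.1
  have hb := tendsto_inProb_leastSquares hZ hindep hident hS hΓ hβ₀Γ hFc hFm hFb hid' hem heL hmean
    (fun n ω => (hβLS n ω).1) hbmin
  have hbn := bddInProb_sqrt_mul_norm_sub hZ hindep hident hS hF hem heL hmean hL hLle' hb hbmin
  have hFXb : ∀ n i, Measurable fun ω => F (X i ω) (βLS n ω) := by
    intro n i
    have h1 : Measurable (Function.uncurry fun (β : Γ) (x : EuclideanSpace ℝ (Fin p)) => F x β) :=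
      measurable_uncurry_of_continuous_of_measurable
        (fun x => continuousOn_iff_continuous_domRestrict.1 (hFc x)) fun β => hFm β β.2
    exact h1.comp (((hβLSmeas n).subtype_mk (h := fun ω => (hβLS n ω).1)).prodMk (hX i))
  set g : (n : ℕ) → Fin n → Ω → EuclideanSpace ℝ (Fin d) := fun n i ω => gImputed f K (h n)
    (fun j : Fin n => X j ω) (fun j => Y j ω) (fun j => δ j ω) (βLS n ω) β₀ i with hgdef
  have hg : ∀ n (i : Fin n) ω, g n i ω = (isObserved (Z i ω) * (Z i ω).2.1 /
      clampedSel sel c (Z i ω).1) • gradient (F (Z i ω).1) β₀ +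
      scoreErr Prod.fst isObserved (fun z => z.2.1) (clampedSel sel c) K F
        (fun x => gradient (F x) β₀) β₀ (βLS n ω) (h n) (fun j : Fin n => Z j ω) i := by
    intro n i ω
    simp only [hgdef, gImputed, imputed, scoreErr, weightErr, hδo, hY]
    simp only [hZdef, hFX]
    rw [← add_smul]
    congr 1
    ring
  refine empLogLik_tendsto_of_scoreErr hZ hindep hident hS hK' hpos hzero hnh hF hem heL he0 hmean
      hL
    hLle' hb hbn (fun n i => ?_) hg
  have hGm := hF.measurable_grad
  have hsm := measurable_clampedSel (c := c) hsel
  have h1 := (measurable_weightErr measurable_fst measurable_isObserved hsm hK (h n) n i).comp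
    (measurable_pi_lambda (fun ω (j : Fin n) => Z j ω) fun j => hZ j)
  simp only [Function.comp_def] at h1
  have h2 := hFXb n i
  have h3 : Measurable fun ω => F (X i ω) β₀ := (hFm β₀ hβ₀Γ).comp (hX i)
  have h4 : Measurable fun ω => gradient (F (X i ω)) β₀ := hGm.comp (hX i)
  have h5 := hX i
  have h6 := hε i
  have h7 := hδ i
  have h8 : g n i = fun ω => _ := funext fun ω => hg n i ω
  have h9 : Measurable (g n i) := by
    rw [h8]
    simp only [scoreErr, hδo]
    have h10 := hsm.comp h5
    exact (((h7.mul h6).div h10).smul h4).add (((h6.mul h1).add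
      (((measurable_const.sub (h7.div h10)).sub h1).mul (h2.sub h3))).smul h4)
  exact h9
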